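/- **Correlation of interference.** Let $\lambda_p>0$, $d>0$, $\alpha>2$, $m>0$. Potential senders form a homogeneous Poisson point process $\Phi_p\subset\mathbb R^2$ of intensity $\lambda_p$. In every time slot $t\in\mathbb Z$ each $x\in\Phi_p$ has a mark $m_{x,t}$, uniform on $[0,1]$, and a fading coefficient $h_{x,t}^2$, gamma distributed with shape $m$ and scale $1/m$; all marks and fading coefficients (over points and slots) are independent of each other and of $\Phi_p$. The point $x$ sends in slot $t$ (indicator $\gamma_x(t)=1$) if and only if $m_{x,t}<m_{y,t}$ for all other $y\in\Phi_p$ with $\|x-y\|\le d$ (Matérn type II thinning). With the path gain $\ell(r)=\min(1,r^{-\alpha})$ (and $\ell(0)=1$), the interference at the origin in slot $t$ is $I_t=\sum_{x\in\Phi_p}h_{x,t}^2\,\ell(\|x\|)\,\gamma_x(t)$. Put $c=\pi d^2$; $\gamma(r)=2d^2\arccos\frac{r}{2d}-\frac r2\sqrt{4d^2-r^2}$ for $0\le r\le 2d$ and $\gamma(r)=0$ for $r>2d$; $\Gamma(r)=2c-\gamma(r)$; and, with $\mathrm{Ei}$ the exponential integral and $\gamma_{\rm eul}$ Euler's constant,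 $$p_1=\frac{1-e^{-\lambda_p c}}{\lambda_p c},\qquad \lambda=\lambda_p p_1,\qquad p_{12}=\frac{e^{-\lambda_p c}\big(\mathrm{Ei}(\lambda_p c)-\log(\lambda_p c)-\gamma_{\rm eul}\big)}{\lambda_p c},$$ $$\rho^{(2)}(r)=\lambda_p^2\,p_{1/1}(r),\qquad p_{1/1}(r)=\frac{2\Gamma(r)(1-e^{-\lambda_p c})}{\lambda_p^2c\,\Gamma(r)(\Gamma(r)-c)}-\frac{2(1-e^{-\lambda_p\Gamma(r)})}{\lambda_p^2\Gamma(r)(\Gamma(r)-c)}\ \ (r>d),\qquad p_{1/1}(r)=0\ \ (r\le d).$$ Writing $g=\gamma(r)$, let $p_{1/2}(r)=p_1^2$ for $r\ge 2d$, $$p_{1/2}(r)=\frac{e^{-\lambda_pc^2/g}}{\lambda_p g}\Big(\mathrm{Ei}\big(\tfrac{\lambda_pc^2}{g}\big)+\mathrm{Ei}\big(\tfrac{\lambda_p(g-c)^2}{g}\big)-2\,\mathrm{Ei}\big(\lambda_pc(\tfrac cg-1)\big)\Big)\quad(d\le r<2d),$$ and for $0<r<d$ $$p_{1/2}(r)=\frac{e^{-\lambda_pc(2+c/g)}}{c\lambda_p^2g^3}\Big(c\,e^{2\lambda_pc}\big(g(1+2\lambda_pc-\lambda_pg)-\lambda_pc^2\big)\Big(2\,\mathrm{Ei}\big(\lambda_pc(\tfrac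 cg-1)\big)-\mathrm{Ei}\big(\tfrac{\lambda_pc^2}{g}\big)-\mathrm{Ei}\big(\tfrac{\lambda_p(g-c)^2}{g}\big)\Big)$$ $$\qquad-\,g\,e^{\lambda_pc^2/g}\big(c\,e^{\lambda_pg}+e^{2\lambda_pc}(c-2g)-2e^{\lambda_pc}(c-g)\big)\Big).$$ Finally let $$E(r)=\int_0^\infty\!\!\int_0^{2\pi}\ell\big(r(\cosh\mu+\cos\nu)\big)\,\ell\big(r(\cosh\mu-\cos\nu)\big)\,\frac{r^2}{2}\big(\cosh2\mu-\cos2\nu\big)\,d\nu\,d\mu .$$ Then in every slot $t$ the series $I_t$ converges almost surely, $I_t$ has a finite second moment and positive variance, and for any two distinct slots Pearson's correlation coefficient of the interference, $\rho[I_1,I_2]=\mathrm{cov}[I_1,I_2]/\sqrt{\mathrm{var}[I_1]\,\mathrm{var}[I_2]}$, is $$\rho[I_1,I_2]=\frac{\displaystyle\lambda_p\,p_{12}\,\frac{\alpha\pi}{\alpha-1}+8\pi\int_0^\infty E(r)\,\lambda_p^2\,p_{1/2}(2r)\,r\,dr-\Big(\frac{\lambda\alpha\pi}{\alpha-2}\Big)^2}{\displaystyle\lambda\,\frac{(m+1)\alpha\pi}{m(\alpha-1)}+8\pi\int_{d/2}^\infty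 E(r)\,\rho^{(2)}(2r)\,r\,dr-\Big(\frac{\lambda\alpha\pi}{\alpha-2}\Big)^2}.$$ -/

import Mathlib

open MeasureTheory ProbabilityTheory Set Filter Topology

noncomputable section

namespace Matern

/-- The Euclidean plane. -/
abbrev Plane : Type := EuclideanSpace ℝ (Fin 2)

/-! ### Random model -/

/-- The counting measure `∑ₙ δ_{Xₙ(ω)}` of the points `X 0 ω, X 1 ω, …`. -/
def pointMeasure {Ω : Type*} (X : ℕ → Ω → Plane) (ω : Ω) : Measure Plane :=
  Measure.sum fun n => Measure.dirac (X n ω)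

/-- The points `X 0, X 1, …` form a homogeneous Poisson point process of intensity `lam` on the
plane: the number of points in a measurable set `B` of finite area is Poisson distributed with
mean `lam * area B`, and the numbers of points in disjoint sets are independent. -/
structure IsPoissonProcess {Ω : Type*} [MeasurableSpace Ω] (lam : ℝ) (X : ℕ → Ω → Plane)
    (P : Measure Ω) : Prop where
  measurable : ∀ n, Measurable (X n)
  count_law : ∀ B : Set Plane, MeasurableSet B → volume B ≠ ⊤ →
    HasLaw (fun ω => pointMeasure X ω B)
      ((poissonMeasure (lam * (volume B).toReal).toNNReal).map
        (Nat.cast : ℕ → ENNReal)) P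
  count_indep : ∀ (k : ℕ) (B : Fin k → Set Plane), (∀ i, MeasurableSet (B i)) →
    Pairwise (fun i j => Disjoint (B i) (B j)) →
    iIndepFun (fun i ω => pointMeasure X ω (B i)) P

/-- The random input of the network. `X n` is the location of the `n`-th potential sender, and
`U t n`, `H t n` are its mark and its fading coefficient (the squared amplitude) in slot `t`.
The locations form a Poisson process; all marks are i.i.d. uniform on `[0, 1]`, all fading
coefficients are i.i.d. gamma distributed with shape `m` and scale `1 / m` (that is, rate `m`), and
locations, marks and fading are independent of each other. -/
structure IsNetwork {Ω : Type*} [MeasurableSpace Ω] (lam m : ℝ) (X : ℕ → Ω → Plane)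
    (U H : ℤ → ℕ → Ω → ℝ) (P : Measure Ω) : Prop where
  poisson : IsPoissonProcess lam X P
  mark_measurable : ∀ t n, Measurable (U t n)
  mark_law : ∀ t n, HasLaw (U t n) (volume.restrict (Icc (0 : ℝ) 1)) P
  mark_indep : iIndepFun (fun p : ℤ × ℕ => U p.1 p.2) P
  fading_measurable : ∀ t n, Measurable (H t n)
  fading_law : ∀ t n, HasLaw (H t n) (gammaMeasure m m) P
  fading_indep : iIndepFun (fun p : ℤ × ℕ => H p.1 p.2) P
  mark_fading_indep :
    IndepFun (fun ω (p : ℤ × ℕ) => U p.1 p.2 ω) (fun ω (p : ℤ × ℕ) => H p.1 p.2 ω) P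
  location_indep :
    IndepFun (fun ω n => X n ω)
      (fun ω => ((fun p : ℤ × ℕ => U p.1 p.2 ω), (fun p : ℤ × ℕ => H p.1 p.2 ω))) P

/-- Matérn type II thinning with hard-core distance `d`: the point `n` is retained in slot `t` if
its mark is smaller than the marks of all other points at distance at most `d`. -/
def Retained {Ω : Type*} (d : ℝ) (X : ℕ → Ω → Plane) (U : ℤ → ℕ → Ω → ℝ) (t : ℤ) (n : ℕ)
    (ω : Ω) : Prop :=
  ∀ k, k ≠ n → dist (X n ω) (X k ω) ≤ d → U t n ω < U t k ω

/-- The path gain `min (1, r ^ (-α))` at distance `r ≥ 0`, equal to `1` at `r = 0`. -/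
def pathGain (α r : ℝ) : ℝ := if r = 0 then 1 else min 1 (r ^ (-α))

open scoped Classical in
/-- The power received at the origin from the `n`-th potential sender in slot `t`. -/
def receivedPower {Ω : Type*} (d α : ℝ) (X : ℕ → Ω → Plane) (U H : ℤ → ℕ → Ω → ℝ)
    (t : ℤ) (n : ℕ) (ω : Ω) : ℝ :=
  if Retained d X U t n ω then H t n ω * pathGain α ‖X n ω‖ else 0

/-- The interference power at the origin in slot `t`. -/
def interference {Ω : Type*} (d α : ℝ) (X : ℕ → Ω → Plane) (U H : ℤ → ℕ → Ω → ℝ)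
    (t : ℤ) (ω : Ω) : ℝ :=
  ∑' n, receivedPower d α X U H t n ω

/-- Pearson's correlation coefficient. -/
def pearson {Ω : Type*} [MeasurableSpace Ω] (Y Z : Ω → ℝ) (P : Measure Ω) : ℝ :=
  cov[Y, Z; P] / √(Var[Y; P] * Var[Z; P])

/-! ### The exponential integral -/

/-- The exponential integral `Ei x = PV ∫_{-∞}^x exp t / t dt` for `x > 0`, where the part of the
principal value over `[-x, x]` is folded at `0`; see `tendsto_expIntegralEi`. -/
def expIntegralEi (x : ℝ) : ℝ :=
  (∫ t in Iic (-x), Real.exp t / t) + ∫ t in (0 : ℝ)..x, (Real.exp t - Real.exp (-t)) / t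

/-- `expIntegralEi x` is the Cauchy principal value. -/
theorem tendsto_expIntegralEi {x : ℝ} (hx : 0 < x) :
    Tendsto (fun ε : ℝ => (∫ t in Iic (-ε), Real.exp t / t) + ∫ t in ε..x, Real.exp t / t)
      (𝓝[>] 0) (𝓝 (expIntegralEi x)) := by
  have hint : IntervalIntegrable (fun t : ℝ => (Real.exp t - Real.exp (-t)) / t) volume 0 x := by
    have hc : Continuous (dslope (fun t : ℝ => Real.exp t - Real.exp (-t)) 0) := by
      rw [continuous_iff_continuousAt]
      intro t
      by_cases ht : t = 0
      · subst ht
        rw [continuousAt_dslope_same]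
        fun_prop
      · rw [continuousAt_dslope_of_ne ht]
        fun_prop
    refine (hc.intervalIntegrable 0 x).congr ?_
    intro t ht
    rw [uIoc_of_le hx.le] at ht
    simp only
    rw [dslope_of_ne _ ht.1.ne', slope_def_field]
    simp
  have hcont : Tendsto (fun ε : ℝ => ∫ t in ε..x, (Real.exp t - Real.exp (-t)) / t)
      (𝓝[>] 0) (𝓝 (∫ t in (0 : ℝ)..x, (Real.exp t - Real.exp (-t)) / t)) := by
    have h1 : ContinuousOn (fun ε : ℝ => ∫ t in x..ε, (Real.exp t - Real.exp (-t)) / t)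
        (uIcc 0 x) :=
      intervalIntegral.continuousOn_primitive_interval' hint right_mem_uIcc
    have h2 := (h1 0 left_mem_uIcc).neg
    have h3 : ContinuousWithinAt (fun ε : ℝ => ∫ t in ε..x, (Real.exp t - Real.exp (-t)) / t)
        (uIcc 0 x) 0 := by
      refine h2.congr (fun y _ => ?_) ?_ <;>
        exact intervalIntegral.integral_symm _ _
    refine h3.mono_left ?_
    rw [uIcc_of_le hx.le]
    exact nhdsWithin_le_of_mem (Icc_mem_nhdsGT hx)
  refine (hcont.const_add (∫ t in Iic (-x), Real.exp t / t)).congr' ?_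
  filter_upwards [Ioo_mem_nhdsGT hx] with ε hε
  have hεx : -x ≤ -ε := neg_le_neg hε.2.le
  have hii : ∀ y : ℝ, 0 < y → IntegrableOn (fun t : ℝ => Real.exp t / t) (Iic (-y)) := by
    intro y hy
    have he : IntegrableOn (fun t : ℝ => Real.exp t) (Iic (-y)) := integrableOn_exp_Iic _
    refine (he.const_mul (1 / y)).mono' ?_ ?_
    · exact (Real.measurable_exp.div measurable_id).aestronglyMeasurable
    · refine (ae_restrict_iff' measurableSet_Iic).2 (Eventually.of_forall fun t ht => ?_)
      have ht' : t ≤ -y := ht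
      rw [Real.norm_eq_abs, abs_div, Real.abs_exp, abs_of_neg (by linarith), one_div,
        div_eq_inv_mul]
      gcongr
      linarith
  have h1 : (∫ t in Iic (-ε), Real.exp t / t) - (∫ t in Iic (-x), Real.exp t / t)
      = ∫ t in (-x)..(-ε), Real.exp t / t :=
    intervalIntegral.integral_Iic_sub_Iic (hii x hx) (hii ε hε.1)
  have h2 : (∫ t in (-x)..(-ε), Real.exp t / t) = ∫ t in ε..x, Real.exp (-t) / (-t) :=
    (intervalIntegral.integral_comp_neg (fun t : ℝ => Real.exp t / t)).symm
  have hne : ∀ t ∈ uIcc ε x, t ≠ 0 := by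
    intro t ht
    rw [uIcc_of_le hε.2.le] at ht
    exact (lt_of_lt_of_le hε.1 ht.1).ne'
  have i1 : IntervalIntegrable (fun t : ℝ => Real.exp t / t) volume ε x :=
    ContinuousOn.intervalIntegrable (Real.continuous_exp.continuousOn.div continuousOn_id hne)
  have i2 : IntervalIntegrable (fun t : ℝ => Real.exp (-t) / (-t)) volume ε x := by
    refine ContinuousOn.intervalIntegrable (ContinuousOn.div ?_ continuousOn_id.neg ?_)
    · fun_prop
    · intro t ht
      exact neg_ne_zero.2 (hne t ht)
  have h3 : (∫ t in ε..x, (Real.exp t - Real.exp (-t)) / t)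
      = (∫ t in ε..x, Real.exp t / t) + ∫ t in ε..x, Real.exp (-t) / (-t) := by
    rw [← intervalIntegral.integral_add i1 i2]
    refine intervalIntegral.integral_congr fun t _ => ?_
    rw [div_neg, sub_div, sub_eq_add_neg]
  rw [h3, ← h2, ← h1]
  ring

/-! ### Retainment probabilities

`lam` is the intensity of the Poisson process and `d` the hard-core distance. -/

/-- Area of the sensing disc. -/
def discArea (d : ℝ) : ℝ := d ^ 2 * Real.pi

/-- Area of the intersection of two discs of radius `d` with centres at distance `r`. -/
def lensArea (d r : ℝ) : ℝ :=
  if r ≤ 2 * d then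
    2 * d ^ 2 * Real.arccos (r / (2 * d)) - r / 2 * √(4 * d ^ 2 - r ^ 2)
  else 0

/-- Area of the union of two discs of radius `d` with centres at distance `r`. -/
def unionArea (d r : ℝ) : ℝ := 2 * discArea d - lensArea d r

/-- A point is retained in one thinning. -/
def retainOnce (lam d : ℝ) : ℝ :=
  (1 - Real.exp (-(lam * discArea d))) / (lam * discArea d)

/-- Intensity of the thinned process. -/
def senderIntensity (lam d : ℝ) : ℝ := lam * retainOnce lam d

/-- A point is retained in both of two independent thinnings. -/
def retainTwice (lam d : ℝ) : ℝ :=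
  Real.exp (-(lam * discArea d)) *
      (expIntegralEi (lam * discArea d) - Real.log (lam * discArea d)
        - Real.eulerMascheroniConstant) /
    (lam * discArea d)

/-- Two points at distance `r` are both retained in the same thinning. -/
def retainPairSame (lam d r : ℝ) : ℝ :=
  if d < r then
    2 * unionArea d r * (1 - Real.exp (-(lam * discArea d))) /
        (lam ^ 2 * discArea d * unionArea d r * (unionArea d r - discArea d))
      - 2 * (1 - Real.exp (-(lam * unionArea d r))) /
        (lam ^ 2 * unionArea d r * (unionArea d r - discArea d))
  else 0

/-- Second-order product density of the thinned process. -/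
def productDensity (lam d r : ℝ) : ℝ := lam ^ 2 * retainPairSame lam d r

/-- Of two points at distance `r`, one is retained in a first thinning and the other one in a
second, independent thinning. With `c` the area of a disc and `g` the area of the lens, the three
cases are `r < d`, `d ≤ r < 2 d` and `2 d ≤ r` (where `g = 0`). -/
def retainPairIndep (lam d r : ℝ) : ℝ :=
  let c := discArea d
  let g := lensArea d r
  if r < d then
    Real.exp (-(c * lam * (2 + c / g))) / (c * lam ^ 2 * g ^ 3) *
      (c * Real.exp (2 * c * lam) * (g * (1 + 2 * c * lam - g * lam) - c ^ 2 * lam) *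
          (2 * expIntegralEi (c * lam * (c / g - 1)) - expIntegralEi (c ^ 2 * lam / g)
            - expIntegralEi (lam * (g - c) ^ 2 / g))
        - g * Real.exp (c ^ 2 * lam / g) *
          (Real.exp (lam * g) * c + Real.exp (2 * c * lam) * (c - 2 * g)
            - 2 * Real.exp (c * lam) * (c - g)))
  else if r < 2 * d then
    Real.exp (-(c ^ 2 * lam / g)) *
        (expIntegralEi (c ^ 2 * lam / g) + expIntegralEi (lam * (g - c) ^ 2 / g)
          - 2 * expIntegralEi (c * lam * (c / g - 1))) /
      (lam * g)
  else retainOnce lam d ^ 2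

/-- The inner double integral, in elliptic coordinates with foci at distance `r` from the
centre. -/
def ellipticIntegral (α r : ℝ) : ℝ :=
  ∫ μ in Ioi (0 : ℝ), ∫ ν in (0 : ℝ)..(2 * Real.pi),
    pathGain α (r * (Real.cosh μ + Real.cos ν)) * pathGain α (r * (Real.cosh μ - Real.cos ν)) *
      (r ^ 2 / 2 * (Real.cosh (2 * μ) - Real.cos (2 * ν)))

end Matern

end

open Matern

open Matern
noncomputable section

namespace Matern

/-! ### Independent pairs and Poisson variables -/

/-! The correlation coefficient needs only the mean, the second moment and the cross moment of the
interference. Each is the expectation of a sum, or double sum, of nonnegative terms over the points.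
All of them are computed in `ENNReal`, where sums and integrals may be exchanged freely; finiteness
is settled at the end and only then are real values taken.

A term factorises because locations, marks and fading are independent
(`IsNetwork.lintegral_separate`). Fading contributes 1 for two different coefficients and (m+1)/m
for a squared one. Given the locations, retainment compares a mark u (or two marks u, v) with
finitely many other uniform marks, so its probability is an integral over the unit square of powers
of 1-u, 1-v, and 1-max(u,v) or (1-u)(1-v), whose exponents are numbers of points in discs and lenses
(`prob_marks_lt`).

The Mecke equation, for one point and for pairs, turns the expected sum into a plane integral of the
same quantity averaged over the configuration with the summed points added
(`IsPoissonProcess.mecke`, `IsPoissonProcess.mecke_pair`). It rests on the identity E[N f(N)] = r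
E[f(N+1)] for Poisson N, applied to cell counts and extended by a monotone class argument. Averaging
powers over independent Poisson counts gives exponentials of areas, and integrating these over u and
v gives the closed forms: elementary for one slot, exponential integrals for two slots, where the
exponent is bilinear in the marks (`integral_exp_retainTwice`, `integral_exp_pair_far`,
`integral_exp_pair_near`, `integral_exp_pair_same`).

The remaining pair integral has a weight depending only on the distance of the two points. With
their difference fixed, the sum of the two path gains' arguments is governed by distances to two
foci, and elliptic coordinates express both distances; polar coordinates for the difference then
leave a single radial integral (`lintegral_pair`).

The variance is positive because replacing the fading by its mean 1 lowers the second moment by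
exactly 1/m times a positive diagonal term, while the lowered value is still at least the squared
mean (`IsNetwork.sq_mean_le`). -/

theorem lintegral_comp_prodMk_of_indepFun {Ω β γ : Type*} [MeasurableSpace Ω] [MeasurableSpace β]
    [MeasurableSpace γ] {P : Measure Ω} [IsProbabilityMeasure P] {f : Ω → β} {g : Ω → γ}
    (h : IndepFun f g P) (hf : AEMeasurable f P) (hg : AEMeasurable g P) {F : β × γ → ENNReal}
    (hF : Measurable F) :
    ∫⁻ ω, F (f ω, g ω) ∂P = ∫⁻ ω, ∫⁻ ω', F (f ω, g ω') ∂P ∂P := by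
  have hfg := (indepFun_iff_map_prod_eq_prod_map_map hf hg).1 h
  rw [← lintegral_map' hF.aemeasurable (hf.prodMk hg), hfg, lintegral_prod _ hF.aemeasurable,
    lintegral_map' (by fun_prop) hf]
  refine lintegral_congr fun ω => ?_
  rw [lintegral_map' (by fun_prop) hg]

theorem lintegral_poissonMeasure (r : NNReal) (f : ℕ → ENNReal) :
    ∫⁻ k, f k ∂(poissonMeasure r)
      = ∑' k : ℕ, ENNReal.ofReal (Real.exp (-r) * r ^ k / k.factorial) * f k := by
  rw [poissonMeasure, lintegral_sum_measure]
  simp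

/-- Termwise this is k · r^k/k! = r · r^(k-1)/(k-1)!, with the term k = 0 vanishing. It is the
one-cell case of the Mecke equation. -/
theorem lintegral_natCast_mul_poissonMeasure (r : NNReal) (f : ℕ → ENNReal) :
    ∫⁻ k, (k : ENNReal) * f k ∂(poissonMeasure r) = r * ∫⁻ k, f (k + 1) ∂(poissonMeasure r) := by
  rw [lintegral_poissonMeasure, lintegral_poissonMeasure, ← ENNReal.tsum_mul_left,
    tsum_eq_zero_add' ENNReal.summable]
  simp only [Nat.cast_zero, zero_mul, mul_zero, zero_add]
  refine tsum_congr fun k => ?_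
  rw [← mul_assoc, ← mul_assoc]
  congr 1
  rw [← ENNReal.ofReal_natCast, ← ENNReal.ofReal_coe_nnreal, ← ENNReal.ofReal_mul (by positivity),
    ← ENNReal.ofReal_mul (by positivity)]
  congr 1
  rw [Nat.factorial_succ]
  push_cast
  have : (k.factorial : ℝ) ≠ 0 := by positivity
  have : (k : ℝ) + 1 ≠ 0 := by positivity
  field_simp
  ring

/-- The source of every exponential in the closed forms: N competitors are all beaten with
probability (1-u)^N, and here N is averaged out. -/
theorem lintegral_pow_poissonMeasure (r : NNReal) {s : ℝ} (hs : 0 ≤ s) :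
    ∫⁻ k, ENNReal.ofReal (s ^ k) ∂(poissonMeasure r)
      = ENNReal.ofReal (Real.exp (-(r * (1 - s)))) := by
  rw [lintegral_poissonMeasure]
  have h : HasSum (fun k : ℕ => Real.exp (-r) * r ^ k / k.factorial * s ^ k)
      (Real.exp (-(r * (1 - s)))) := by
    have h1 := (NormedSpace.expSeries_div_hasSum_exp (𝔸 := ℝ) (r * s)).mul_left (Real.exp (-r))
    rw [← Real.exp_eq_exp_ℝ, ← Real.exp_add] at h1
    have e1 : -(r : ℝ) + r * s = -(r * (1 - s)) := by ring
    rw [e1] at h1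
    refine h1.congr_fun fun k => ?_
    rw [mul_pow]; ring
  rw [← h.tsum_eq, ENNReal.ofReal_tsum_of_nonneg (fun k => by positivity) h.summable]
  exact tsum_congr fun k => (ENNReal.ofReal_mul (by positivity)).symm

/-! ### The Mecke equation -/

section PoissonPoints

theorem pointMeasure_apply {Ω : Type*} (X : ℕ → Ω → Plane) (ω : Ω) {B : Set Plane} (hB : MeasurableSet B) :
    pointMeasure X ω B = ∑' n, B.indicator 1 (X n ω) := by
  rw [pointMeasure, Measure.sum_apply _ hB]
  exact tsum_congr fun n => Measure.dirac_apply' _ hB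

theorem lintegral_pointMeasure {Ω : Type*} (X : ℕ → Ω → Plane) (ω : Ω) (f : Plane → ENNReal) :
    ∫⁻ x, f x ∂(pointMeasure X ω) = ∑' n, f (X n ω) := by
  rw [pointMeasure, lintegral_sum_measure]
  simp

variable {Ω : Type*} [MeasurableSpace Ω] {P : Measure Ω} {lam : ℝ} {X : ℕ → Ω → Plane}

theorem IsPoissonProcess.measurable_pointMeasure (hX : IsPoissonProcess lam X P) :
    Measurable (pointMeasure X) := by
  refine Measure.measurable_of_measurable_coe _ fun B hB => ?_
  simp_rw [pointMeasure_apply X _ hB]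
  exact Measurable.tsum fun n => (measurable_const.indicator hB).comp (hX.measurable n)

theorem IsPoissonProcess.lintegral_count (hX : IsPoissonProcess lam X P) {B : Set Plane}
    (hB : MeasurableSet B) (hBv : volume B ≠ ⊤) {f : ENNReal → ENNReal} (hf : Measurable f) :
    ∫⁻ ω, f (pointMeasure X ω B) ∂P
      = ∫⁻ k : ℕ, f k ∂(poissonMeasure (lam * (volume B).toReal).toNNReal) := by
  have h := hX.count_law B hB hBv
  rw [← lintegral_map' hf.aemeasurable h.aemeasurable, h.map_eq,
    lintegral_map hf (measurable_from_top)]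

/-- A Mecke equation for functions of finitely many cell counts. The counts are independent, so all
but the one in cell `j₀` can be frozen and the Poisson shift identity applied to the latter. -/
theorem IsPoissonProcess.lintegral_count_mul_cells [IsProbabilityMeasure P]
    (hX : IsPoissonProcess lam X P)
    {ι : Type*} [Fintype ι] [DecidableEq ι] (c : Plane → ι) (hc : ∀ j, MeasurableSet (c ⁻¹' {j}))
    (j₀ : ι) (hj₀ : volume (c ⁻¹' {j₀}) ≠ ⊤) {h : (ι → ENNReal) → ENNReal} (hh : Measurable h) :
    ∫⁻ ω, pointMeasure X ω (c ⁻¹' {j₀}) * h (fun j => pointMeasure X ω (c ⁻¹' {j})) ∂P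
      = ENNReal.ofReal (lam * (volume (c ⁻¹' {j₀})).toReal) *
        ∫⁻ ω, h (fun j => pointMeasure X ω (c ⁻¹' {j}) + if j = j₀ then 1 else 0) ∂P := by
  classical
  have hm : ∀ j, Measurable fun ω => pointMeasure X ω (c ⁻¹' {j}) := fun j =>
    (Measure.measurable_coe (hc j)).comp hX.measurable_pointMeasure
  have hi : iIndepFun (fun j ω => pointMeasure X ω (c ⁻¹' {j})) P := by
    have e := Fintype.equivFin ι
    have h1 := hX.count_indep (Fintype.card ι) (fun i => c ⁻¹' {e.symm i}) (fun i => hc _)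
      (fun i k hik => by
        refine Disjoint.preimage _ ?_
        simpa using hik)
    have h2 := h1.precomp e.injective
    simpa using h2
  have hi2 := hi.indepFun_finset {j₀} (Finset.univ.erase j₀) (by simp) hm
  have hi3 : IndepFun (fun ω => pointMeasure X ω (c ⁻¹' {j₀}))
      (fun ω (i : {j // j ∈ Finset.univ.erase j₀}) => pointMeasure X ω (c ⁻¹' {i.1})) P :=
    hi2.comp (φ := fun v : (({j₀} : Finset ι) → ENNReal) => v ⟨j₀, by simp⟩) (ψ := id)
      (measurable_pi_apply _) measurable_id
  -- `r` reassembles the full vector of counts from the distinguished count and the remaining ones.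
  let r : ENNReal × ({j // j ∈ Finset.univ.erase j₀} → ENNReal) → ι → ENNReal := fun p j =>
    if hj : j ∈ Finset.univ.erase j₀ then p.2 ⟨j, hj⟩ else p.1
  have hr : Measurable r := by
    refine measurable_pi_lambda _ fun j => ?_
    by_cases hj : j ∈ Finset.univ.erase j₀
    · simp only [r, dif_pos hj]; fun_prop
    · simp only [r, dif_neg hj]; fun_prop
  have key : ∀ F : ENNReal × ({j // j ∈ Finset.univ.erase j₀} → ENNReal) → ENNReal,
      Measurable F →
      ∫⁻ ω, F (pointMeasure X ω (c ⁻¹' {j₀}), fun i => pointMeasure X ω (c ⁻¹' {i.1})) ∂P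
      = ∫⁻ ω, ∫⁻ ω', F (pointMeasure X ω' (c ⁻¹' {j₀}),
          fun i => pointMeasure X ω (c ⁻¹' {i.1})) ∂P ∂P := by
    intro F hF
    exact lintegral_comp_prodMk_of_indepFun (F := F ∘ Prod.swap) hi3.symm
      (by fun_prop) (by fun_prop) (hF.comp measurable_swap)
  have e1 := key (fun p => p.1 * h (r p)) (by fun_prop)
  have e2 := key (fun p => h (r (p.1 + 1, p.2))) (by fun_prop)
  have r1 : ∀ ω, r (pointMeasure X ω (c ⁻¹' {j₀}), fun i => pointMeasure X ω (c ⁻¹' {i.1}))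
      = fun j => pointMeasure X ω (c ⁻¹' {j}) := by
    intro ω; ext j
    by_cases hj : j = j₀
    · subst hj; simp [r]
    · simp [r, hj]
  have r2 : ∀ ω, r (pointMeasure X ω (c ⁻¹' {j₀}) + 1, fun i => pointMeasure X ω (c ⁻¹' {i.1}))
      = fun j => pointMeasure X ω (c ⁻¹' {j}) + if j = j₀ then 1 else 0 := by
    intro ω; ext j
    by_cases hj : j = j₀
    · subst hj; simp [r]
    · simp [r, hj]
  simp only [r1] at e1
  simp only [r2] at e2
  rw [e1, e2, ← lintegral_const_mul' _ _ ENNReal.ofReal_ne_top]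
  refine lintegral_congr fun ω => ?_
  rw [hX.lintegral_count (hc j₀) hj₀ (f := fun x => x * h (r (x, _))) (by fun_prop),
    hX.lintegral_count (hc j₀) hj₀ (f := fun x => h (r (x + 1, _))) (by fun_prop),
    lintegral_natCast_mul_poissonMeasure]
  simp only [Nat.cast_add, Nat.cast_one]
  rfl

end PoissonPoints

/-! ### From cell counts to the Mecke equation. -/

section PoissonPoints

variable {Ω : Type*} [MeasurableSpace Ω] {P : Measure Ω} {lam : ℝ} {X : ℕ → Ω → Plane}

theorem measurable_add_dirac :
    Measurable fun p : Plane × Measure Plane => p.2 + Measure.dirac p.1 := by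
  refine Measure.measurable_of_measurable_coe _ fun B hB => ?_
  simp only [Measure.coe_add, Pi.add_apply]
  refine ((Measure.measurable_coe hB).comp measurable_snd).add ?_
  exact (Measure.measurable_coe hB).comp (Measure.measurable_dirac.comp measurable_fst)

/-- The Campbell measure: the joint distribution of a typical point and the configuration. -/
def campbell (X : ℕ → Ω → Plane) (P : Measure Ω) : Measure (Plane × Measure Plane) :=
  Measure.sum fun n => P.map fun ω => (X n ω, pointMeasure X ω)

/-- The joint distribution of a Lebesgue distributed point and the configuration with that point
added. -/
def palmProduct (lam : ℝ) (X : ℕ → Ω → Plane) (P : Measure Ω) : Measure (Plane × Measure Plane) :=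
  ENNReal.ofReal lam •
    ((volume : Measure Plane).prod P).map fun p => (p.1, pointMeasure X p.2 + Measure.dirac p.1)

theorem IsPoissonProcess.lintegral_campbell (hX : IsPoissonProcess lam X P)
    {G : Plane × Measure Plane → ENNReal} (hG : Measurable G) :
    ∫⁻ z, G z ∂(campbell X P) = ∫⁻ ω, ∑' n, G (X n ω, pointMeasure X ω) ∂P := by
  have hΦ := hX.measurable_pointMeasure
  have hXn := hX.measurable
  rw [campbell, lintegral_sum_measure, lintegral_tsum (fun n => by
    have := hXn n
    fun_prop)]
  refine tsum_congr fun n => ?_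
  have := hXn n
  rw [lintegral_map hG (by fun_prop)]

theorem IsPoissonProcess.lintegral_palmProduct [SFinite P] (hX : IsPoissonProcess lam X P)
    {G : Plane × Measure Plane → ENNReal} (hG : Measurable G) :
    ∫⁻ z, G z ∂(palmProduct lam X P)
      = ENNReal.ofReal lam * ∫⁻ x, ∫⁻ ω, G (x, pointMeasure X ω + Measure.dirac x) ∂P := by
  have hΦ := hX.measurable_pointMeasure
  have h1 : Measurable fun p : Plane × Ω => (p.1, pointMeasure X p.2 + Measure.dirac p.1) :=
    measurable_fst.prodMk (measurable_add_dirac.comp (measurable_fst.prodMk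
      (hΦ.comp measurable_snd)))
  rw [palmProduct, lintegral_smul_measure, lintegral_map hG h1,
    lintegral_prod (fun p : Plane × Ω => G (p.1, pointMeasure X p.2 + Measure.dirac p.1))
      (hG.comp h1).aemeasurable, smul_eq_mul]

/-- When the event `S` depends on the configuration only through cell counts, adding a point of cell
`j₀` raises exactly that count by one. The claim is then the shift identity for cell counts,
integrated over the location of the added point. -/
theorem IsPoissonProcess.campbell_cell [IsProbabilityMeasure P] (hX : IsPoissonProcess lam X P)
    (hlam : 0 ≤ lam)
    {ι : Type*} [Fintype ι] [DecidableEq ι] (c : Plane → ι) (hc : ∀ j, MeasurableSet (c ⁻¹' {j}))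
    (j₀ : ι) (hj₀ : volume (c ⁻¹' {j₀}) ≠ ⊤) {S : Set (Measure Plane)} {T : Set (ι → ENNReal)}
    (hT : MeasurableSet T) (hS : MeasurableSet S)
    (hST : ∀ φ : Measure Plane, φ ∈ S ↔ (fun j => φ (c ⁻¹' {j})) ∈ T) :
    campbell X P ((c ⁻¹' {j₀}) ×ˢ S) = palmProduct lam X P ((c ⁻¹' {j₀}) ×ˢ S) := by
  have hm : MeasurableSet ((c ⁻¹' {j₀}) ×ˢ S) := (hc j₀).prod hS
  have hind : ∀ (x : Plane) (φ : Measure Plane),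
      ((c ⁻¹' {j₀}) ×ˢ S).indicator (1 : Plane × Measure Plane → ENNReal) (x, φ)
      = (c ⁻¹' {j₀}).indicator 1 x * T.indicator 1 (fun j => φ (c ⁻¹' {j})) := by
    intro x φ
    simp only [indicator, mem_prod, hST]
    split_ifs <;> simp_all
  rw [← lintegral_indicator_one hm, ← lintegral_indicator_one hm,
    hX.lintegral_campbell (measurable_one.indicator hm),
    hX.lintegral_palmProduct (measurable_one.indicator hm)]
  simp only [hind]
  simp only [ENNReal.tsum_mul_right, ← pointMeasure_apply X _ (hc j₀)]
  rw [hX.lintegral_count_mul_cells c hc j₀ hj₀ (measurable_one.indicator hT),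
    ENNReal.ofReal_mul hlam, ENNReal.ofReal_toReal hj₀, mul_assoc]
  congr 1
  have h2 : ∀ x, ∫⁻ ω, (c ⁻¹' {j₀}).indicator (1 : Plane → ENNReal) x * T.indicator 1 (fun j =>
        (pointMeasure X ω + Measure.dirac x) (c ⁻¹' {j})) ∂P
      = (c ⁻¹' {j₀}).indicator (fun _ => ∫⁻ ω, T.indicator 1 (fun j =>
        pointMeasure X ω (c ⁻¹' {j}) + if j = j₀ then 1 else 0) ∂P) x := by
    intro x
    by_cases hx : x ∈ c ⁻¹' {j₀}
    · rw [indicator_of_mem hx, indicator_of_mem hx]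
      simp only [Pi.one_apply, one_mul]
      refine lintegral_congr fun ω => ?_
      congr 1
      ext j
      rw [Measure.add_apply, Measure.dirac_apply' _ (hc j)]
      congr 1
      have hx' : c x = j₀ := hx
      simp [indicator, hx', eq_comm]
    · simp [indicator_of_notMem hx]
  rw [lintegral_congr h2, lintegral_indicator_const (hc j₀), mul_comm]

/-- Uniqueness of measures on a π-system: products of a set of finite area with an event about
finitely many counts generate the product σ-algebra, and any such product splits into cells of one
finite partition of the plane. -/
theorem IsPoissonProcess.campbell_eq [IsProbabilityMeasure P] (hX : IsPoissonProcess lam X P)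
    (hlam : 0 ≤ lam) : campbell X P = palmProduct lam X P := by
  classical
  let m : {s : Set Plane // MeasurableSet s} → MeasurableSpace (Measure Plane) := fun s =>
    MeasurableSpace.comap (fun φ => φ s.1) (borel ENNReal)
  let π : Set (Set (Measure Plane)) := piiUnionInter (fun n => {s | MeasurableSet[m n] s}) univ
  have hπg : MeasurableSpace.generateFrom π = Measure.instMeasurableSpace := by
    refine (generateFrom_piiUnionInter_measurableSet m univ).trans ?_
    simp only [mem_univ, iSup_pos, m, Measure.instMeasurableSpace, iSup_subtype]
  have hπ : IsPiSystem π :=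
    isPiSystem_piiUnionInter _ (fun x => @MeasurableSpace.isPiSystem_measurableSet _ (m x)) _
  have huniv : (univ : Set (Measure Plane)) ∈ π := ⟨∅, by simp, fun _ => univ, by simp, by simp⟩
  have hml : ∀ s : {s : Set Plane // MeasurableSet s}, Measurable fun φ : Measure Plane => φ s.1 :=
    fun s => Measure.measurable_coe s.2
  have rect : ∀ (B : Set Plane), MeasurableSet B → volume B ≠ ⊤ → ∀ S ∈ π,
      campbell X P (B ×ˢ S) = palmProduct lam X P (B ×ˢ S) := by
    rintro B hB hBv S ⟨t, -, f, hf, rfl⟩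
    have hf' : ∀ i : t, ∃ T : Set ENNReal, MeasurableSet T ∧
        (fun φ : Measure Plane => φ i.1.1) ⁻¹' T = f i.1 := by
      intro i
      obtain ⟨T, hT, h⟩ := hf i.1 i.2
      exact ⟨T, by rwa [BorelSpace.measurable_eq (α := ENNReal)], h⟩
    choose T hT hTf using hf'
    -- The cell of a point records its membership in `B` and in each of the finitely many test sets,
    -- so `B` and every test set is a union of cells, and each tested count is a sum of cell counts.
    let c : Plane → Bool × (t → Bool) := fun x => (decide (x ∈ B), fun i => decide (x ∈ i.1.1))
    have hcm : Measurable c := by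
      refine Measurable.prodMk (measurable_to_bool ?_) (measurable_pi_lambda _ fun i =>
        measurable_to_bool ?_)
      · convert hB using 1
        ext x; simp
      · convert i.1.2 using 1
        ext x; simp
    have hc : ∀ j, MeasurableSet (c ⁻¹' {j}) := fun j => hcm (measurableSet_singleton j)
    have hS : MeasurableSet (⋂ x ∈ t, f x) := by
      refine Finset.measurableSet_biInter _ fun i hi => ?_
      rw [← hTf ⟨i, hi⟩]
      exact hml i (hT ⟨i, hi⟩)
    let T' : Set (Bool × (t → Bool) → ENNReal) :=
      ⋂ i : t, {w | ∑ j with j.2 i = true, w j ∈ T i}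
    have hT' : MeasurableSet T' := by
      refine MeasurableSet.iInter fun i => ?_
      exact (Finset.measurable_sum _ fun j _ => measurable_pi_apply j) (hT i)
    have hST : ∀ φ : Measure Plane, φ ∈ (⋂ x ∈ t, f x) ↔ (fun j => φ (c ⁻¹' {j})) ∈ T' := by
      intro φ
      simp only [mem_iInter, T', mem_ofPred_eq]
      have hsum : ∀ i : t, ∑ j with j.2 i = true, φ (c ⁻¹' {j}) = φ i.1.1 := by
        intro i
        rw [← measure_biUnion_finset (fun a _ b _ hab => Disjoint.preimage _ (by simpa using hab))
          (fun j _ => hc j)]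
        congr 1
        ext x
        simp [c]
      simp only [hsum]
      constructor
      · intro h i
        have := h i.1 i.2
        rwa [← hTf i] at this
      · intro h i hi
        have := h ⟨i, hi⟩
        rw [← hTf ⟨i, hi⟩]
        exact this
    have hdec : B ×ˢ (⋂ x ∈ t, f x) = ⋃ j ∈ Finset.univ.filter
        (fun j : Bool × (t → Bool) => j.1 = true), (c ⁻¹' {j}) ×ˢ (⋂ x ∈ t, f x) := by
      ext x
      simp [c]
    have hdisj : (Finset.univ.filter (fun j : Bool × (t → Bool) => j.1 = true) :
        Set (Bool × (t → Bool))).PairwiseDisjoint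
        (fun j => (c ⁻¹' {j}) ×ˢ (⋂ x ∈ t, f x)) := by
      intro a _ b _ hab
      exact Disjoint.set_prod_left (Disjoint.preimage _ (by simpa using hab)) _ _
    rw [hdec, measure_biUnion_finset hdisj (fun j _ => (hc j).prod hS),
      measure_biUnion_finset hdisj (fun j _ => (hc j).prod hS)]
    refine Finset.sum_congr rfl fun j hj => ?_
    refine hX.campbell_cell hlam c hc j ?_ hT' hS hST
    refine ne_top_of_le_ne_top hBv (measure_mono fun x hx => ?_)
    have hx' : c x = j := hx
    have : (c x).1 = true := by rw [hx']; simpa using hj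
    simpa [c] using this
  -- a generating pi-system of rectangles over sets of finite area
  let C : Set (Set Plane) := {B | MeasurableSet B ∧ volume B ≠ ⊤}
  have hC : MeasurableSpace.generateFrom C = (inferInstance : MeasurableSpace Plane) := by
    refine le_antisymm (MeasurableSpace.generateFrom_le fun s hs => hs.1) fun s hs => ?_
    have hs' : s = ⋃ n : ℕ, s ∩ Metric.ball 0 n := by
      rw [← inter_iUnion, Metric.iUnion_ball_nat, inter_univ]
    rw [hs']
    refine @MeasurableSet.iUnion _ _ (MeasurableSpace.generateFrom C) _ _ fun n =>
      MeasurableSpace.measurableSet_generateFrom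
        ⟨MeasurableSet.inter hs measurableSet_ball, ne_top_of_le_ne_top measure_ball_lt_top.ne
          (measure_mono inter_subset_right)⟩
  have hCspan : IsCountablySpanning C :=
    ⟨fun n : ℕ => Metric.ball 0 n, fun n => ⟨measurableSet_ball, measure_ball_lt_top.ne⟩,
      Metric.iUnion_ball_nat 0⟩
  have hπspan : IsCountablySpanning π := ⟨fun _ : ℕ => univ, fun _ => huniv, iUnion_const _⟩
  -- The measures need not be finite, so uniqueness also uses an exhaustion by generators of finite
  -- measure: balls times all configurations.
  refine Measure.ext_of_generateFrom_of_iUnion (image2 (· ×ˢ ·) C π)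
    (fun n : ℕ => (Metric.ball (0 : Plane) n) ×ˢ univ)
    (generateFrom_eq_prod hC hπg hCspan hπspan).symm
    (IsPiSystem.prod (fun a ha b hb _ => ⟨ha.1.inter hb.1, ne_top_of_le_ne_top ha.2
      (measure_mono inter_subset_left)⟩) hπ) ?_
    (fun n => ⟨_, ⟨measurableSet_ball, measure_ball_lt_top.ne⟩, _, huniv, rfl⟩) ?_ ?_
  · rw [← iUnion_prod_const, Metric.iUnion_ball_nat, univ_prod_univ]
  · intro n
    rw [rect _ measurableSet_ball measure_ball_lt_top.ne _ huniv,
      ← lintegral_indicator_one (measurableSet_ball.prod MeasurableSet.univ),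
      hX.lintegral_palmProduct (measurable_one.indicator
        (measurableSet_ball.prod MeasurableSet.univ))]
    have : ∀ (x : Plane) (φ : Measure Plane), (Metric.ball (0 : Plane) n ×ˢ
        (univ : Set (Measure Plane))).indicator (1 : Plane × Measure Plane → ENNReal) (x, φ)
        = (Metric.ball (0 : Plane) n).indicator 1 x := by
      intro x φ; simp [indicator]
    simp only [this, lintegral_const, measure_univ, mul_one]
    rw [lintegral_indicator_one measurableSet_ball]
    exact ENNReal.mul_ne_top ENNReal.ofReal_ne_top measure_ball_lt_top.ne
  · rintro _ ⟨B, hB, S, hS, rfl⟩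
    exact rect B hB.1 hB.2 S hS

/-- The Mecke equation. -/
theorem IsPoissonProcess.mecke [IsProbabilityMeasure P] (hX : IsPoissonProcess lam X P)
    (hlam : 0 ≤ lam) {G : Plane × Measure Plane → ENNReal} (hG : Measurable G) :
    ∫⁻ ω, ∑' n, G (X n ω, pointMeasure X ω) ∂P
      = ENNReal.ofReal lam * ∫⁻ x, ∫⁻ ω, G (x, pointMeasure X ω + Measure.dirac x) ∂P := by
  rw [← hX.lintegral_campbell hG, hX.campbell_eq hlam, hX.lintegral_palmProduct hG]

end PoissonPoints

/-! ### Locally finite configurations -/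

/-- The configurations with finitely many points in every ball. -/
def locallyFinite : Set (Measure Plane) := {φ | ∀ n : ℕ, φ (Metric.ball 0 n) < ⊤}

theorem measurableSet_locallyFinite : MeasurableSet locallyFinite := by
  have : locallyFinite = ⋂ n : ℕ, {φ : Measure Plane | φ (Metric.ball 0 n) < ⊤} := by
    ext φ; simp [locallyFinite]
  rw [this]
  exact MeasurableSet.iInter fun n =>
    measurableSet_lt (Measure.measurable_coe measurableSet_ball) measurable_const

theorem lt_top_of_locallyFinite {φ : Measure Plane} (hφ : φ ∈ locallyFinite) {B : Set Plane}
    (hB : Bornology.IsBounded B) : φ B < ⊤ := by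
  obtain ⟨r, hr⟩ := hB.subset_ball 0
  obtain ⟨n, hn⟩ := exists_nat_ge r
  exact (measure_mono (hr.trans (Metric.ball_subset_ball hn))).trans_lt (hφ n)

theorem add_dirac_mem_locallyFinite {φ : Measure Plane} (hφ : φ ∈ locallyFinite) (x : Plane) :
    φ + Measure.dirac x ∈ locallyFinite := by
  intro n
  rw [Measure.add_apply]
  exact ENNReal.add_lt_top.2 ⟨hφ n, measure_lt_top _ _⟩

/-- A configuration restricted to the shell `n`, when it has `k` points there. -/
def shellKernel (p : ℕ × ℕ) : Kernel (Measure Plane) Plane where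
  toFun φ := {φ' : Measure Plane | φ' ∈ locallyFinite ∧
    ⌊(φ' (disjointed (fun n : ℕ => Metric.ball (0 : Plane) n) p.1)).toReal⌋₊ = p.2}.indicator
      (fun φ => φ.restrict (disjointed (fun n : ℕ => Metric.ball (0 : Plane) n) p.1)) φ
  measurable' := by
    have hd : MeasurableSet (disjointed (fun n : ℕ => Metric.ball (0 : Plane) n) p.1) :=
      MeasurableSet.disjointed (fun n => measurableSet_ball) _
    have hr : Measurable fun φ : Measure Plane =>
        φ.restrict (disjointed (fun n : ℕ => Metric.ball (0 : Plane) n) p.1) := by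
      refine Measure.measurable_of_measurable_coe _ fun s hs => ?_
      simp only [Measure.restrict_apply hs]
      exact Measure.measurable_coe (hs.inter hd)
    refine Measurable.indicator hr ?_
    refine measurableSet_locallyFinite.inter (measurableSet_eq_fun ?_ measurable_const)
    exact Nat.measurable_floor.comp (Measure.measurable_coe hd).ennreal_toReal

/-- Prescribing the integer part k of the mass of the shell is what makes the bound k + 1 uniform in
the configuration. -/
instance (p : ℕ × ℕ) : IsFiniteKernel (shellKernel p) := by
  refine ⟨⟨(p.2 + 1 : ENNReal), by finiteness, fun φ => ?_⟩⟩
  have hb : Bornology.IsBounded (disjointed (fun n : ℕ => Metric.ball (0 : Plane) n) p.1) :=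
    Metric.isBounded_ball.subset (disjointed_subset _ _)
  simp only [shellKernel, Kernel.coe_mk, indicator]
  split_ifs with h
  · rw [Measure.restrict_apply_univ]
    have := Nat.lt_floor_add_one
      (φ (disjointed (fun n : ℕ => Metric.ball (0 : Plane) n) p.1)).toReal
    have h2 := h.2
    rw [h2] at this
    rw [← ENNReal.ofReal_toReal (lt_top_of_locallyFinite h.1 hb).ne]
    refine (ENNReal.ofReal_le_ofReal this.le).trans (le_of_eq ?_)
    rw [ENNReal.ofReal_add (by positivity) (by positivity)]
    simp
  · simp

/-- The identity on locally finite configurations, as an s-finite kernel. -/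
def configKernel : Kernel (Measure Plane) Plane := Kernel.sum shellKernel

instance : IsSFiniteKernel configKernel := Kernel.isSFiniteKernel_sum

/-- For fixed shell only the summand with the right number of points survives, and the shells
partition the plane. The purpose is measurability: integrating a jointly measurable function against
the configuration itself is measurable in the configuration once the configuration is presented as
an s-finite kernel. -/
theorem configKernel_apply {φ : Measure Plane} (hφ : φ ∈ locallyFinite) : configKernel φ = φ := by
  ext s hs
  have hd : ∀ n, MeasurableSet (disjointed (fun n : ℕ => Metric.ball (0 : Plane) n) n) :=
    MeasurableSet.disjointed (fun n => measurableSet_ball)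
  rw [configKernel, Kernel.sum_apply' _ _ hs, ENNReal.tsum_prod']
  have h1 : ∀ n, ∑' k, shellKernel (n, k) φ s
      = φ (s ∩ disjointed (fun n : ℕ => Metric.ball (0 : Plane) n) n) := by
    intro n
    rw [tsum_eq_single ⌊(φ (disjointed (fun n : ℕ => Metric.ball (0 : Plane) n) n)).toReal⌋₊]
    · simp [shellKernel, indicator, hφ, Measure.restrict_apply hs]
    · intro k hk
      simp [shellKernel, indicator, hφ, hk.symm]
  simp_rw [h1]
  rw [← measure_iUnion, ← inter_iUnion, iUnion_disjointed, Metric.iUnion_ball_nat, inter_univ]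
  · exact fun a b hab => ((disjoint_disjointed _) hab).mono inter_subset_right inter_subset_right
  · exact fun n => hs.inter (hd n)

/-! ### Pairs of points and generating functions of counts. -/

section PoissonPoints

variable {Ω : Type*} [MeasurableSpace Ω] {P : Measure Ω} {lam : ℝ} {X : ℕ → Ω → Plane}

/-- The count of each ball has a law carried by the natural numbers, hence avoids ⊤; countably many
balls suffice. -/
theorem IsPoissonProcess.ae_locallyFinite (hX : IsPoissonProcess lam X P) :
    ∀ᵐ ω ∂P, pointMeasure X ω ∈ locallyFinite := by
  refine ae_all_iff.2 fun n => ?_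
  have h := hX.lintegral_count (B := Metric.ball 0 n) measurableSet_ball measure_ball_lt_top.ne
    (f := ({⊤} : Set ENNReal).indicator 1) (measurable_one.indicator (measurableSet_singleton _))
  have hm : Measurable fun ω => pointMeasure X ω (Metric.ball 0 n) :=
    (Measure.measurable_coe measurableSet_ball).comp hX.measurable_pointMeasure
  have h0 : ∀ k : ℕ, ({⊤} : Set ENNReal).indicator (1 : ENNReal → ENNReal) k = 0 := fun k => by
    simp
  simp only [h0, lintegral_zero] at h
  have h' := (lintegral_eq_zero_iff (f := fun ω => ({⊤} : Set ENNReal).indicator (1 : ENNReal →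
    ENNReal) (pointMeasure X ω (Metric.ball 0 n)))
    ((measurable_one.indicator (measurableSet_singleton _)).comp hm)).1 h
  filter_upwards [h'] with ω hω
  by_contra hne
  rw [not_lt_top_iff] at hne
  simp [hne] at hω

/-- The Mecke equation for pairs of points. -/
theorem IsPoissonProcess.mecke_pair [IsProbabilityMeasure P] (hX : IsPoissonProcess lam X P)
    (hlam : 0 ≤ lam) {G : Plane × Plane × Measure Plane → ENNReal} (hG : Measurable G) :
    ∫⁻ ω, ∑' n, ∑' k, G (X n ω, X k ω, pointMeasure X ω) ∂P
      = ENNReal.ofReal lam * (∫⁻ x, ∫⁻ ω, G (x, x, pointMeasure X ω + Measure.dirac x) ∂P)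
        + ENNReal.ofReal lam ^ 2 * ∫⁻ x, ∫⁻ y, ∫⁻ ω,
          G (x, y, pointMeasure X ω + Measure.dirac x + Measure.dirac y) ∂P := by
  have hΦ := hX.measurable_pointMeasure
  have hadd := measurable_add_dirac
  -- The inner sum over points becomes an integral against `configKernel`, so that the one-point
  -- Mecke equation applies to the outer sum.
  have hF : Measurable fun z : Plane × Measure Plane => ∫⁻ y, G (z.1, y, z.2) ∂(configKernel z.2) :=
    Measurable.lintegral_kernel_prod_right (κ := configKernel.comap Prod.snd measurable_snd)
      (f := fun z y => G (z.1, y, z.2)) (by unfold Function.uncurry; fun_prop)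
  have h1 := hX.mecke hlam hF
  have h2 : ∫⁻ ω, ∑' n, ∑' k, G (X n ω, X k ω, pointMeasure X ω) ∂P
      = ∫⁻ ω, ∑' n, ∫⁻ y, G (X n ω, y, pointMeasure X ω) ∂(configKernel (pointMeasure X ω)) ∂P := by
    refine lintegral_congr_ae ?_
    filter_upwards [hX.ae_locallyFinite] with ω hω
    rw [configKernel_apply hω]
    simp only [lintegral_pointMeasure]
  have hGx : ∀ x : Plane, Measurable fun z : Plane × Measure Plane =>
      G (x, z.1, z.2 + Measure.dirac x) := by
    intro x
    have : Measurable fun z : Plane × Measure Plane => z.2 + Measure.dirac x :=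
      hadd.comp (measurable_const.prodMk measurable_snd)
    fun_prop
  have hGd : Measurable fun p : Plane × Ω => G (p.1, p.1, pointMeasure X p.2 + Measure.dirac p.1) :=
    by
    have : Measurable fun p : Plane × Ω => pointMeasure X p.2 + Measure.dirac p.1 :=
      hadd.comp (measurable_fst.prodMk (hΦ.comp measurable_snd))
    fun_prop
  -- In the enlarged configuration the inner integral sees the added point `x`, which gives the
  -- diagonal term, and the original points, to which the Mecke equation is applied a second time.
  have h3 : ∀ x, ∫⁻ ω, ∫⁻ y, G (x, y, pointMeasure X ω + Measure.dirac x)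
        ∂(configKernel (pointMeasure X ω + Measure.dirac x)) ∂P
      = (∫⁻ ω, G (x, x, pointMeasure X ω + Measure.dirac x) ∂P)
        + ENNReal.ofReal lam * ∫⁻ y, ∫⁻ ω,
          G (x, y, pointMeasure X ω + Measure.dirac x + Measure.dirac y) ∂P := by
    intro x
    have h4 := hX.mecke hlam (hGx x)
    simp only [add_right_comm _ (Measure.dirac _) (Measure.dirac x)] at h4
    rw [← h4, ← lintegral_add_left (by fun_prop)]
    refine lintegral_congr_ae ?_
    filter_upwards [hX.ae_locallyFinite] with ω hω
    rw [configKernel_apply (add_dirac_mem_locallyFinite hω x), lintegral_add_measure,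
      lintegral_dirac, lintegral_pointMeasure, add_comm]
  rw [h2, h1]
  simp only [h3]
  rw [lintegral_add_left (hGd.lintegral_prod_right' (ν := P)),
    lintegral_const_mul' _ _ ENNReal.ofReal_ne_top, mul_add, ← mul_assoc, sq]

/-- The number of points, as a natural number. -/
def count (a : ENNReal) : ℕ := ⌊a.toReal⌋₊

theorem measurable_count : Measurable count :=
  Nat.measurable_floor.comp ENNReal.measurable_toReal

@[simp] theorem count_natCast (k : ℕ) : count k = k := by simp [count]

theorem IsPoissonProcess.lintegral_pow_count [IsProbabilityMeasure P]
    (hX : IsPoissonProcess lam X P) (hlam : 0 ≤ lam) {B : Set Plane} (hB : MeasurableSet B)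
    (hBv : volume B ≠ ⊤) {s : ℝ} (hs : 0 ≤ s) :
    ∫⁻ ω, ENNReal.ofReal (s ^ count (pointMeasure X ω B)) ∂P
      = ENNReal.ofReal (Real.exp (-(lam * (volume B).toReal * (1 - s)))) := by
  have hm : Measurable fun a => ENNReal.ofReal (s ^ count a) :=
    (measurable_from_top (f := fun k : ℕ => ENNReal.ofReal (s ^ k))).comp measurable_count
  rw [hX.lintegral_count hB hBv hm]
  simp only [count_natCast]
  rw [lintegral_pow_poissonMeasure _ hs, Real.coe_toNNReal _ (by positivity)]

/-- The joint generating function of the numbers of points in three disjoint sets. -/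
theorem IsPoissonProcess.lintegral_pow_count₃ [IsProbabilityMeasure P]
    (hX : IsPoissonProcess lam X P) (hlam : 0 ≤ lam) {B : Fin 3 → Set Plane}
    (hB : ∀ i, MeasurableSet (B i)) (hd : Pairwise fun i j => Disjoint (B i) (B j))
    (hBv : ∀ i, volume (B i) ≠ ⊤) {p q w : ℝ} (hp : 0 ≤ p) (hq : 0 ≤ q) (hw : 0 ≤ w) :
    ∫⁻ ω, ENNReal.ofReal (p ^ count (pointMeasure X ω (B 0)) * q ^ count (pointMeasure X ω (B 1))
        * w ^ count (pointMeasure X ω (B 2))) ∂P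
      = ENNReal.ofReal (Real.exp (-(lam * ((volume (B 0)).toReal * (1 - p)
          + (volume (B 1)).toReal * (1 - q) + (volume (B 2)).toReal * (1 - w))))) := by
  have hm : ∀ i, Measurable fun ω => pointMeasure X ω (B i) := fun i =>
    (Measure.measurable_coe (hB i)).comp hX.measurable_pointMeasure
  have hpow : ∀ s : ℝ, Measurable fun a => ENNReal.ofReal (s ^ count a) := fun s =>
    (measurable_from_top (f := fun k : ℕ => ENNReal.ofReal (s ^ k))).comp measurable_count
  have hi := hX.count_indep 3 B hB hd
  have hi2 : iIndepFun (fun i ω => ENNReal.ofReal ((![p, q, w] i) ^ count (pointMeasure X ω (B i))))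
      P := hi.comp (fun i a => ENNReal.ofReal ((![p, q, w] i) ^ count a)) (fun i => hpow _)
  have h := lintegral_prod_eq_prod_lintegral_of_indepFun Finset.univ _ hi2
    (fun i => (hpow _).comp (hm i))
  simp only [Fin.prod_univ_three] at h
  change ∫⁻ ω, ENNReal.ofReal (p ^ count (pointMeasure X ω (B 0))) *
      ENNReal.ofReal (q ^ count (pointMeasure X ω (B 1))) *
      ENNReal.ofReal (w ^ count (pointMeasure X ω (B 2))) ∂P
    = (∫⁻ ω, ENNReal.ofReal (p ^ count (pointMeasure X ω (B 0))) ∂P) *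
      (∫⁻ ω, ENNReal.ofReal (q ^ count (pointMeasure X ω (B 1))) ∂P) *
      ∫⁻ ω, ENNReal.ofReal (w ^ count (pointMeasure X ω (B 2))) ∂P at h
  rw [hX.lintegral_pow_count hlam (hB _) (hBv _) hp, hX.lintegral_pow_count hlam (hB _) (hBv _) hq,
    hX.lintegral_pow_count hlam (hB _) (hBv _) hw, ← ENNReal.ofReal_mul (by positivity),
    ← ENNReal.ofReal_mul (by positivity), ← Real.exp_add, ← Real.exp_add] at h
  rw [show -(lam * ((volume (B 0)).toReal * (1 - p)
          + (volume (B 1)).toReal * (1 - q) + (volume (B 2)).toReal * (1 - w)))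
      = -(lam * (volume (B 0)).toReal * (1 - p)) + -(lam * (volume (B 1)).toReal * (1 - q))
        + -(lam * (volume (B 2)).toReal * (1 - w)) by ring, ← h]
  refine lintegral_congr fun ω => ?_
  rw [ENNReal.ofReal_mul (by positivity), ENNReal.ofReal_mul (by positivity)]

end PoissonPoints

/-! ### Comparison of uniform marks -/

/-- The uniform distribution on the unit interval. -/
def unif : Measure ℝ := volume.restrict (Icc (0 : ℝ) 1)

instance : IsProbabilityMeasure unif := ⟨by simp [unif]⟩

/-- The probability that `u` lies below `a` uniform marks, `v` below `b` further marks, and both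
below `c` further marks, for uniform `u` and `v`. -/
def markProb (a b c : ℕ) : ENNReal :=
  ∫⁻ z, ENNReal.ofReal ((1 - z.1) ^ a * (1 - z.2) ^ b * (1 - max z.1 z.2) ^ c) ∂(unif.prod unif)

section Marks

variable {Ω ι : Type*} [MeasurableSpace Ω] {P : Measure Ω}
  {U : ι → Ω → ℝ}

theorem prob_mark_gt (hUm : ∀ i, Measurable (U i)) (hU : ∀ i, HasLaw (U i) unif P) (i : ι) {w : ℝ}
    (hw : w ∈ Icc (0 : ℝ) 1) : P {ω | w < U i ω} = ENNReal.ofReal (1 - w) := by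
  have h : P {ω | w < U i ω} = P.map (U i) (Ioi w) :=
    (Measure.map_apply (hUm i) measurableSet_Ioi).symm
  rw [h, (hU i).map_eq, unif, Measure.restrict_apply measurableSet_Ioi]
  have : Ioi w ∩ Icc 0 1 = Ioc w 1 := by
    ext x; simp only [mem_inter_iff, mem_Ioi, mem_Icc, mem_Ioc]
    exact ⟨fun h => ⟨h.1, h.2.2⟩, fun h => ⟨h.1, (hw.1.trans h.1.le), h.2⟩⟩
  rw [this, Real.volume_Ioc]

theorem prob_marks_gt (hUm : ∀ i, Measurable (U i)) (hU : ∀ i, HasLaw (U i) unif P)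
    (hi : iIndepFun U P) (T : Finset ι) {w : ι → ℝ} (hw : ∀ i ∈ T, w i ∈ Icc (0 : ℝ) 1) :
    P {ω | ∀ i ∈ T, w i < U i ω} = ENNReal.ofReal (∏ i ∈ T, (1 - w i)) := by
  have h := hi.measure_inter_preimage_eq_mul T (sets := fun i => Ioi (w i))
    (fun i _ => measurableSet_Ioi)
  have h1 : {ω | ∀ i ∈ T, w i < U i ω} = ⋂ i ∈ T, U i ⁻¹' Ioi (w i) := by
    ext ω; simp
  rw [h1, h, ENNReal.ofReal_prod_of_nonneg (fun i hi => sub_nonneg.2 (hw i hi).2)]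
  exact Finset.prod_congr rfl fun i hi => prob_mark_gt hUm hU i (hw i hi)

/-- Joint comparison of two marks with two finite families of marks. -/
theorem prob_marks_lt [IsProbabilityMeasure P] (hUm : ∀ i, Measurable (U i)) (hU : ∀ i, HasLaw (U i) unif P)
    (hi : iIndepFun U P) [DecidableEq ι] {p q : ι} (hpq : p ≠ q) {S S' : Finset ι} (hpS : p ∉ S)
    (hqS : q ∉ S) (hpS' : p ∉ S') (hqS' : q ∉ S') :
    P {ω | (∀ j ∈ S, U p ω < U j ω) ∧ ∀ j ∈ S', U q ω < U j ω}
      = markProb (S \ S').card (S' \ S).card (S ∩ S').card := by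
  classical
  -- the vector of all marks involved splits into two independent parts
  have h2 := hi.indepFun_finset {p, q} (S ∪ S') (by
    rw [Finset.disjoint_left]
    intro a ha
    simp only [Finset.mem_insert, Finset.mem_singleton] at ha
    rcases ha with rfl | rfl <;> simp [*]) hUm
  have h3 : IndepFun (fun ω => (U p ω, U q ω)) (fun ω (i : {i // i ∈ S ∪ S'}) => U i.1 ω) P :=
    h2.comp (φ := fun v : ({i // i ∈ ({p, q} : Finset ι)} → ℝ) =>
      (v ⟨p, by simp⟩, v ⟨q, by simp⟩)) (ψ := id) (by fun_prop) measurable_id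
  have hV : Measurable fun ω (i : {i // i ∈ S ∪ S'}) => U i.1 ω :=
    measurable_pi_lambda _ fun i => hUm i.1
  have hpair : P.map (fun ω => (U p ω, U q ω)) = unif.prod unif := by
    rw [(indepFun_iff_map_prod_eq_prod_map_map (hUm p).aemeasurable (hUm q).aemeasurable).1
      (hi.indepFun hpq), (hU p).map_eq, (hU q).map_eq]
  let A : Set ((ℝ × ℝ) × ({i // i ∈ S ∪ S'} → ℝ)) :=
    {y | (∀ j, j.1 ∈ S → y.1.1 < y.2 j) ∧ ∀ j, j.1 ∈ S' → y.1.2 < y.2 j}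
  have hA : MeasurableSet A := by
    have : A = (⋂ j : {i // i ∈ S ∪ S'}, ⋂ _ : j.1 ∈ S, {y | y.1.1 < y.2 j}) ∩
        ⋂ j : {i // i ∈ S ∪ S'}, ⋂ _ : j.1 ∈ S', {y | y.1.2 < y.2 j} := by
      ext y; simp [A]
    rw [this]
    refine (MeasurableSet.iInter fun j => MeasurableSet.iInter fun _ => ?_).inter
      (MeasurableSet.iInter fun j => MeasurableSet.iInter fun _ => ?_) <;>
    exact measurableSet_lt (by fun_prop) (by fun_prop)
  have hE : {ω | (∀ j ∈ S, U p ω < U j ω) ∧ ∀ j ∈ S', U q ω < U j ω}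
      = {ω | ((U p ω, U q ω), fun i : {i // i ∈ S ∪ S'} => U i.1 ω) ∈ A} := by
    ext ω
    simp only [A, mem_ofPred_eq, Subtype.forall, Finset.mem_union]
    exact ⟨fun h => ⟨fun j _ hj => h.1 j hj, fun j _ hj => h.2 j hj⟩,
      fun h => ⟨fun j hj => h.1 j (Or.inl hj) hj, fun j hj => h.2 j (Or.inr hj) hj⟩⟩
  have hEm : MeasurableSet {ω | ((U p ω, U q ω), fun i : {i // i ∈ S ∪ S'} => U i.1 ω) ∈ A} :=
    (((hUm p).prodMk (hUm q)).prodMk hV) hA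
  have hind : ∀ ω, {ω | ((U p ω, U q ω), fun i : {i // i ∈ S ∪ S'} => U i.1 ω) ∈ A}.indicator
      (1 : Ω → ENNReal) ω = A.indicator 1 ((U p ω, U q ω), fun i => U i.1 ω) := by
    intro ω; simp [indicator]
  rw [hE, ← lintegral_indicator_one hEm, lintegral_congr hind,
    lintegral_comp_prodMk_of_indepFun h3 ((hUm p).prodMk (hUm q)).aemeasurable
      hV.aemeasurable (measurable_one.indicator hA)]
  have hG : Measurable fun z : ℝ × ℝ => ∫⁻ ω', A.indicator (1 : (ℝ × ℝ) × ({i // i ∈ S ∪ S'} → ℝ) → ENNReal)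
      (z, fun i : {i // i ∈ S ∪ S'} => U i.1 ω') ∂P := by
    refine Measurable.lintegral_prod_right' (f := fun y : (ℝ × ℝ) × Ω =>
      A.indicator (1 : (ℝ × ℝ) × ({i // i ∈ S ∪ S'} → ℝ) → ENNReal) (y.1, fun i : {i // i ∈ S ∪ S'} => U i.1 y.2)) ?_
    refine (measurable_one.indicator hA).comp (measurable_fst.prodMk ?_)
    exact hV.comp measurable_snd
  rw [← lintegral_map (f := fun z : ℝ × ℝ => ∫⁻ ω', A.indicator (1 : (ℝ × ℝ) × ({i // i ∈ S ∪ S'} → ℝ) → ENNReal)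
      (z, fun i : {i // i ∈ S ∪ S'} => U i.1 ω') ∂P) hG ((hUm p).prodMk (hUm q)), hpair, markProb]
  have hsupp : ∀ᵐ z ∂(unif.prod unif), z.1 ∈ Icc (0 : ℝ) 1 ∧ z.2 ∈ Icc (0 : ℝ) 1 := by
    rw [unif, Measure.prod_restrict]
    filter_upwards [ae_restrict_mem (measurableSet_Icc.prod measurableSet_Icc)] with z hz
    exact hz
  refine lintegral_congr_ae ?_
  filter_upwards [hsupp] with z hz
  -- `w j` is the largest threshold imposed on the mark `j`: both values if `j` competes in both
  -- families, one of them otherwise.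
  let w : ι → ℝ := fun j => if j ∈ S then (if j ∈ S' then max z.1 z.2 else z.1) else z.2
  have hw : ∀ i ∈ S ∪ S', w i ∈ Icc (0 : ℝ) 1 := by
    intro i _
    simp only [w]
    split_ifs
    · exact ⟨le_max_of_le_left hz.1.1, max_le hz.1.2 hz.2.2⟩
    · exact hz.1
    · exact hz.2
  have hset : {ω | (z, fun i : {i // i ∈ S ∪ S'} => U i.1 ω) ∈ A}
      = {ω | ∀ i ∈ S ∪ S', w i < U i ω} := by
    ext ω
    simp only [A, mem_ofPred_eq, Subtype.forall, Finset.mem_union, w]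
    constructor
    · rintro ⟨h1, h2⟩ i hi
      split_ifs with hS hS'
      · exact max_lt (h1 i hi hS) (h2 i hi hS')
      · exact h1 i hi hS
      · exact h2 i hi (hi.resolve_left hS)
    · intro h
      refine ⟨fun i hi hS => ?_, fun i hi hS' => ?_⟩
      · have := h i hi
        rw [if_pos hS] at this
        split_ifs at this with hS'
        · exact (le_max_left _ _).trans_lt this
        · exact this
      · have := h i hi
        split_ifs at this with hS
        · exact (le_max_right _ _).trans_lt this
        · exact this
  have hsm : MeasurableSet {ω | (z, fun i : {i // i ∈ S ∪ S'} => U i.1 ω) ∈ A} :=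
    (measurable_const.prodMk hV) hA
  have hi1 : ∀ ω, A.indicator (1 : (ℝ × ℝ) × ({i // i ∈ S ∪ S'} → ℝ) → ENNReal) (z, fun i : {i // i ∈ S ∪ S'} => U i.1 ω)
      = {ω | (z, fun i : {i // i ∈ S ∪ S'} => U i.1 ω) ∈ A}.indicator 1 ω := by
    intro ω; simp [indicator]
  rw [lintegral_congr hi1, lintegral_indicator_one hsm, hset, prob_marks_gt hUm hU hi _ hw]
  congr 1
  -- The threshold is constant on each of these three disjoint parts, so the product over the union
  -- becomes three powers.
  have hdec : S ∪ S' = (S \ S') ∪ (S' \ S) ∪ (S ∩ S') := by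
    ext j; simp only [Finset.mem_union, Finset.mem_sdiff, Finset.mem_inter]; tauto
  rw [hdec, Finset.prod_union, Finset.prod_union]
  · congr 1
    · congr 1
      · refine Finset.prod_eq_pow_card fun j hj => ?_
        simp only [Finset.mem_sdiff] at hj
        simp [w, hj]
      · refine Finset.prod_eq_pow_card fun j hj => ?_
        simp only [Finset.mem_sdiff] at hj
        simp [w, hj]
    · refine Finset.prod_eq_pow_card fun j hj => ?_
      simp only [Finset.mem_inter] at hj
      simp [w, hj]
  · rw [Finset.disjoint_left]; intro j; simp only [Finset.mem_sdiff]; tauto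
  · rw [Finset.disjoint_left]; intro j
    simp only [Finset.mem_sdiff, Finset.mem_union, Finset.mem_inter]; tauto

end Marks

/-! ### Retainment probabilities given the locations -/

section Counting

variable {Ω : Type*} {X : ℕ → Ω → Plane} {ω : Ω}

theorem finite_of_pointMeasure_lt_top {B : Set Plane} (hB : MeasurableSet B)
    (h : pointMeasure X ω B < ⊤) : {n | X n ω ∈ B}.Finite := by
  rw [pointMeasure_apply X ω hB] at h
  refine (ENNReal.finite_const_le_of_tsum_ne_top h.ne one_ne_zero).subset fun n hn => ?_
  have : X n ω ∈ B := hn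
  simp [this]

theorem count_pointMeasure {B : Set Plane} (hB : MeasurableSet B) {s : Finset ℕ}
    (hs : ∀ n, n ∈ s ↔ X n ω ∈ B) : count (pointMeasure X ω B) = s.card := by
  rw [pointMeasure_apply X ω hB, tsum_eq_sum (s := s) (fun n hn => by simp [← hs, hn]),
    Finset.sum_congr rfl (g := fun _ => (1 : ENNReal)) (fun n hn => by simp [(hs n).1 hn])]
  simp

theorem exists_nat_pointMeasure {B : Set Plane} (hB : MeasurableSet B)
    (h : pointMeasure X ω B < ⊤) : ∃ k : ℕ, pointMeasure X ω B = k := by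
  have hf := finite_of_pointMeasure_lt_top hB h
  refine ⟨hf.toFinset.card, ?_⟩
  rw [pointMeasure_apply X ω hB, tsum_eq_sum (s := hf.toFinset) (fun n hn => by
    have : X n ω ∉ B := fun h => hn (by simpa using h)
    simp [this]),
    Finset.sum_congr rfl (g := fun _ => (1 : ENNReal)) (fun n hn => by
    have : X n ω ∈ B := by simpa using hn
    simp [this])]
  simp

end Counting

/-- The probability that a point at `x` of the configuration `φ` is retained. -/
def retainProb (d : ℝ) (x : Plane) (φ : Measure Plane) : ENNReal :=
  markProb (count (φ (Metric.closedBall x d)) - 1) 0 0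

/-- The probability that a point at `x` is retained in a first and a point at `y` in a second slot. -/
def retainProbTwoSlots (d : ℝ) (x y : Plane) (φ : Measure Plane) : ENNReal :=
  markProb (count (φ (Metric.closedBall x d)) - 1) (count (φ (Metric.closedBall y d)) - 1) 0

open scoped Classical in
/-- The probability that two points at `x` and `y` are both retained in one slot. -/
def retainProbPair (d : ℝ) (x y : Plane) (φ : Measure Plane) : ENNReal :=
  if dist x y ≤ d then 0 else
    markProb (count (φ (Metric.closedBall x d \ Metric.closedBall y d)) - 1)
      (count (φ (Metric.closedBall y d \ Metric.closedBall x d)) - 1)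
      (count (φ (Metric.closedBall x d ∩ Metric.closedBall y d)))

/-- Retainment as a condition on fixed locations `x` and marks `u`. -/
def RetainedAt (d : ℝ) (x : ℕ → Plane) (u : ℤ × ℕ → ℝ) (t : ℤ) (n : ℕ) : Prop :=
  ∀ k, k ≠ n → dist (x n) (x k) ≤ d → u (t, n) < u (t, k)

section Given

variable {Ω : Type*} [MeasurableSpace Ω] {P : Measure Ω} [IsProbabilityMeasure P]
  {U : ℤ → ℕ → Ω → ℝ} {Ω' : Type*} {X : ℕ → Ω' → Plane} {ω' : Ω'} {d : ℝ}

theorem exists_neighbours (hφ : pointMeasure X ω' ∈ locallyFinite) (n : ℕ) :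
    ∃ s : Finset ℕ, ∀ k, k ∈ s ↔ k ≠ n ∧ dist (X n ω') (X k ω') ≤ d := by
  have hf := finite_of_pointMeasure_lt_top (X := X) (ω := ω')
    (B := Metric.closedBall (X n ω') d) measurableSet_closedBall
    (lt_top_of_locallyFinite hφ Metric.isBounded_closedBall)
  refine ⟨hf.toFinset.erase n, fun k => ?_⟩
  simp [dist_comm]

/-- The disc contains its own centre, which is not a competitor; this explains the subtraction of
one. Points are counted with multiplicity, as the indices require. -/
theorem count_closedBall (hd : 0 ≤ d) {n : ℕ} {s : Finset ℕ}
    (hs : ∀ k, k ∈ s ↔ k ≠ n ∧ dist (X n ω') (X k ω') ≤ d) :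
    count (pointMeasure X ω' (Metric.closedBall (X n ω') d)) - 1 = s.card := by
  have hn : n ∉ s := by simp [hs]
  rw [count_pointMeasure (s := insert n s) measurableSet_closedBall, Finset.card_insert_of_notMem hn]
  · simp
  · intro k
    rw [Finset.mem_insert, hs, Metric.mem_closedBall, dist_comm]
    by_cases h : k = n
    · simp [h, hd]
    · simp [h]

theorem retainedAt_iff {x : ℕ → Plane} {u : ℤ × ℕ → ℝ} {t : ℤ} {n : ℕ} {s : Finset ℕ}
    (hs : ∀ k, k ∈ s ↔ k ≠ n ∧ dist (x n) (x k) ≤ d) :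
    RetainedAt d x u t n ↔ ∀ p ∈ s.image (Prod.mk t), u (t, n) < u p := by
  simp only [Finset.forall_mem_image, hs, and_imp]
  rfl

/-- Marks of different slots are different variables, so no mark is compared with both: the shared
exponent is zero, even when the two points coincide. -/
theorem prob_retainedAt_two_slots (hUm : ∀ t n, Measurable (U t n))
    (hU : ∀ t n, HasLaw (U t n) unif P) (hi : iIndepFun (fun p : ℤ × ℕ => U p.1 p.2) P)
    (hd : 0 ≤ d) (hφ : pointMeasure X ω' ∈ locallyFinite) {t₁ t₂ : ℤ} (ht : t₁ ≠ t₂) (n k : ℕ) :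
    P {ω | RetainedAt d (fun n => X n ω') (fun p => U p.1 p.2 ω) t₁ n ∧
        RetainedAt d (fun n => X n ω') (fun p => U p.1 p.2 ω) t₂ k}
      = retainProbTwoSlots d (X n ω') (X k ω') (pointMeasure X ω') := by
  obtain ⟨s, hs⟩ := exists_neighbours (d := d) hφ n
  obtain ⟨s', hs'⟩ := exists_neighbours (d := d) hφ k
  have hdis : Disjoint (s.image (Prod.mk t₁)) (s'.image (Prod.mk t₂)) := by
    rw [Finset.disjoint_left]
    rintro _ h1 h2
    simp only [Finset.mem_image] at h1 h2
    obtain ⟨a, -, rfl⟩ := h1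
    obtain ⟨b, -, h⟩ := h2
    exact ht (Prod.ext_iff.1 h).1.symm
  rw [retainProbTwoSlots, count_closedBall hd hs, count_closedBall hd hs']
  have h := prob_marks_lt (fun p : ℤ × ℕ => hUm p.1 p.2) (fun p => hU p.1 p.2) hi
    (p := (t₁, n)) (q := (t₂, k)) (S := s.image (Prod.mk t₁)) (S' := s'.image (Prod.mk t₂))
    (by simp [ht]) (by simp [hs]) (by simp [ht]) (by simp [ht.symm]) (by simp [hs'])
  simp only [retainedAt_iff (d := d) (x := fun n => X n ω') hs,
    retainedAt_iff (d := d) (x := fun n => X n ω') hs']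
  rw [h, Finset.sdiff_eq_self_of_disjoint hdis, Finset.sdiff_eq_self_of_disjoint hdis.symm,
    Finset.disjoint_iff_inter_eq_empty.1 hdis, Finset.card_empty,
    Finset.card_image_of_injective _ (Prod.mk_right_injective _),
    Finset.card_image_of_injective _ (Prod.mk_right_injective _)]

theorem prob_retainedAt (hUm : ∀ t n, Measurable (U t n))
    (hU : ∀ t n, HasLaw (U t n) unif P) (hi : iIndepFun (fun p : ℤ × ℕ => U p.1 p.2) P)
    (hd : 0 ≤ d) (hφ : pointMeasure X ω' ∈ locallyFinite) (t : ℤ) (n : ℕ) :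
    P {ω | RetainedAt d (fun n => X n ω') (fun p => U p.1 p.2 ω) t n}
      = retainProb d (X n ω') (pointMeasure X ω') := by
  obtain ⟨s, hs⟩ := exists_neighbours (d := d) hφ n
  rw [retainProb, count_closedBall hd hs]
  -- The second comparison is void: an empty family of competitors for a mark taken from another
  -- slot.
  have h := prob_marks_lt (fun p : ℤ × ℕ => hUm p.1 p.2) (fun p => hU p.1 p.2) hi
    (p := (t, n)) (q := (t + 1, n)) (S := s.image (Prod.mk t)) (S' := ∅)
    (by simp) (by simp [hs]) (by simp) (by simp) (by simp)
  simp only [retainedAt_iff (d := d) (x := fun n => X n ω') hs]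
  simp only [Finset.notMem_empty, false_imp_iff, implies_true, and_true] at h
  rw [h]
  simp [Finset.card_image_of_injective _ (Prod.mk_right_injective t)]

/-- Within distance `d` each mark would have to be smaller than the other. Beyond it neither point
competes with the other; competitors in the lens must exceed both marks, the rest only one. The
centres lie outside the lens, so its count needs no correction. -/
theorem prob_retainedAt_pair (hUm : ∀ t n, Measurable (U t n))
    (hU : ∀ t n, HasLaw (U t n) unif P) (hi : iIndepFun (fun p : ℤ × ℕ => U p.1 p.2) P)
    (hd : 0 ≤ d) (hφ : pointMeasure X ω' ∈ locallyFinite) (t : ℤ) {n k : ℕ} (hnk : n ≠ k) :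
    P {ω | RetainedAt d (fun n => X n ω') (fun p => U p.1 p.2 ω) t n ∧
        RetainedAt d (fun n => X n ω') (fun p => U p.1 p.2 ω) t k}
      = retainProbPair d (X n ω') (X k ω') (pointMeasure X ω') := by
  rw [retainProbPair]
  split_ifs with hdist
  · convert measure_empty (μ := P)
    ext ω
    simp only [mem_ofPred_eq, mem_empty_iff_false, iff_false, not_and]
    intro h1 h2
    exact lt_asymm (h1 k hnk.symm hdist) (h2 n hnk (by rwa [dist_comm]))
  · obtain ⟨s, hs⟩ := exists_neighbours (d := d) hφ n
    obtain ⟨s', hs'⟩ := exists_neighbours (d := d) hφ k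
    have hdist' : ¬ dist (X k ω') (X n ω') ≤ d := by rwa [dist_comm]
    have h := prob_marks_lt (fun p : ℤ × ℕ => hUm p.1 p.2) (fun p => hU p.1 p.2) hi
      (p := (t, n)) (q := (t, k)) (S := s.image (Prod.mk t)) (S' := s'.image (Prod.mk t))
      (by simp [hnk]) (by simp [hs]) (by simp [hs, hdist]) (by simp [hs', hdist'])
      (by simp [hs'])
    simp only [retainedAt_iff (d := d) (x := fun n => X n ω') hs,
      retainedAt_iff (d := d) (x := fun n => X n ω') hs']
    have hinj := Prod.mk_right_injective (β := ℕ) t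
    rw [h, ← Finset.image_sdiff _ _ hinj, ← Finset.image_sdiff _ _ hinj,
      ← Finset.image_inter _ _ hinj, Finset.card_image_of_injective _ hinj,
      Finset.card_image_of_injective _ hinj, Finset.card_image_of_injective _ hinj]
    have hb : ∀ x : Plane, MeasurableSet (Metric.closedBall x d) := fun x =>
      measurableSet_closedBall
    congr 1
    · rw [count_pointMeasure (s := insert n (s \ s')) ((hb _).diff (hb _)),
        Finset.card_insert_of_notMem (by simp [hs]), Nat.add_sub_cancel]
      intro j
      simp only [Finset.mem_insert, Finset.mem_sdiff, hs, hs', Set.mem_sdiff, Metric.mem_closedBall,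
        dist_comm (X j ω')]
      by_cases hj : j = n
      · subst hj; simp [hd, hdist']
      · by_cases hj' : j = k
        · subst hj'; simp [hdist, hj]
        · simp [hj, hj']
    · rw [count_pointMeasure (s := insert k (s' \ s)) ((hb _).diff (hb _)),
        Finset.card_insert_of_notMem (by simp [hs']), Nat.add_sub_cancel]
      intro j
      simp only [Finset.mem_insert, Finset.mem_sdiff, hs, hs', Set.mem_sdiff, Metric.mem_closedBall,
        dist_comm (X j ω')]
      by_cases hj : j = k
      · subst hj; simp [hd, hdist]
      · by_cases hj' : j = n
        · subst hj'; simp [hdist', hj]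
        · simp [hj, hj']
    · rw [count_pointMeasure (s := s ∩ s') ((hb _).inter (hb _))]
      intro j
      simp only [Finset.mem_inter, hs, hs', mem_inter_iff, Metric.mem_closedBall,
        dist_comm (X j ω')]
      by_cases hj : j = k
      · subst hj; simp [hdist]
      · by_cases hj' : j = n
        · subst hj'; simp [hdist']
        · simp [hj, hj']

end Given

/-! ### Retainment probabilities averaged over the locations -/

theorem ae_unif_prod_mem : ∀ᵐ z ∂(unif.prod unif), z.1 ∈ Icc (0 : ℝ) 1 ∧ z.2 ∈ Icc (0 : ℝ) 1 := by
  rw [unif, Measure.prod_restrict]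
  filter_upwards [ae_restrict_mem (measurableSet_Icc.prod measurableSet_Icc)] with z hz
  exact hz

section Average

variable {Ω : Type*} [MeasurableSpace Ω] {P : Measure Ω} [IsProbabilityMeasure P] {lam : ℝ}
  {X : ℕ → Ω → Plane}

/-- Tonelli puts the average over configurations inside, where for fixed marks it is a joint
generating function of independent Poisson counts. -/
theorem IsPoissonProcess.lintegral_lintegral_pow_count (hX : IsPoissonProcess lam X P)
    (hlam : 0 ≤ lam) {B : Fin 3 → Set Plane}
    (hB : ∀ i, MeasurableSet (B i)) (hd : Pairwise fun i j => Disjoint (B i) (B j))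
    (hBv : ∀ i, volume (B i) ≠ ⊤) {f p q w : ℝ × ℝ → ℝ} (hf : Measurable f) (hp : Measurable p)
    (hq : Measurable q) (hw : Measurable w)
    (h0 : ∀ z : ℝ × ℝ, z.1 ∈ Icc (0 : ℝ) 1 → z.2 ∈ Icc (0 : ℝ) 1 →
      0 ≤ f z ∧ 0 ≤ p z ∧ 0 ≤ q z ∧ 0 ≤ w z) :
    ∫⁻ ω, ∫⁻ z, ENNReal.ofReal (f z * (p z ^ count (pointMeasure X ω (B 0)) *
        q z ^ count (pointMeasure X ω (B 1)) * w z ^ count (pointMeasure X ω (B 2))))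
        ∂(unif.prod unif) ∂P
      = ∫⁻ z, ENNReal.ofReal (f z * Real.exp (-(lam * ((volume (B 0)).toReal * (1 - p z)
          + (volume (B 1)).toReal * (1 - q z) + (volume (B 2)).toReal * (1 - w z)))))
        ∂(unif.prod unif) := by
  have hm : ∀ i, Measurable fun ω => count (pointMeasure X ω (B i)) := fun i =>
    measurable_count.comp ((Measure.measurable_coe (hB i)).comp hX.measurable_pointMeasure)
  have hpow : ∀ (s : ℝ × ℝ → ℝ) (i : Fin 3), Measurable s → Measurable fun y : Ω × (ℝ × ℝ) =>
      s y.2 ^ count (pointMeasure X y.1 (B i)) := fun s i hs =>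
    (hs.comp measurable_snd).pow ((hm i).comp measurable_fst)
  rw [lintegral_lintegral_swap]
  · refine lintegral_congr_ae ?_
    filter_upwards [ae_unif_prod_mem] with z hz
    obtain ⟨hf0, hp0, hq0, hw0⟩ := h0 z hz.1 hz.2
    simp only [ENNReal.ofReal_mul hf0]
    rw [lintegral_const_mul' _ _ ENNReal.ofReal_ne_top,
      hX.lintegral_pow_count₃ hlam hB hd hBv hp0 hq0 hw0]
  · have h1 := hpow p 0 hp
    have h2 := hpow q 1 hq
    have h3 := hpow w 2 hw
    exact ((((hf.comp measurable_snd).mul ((h1.mul h2).mul h3))).ennreal_ofReal).aemeasurable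

variable {d : ℝ}

/-- Common form of the averages around a single point, retained in one slot or in two. The added
point cancels the subtraction of one, leaving the unconditioned count in the disc. -/
theorem IsPoissonProcess.lintegral_retain_of_count (hX : IsPoissonProcess lam X P)
    (hlam : 0 ≤ lam) (x : Plane) (a b : ℕ → ℕ) {w : ℝ × ℝ → ℝ} (hw : Measurable w)
    (h0 : ∀ z : ℝ × ℝ, z.1 ∈ Icc (0 : ℝ) 1 → z.2 ∈ Icc (0 : ℝ) 1 → 0 ≤ w z)
    (hab : ∀ n (z : ℝ × ℝ), (1 - z.1) ^ a n * (1 - z.2) ^ b n = w z ^ n) :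
    ∫⁻ ω, markProb (a (count ((pointMeasure X ω + Measure.dirac x) (Metric.closedBall x d)) - 1))
        (b (count ((pointMeasure X ω + Measure.dirac x) (Metric.closedBall x d)) - 1)) 0 ∂P
      = ∫⁻ z, ENNReal.ofReal (Real.exp (-(lam * ((volume (Metric.closedBall x d)).toReal
          * (1 - w z))))) ∂(unif.prod unif) := by
  -- For negative `d` the disc is empty and both sides equal 1.
  rcases lt_or_ge d 0 with hd | hd
  · simp only [Metric.closedBall_eq_empty.2 hd, measure_empty, count, ENNReal.toReal_zero,
      Nat.floor_zero, markProb, hab]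
    simp
  -- Two of the three cells are left empty, so that only the disc contributes.
  have hB : ∀ i : Fin 3, MeasurableSet
      ((![∅, ∅, Metric.closedBall x d] : Fin 3 → Set Plane) i) := by
    intro i; fin_cases i
    · exact MeasurableSet.empty
    · exact MeasurableSet.empty
    · exact measurableSet_closedBall
  have h := hX.lintegral_lintegral_pow_count hlam hB
    (fun i j hij => by fin_cases i <;> fin_cases j <;> simp at hij ⊢)
    (fun i => by
      fin_cases i
      · simp
      · simp
      · exact measure_closedBall_lt_top.ne)
    (f := fun _ => 1) (p := fun _ => 1) (q := fun _ => 1) (w := w) measurable_const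
    measurable_const measurable_const hw
    (fun z hz hz' => ⟨zero_le_one, zero_le_one, zero_le_one, h0 z hz hz'⟩)
  simp only [one_pow, one_mul, sub_self, mul_zero, zero_add] at h
  refine Eq.trans (lintegral_congr_ae ?_) h
  filter_upwards [hX.ae_locallyFinite] with ω hω
  obtain ⟨k, hk⟩ := exists_nat_pointMeasure (X := X) (ω := ω) (B := Metric.closedBall x d)
    measurableSet_closedBall (lt_top_of_locallyFinite hω Metric.isBounded_closedBall)
  have hc : count ((pointMeasure X ω + Measure.dirac x) (Metric.closedBall x d)) - 1 = k := by
    rw [Measure.add_apply, hk, Measure.dirac_apply' _ measurableSet_closedBall,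
      indicator_of_mem (Metric.mem_closedBall_self hd)]
    have : (k : ENNReal) + (1 : Plane → ENNReal) x = ((k + 1 : ℕ) : ENNReal) := by simp
    rw [this, count_natCast, Nat.add_sub_cancel]
  have hk' : pointMeasure X ω ((![∅, ∅, Metric.closedBall x d] : Fin 3 → Set Plane) 2) = k := hk
  rw [hc, hk', count_natCast, markProb]
  simp only [hab, pow_zero, mul_one]

theorem IsPoissonProcess.lintegral_retainProb (hX : IsPoissonProcess lam X P)
    (hlam : 0 ≤ lam) (x : Plane) :
    ∫⁻ ω, retainProb d x (pointMeasure X ω + Measure.dirac x) ∂P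
      = ∫⁻ z, ENNReal.ofReal (Real.exp (-(lam * ((volume (Metric.closedBall x d)).toReal
          * z.1)))) ∂(unif.prod unif) := by
  have h := hX.lintegral_retain_of_count (d := d) hlam x (fun n => n) (fun _ => 0)
    (w := fun z => 1 - z.1) (by fun_prop) (fun z hz _ => sub_nonneg.2 hz.2) (by simp)
  simp only [sub_sub_cancel] at h
  exact h

theorem IsPoissonProcess.lintegral_retainProbTwoSlots_self (hX : IsPoissonProcess lam X P)
    (hlam : 0 ≤ lam) (x : Plane) :
    ∫⁻ ω, retainProbTwoSlots d x x (pointMeasure X ω + Measure.dirac x) ∂P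
      = ∫⁻ z, ENNReal.ofReal (Real.exp (-(lam * ((volume (Metric.closedBall x d)).toReal
          * (1 - (1 - z.1) * (1 - z.2)))))) ∂(unif.prod unif) :=
  hX.lintegral_retain_of_count (d := d) hlam x (fun n => n) (fun n => n)
    (w := fun z => (1 - z.1) * (1 - z.2)) (by fun_prop)
    (fun z hz hz' => mul_nonneg (sub_nonneg.2 hz.2) (sub_nonneg.2 hz'.2))
    (fun n z => (mul_pow _ _ n).symm)

theorem volume_closedBall_inter_le (x y : Plane) (d : ℝ) :
    volume (Metric.closedBall x d ∩ Metric.closedBall y d) ≠ ⊤ :=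
  ne_top_of_le_ne_top measure_closedBall_lt_top.ne (measure_mono inter_subset_left)

theorem toReal_volume_closedBall_diff (x y : Plane) (d : ℝ) :
    (volume (Metric.closedBall x d \ Metric.closedBall y d)).toReal
      = (volume (Metric.closedBall x d)).toReal
        - (volume (Metric.closedBall x d ∩ Metric.closedBall y d)).toReal := by
  have h := measure_sdiff_add_inter (μ := (volume : Measure Plane)) (Metric.closedBall x d)
    (measurableSet_closedBall (x := y) (ε := d))
  have h1 : volume (Metric.closedBall x d \ Metric.closedBall y d) ≠ ⊤ :=
    ne_top_of_le_ne_top measure_closedBall_lt_top.ne (measure_mono sdiff_subset)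
  rw [← h, ENNReal.toReal_add h1 (volume_closedBall_inter_le x y d)]
  ring

/-- The parts of a union of two discs. -/
def discParts (d : ℝ) (x y : Plane) : Fin 3 → Set Plane :=
  ![Metric.closedBall x d \ Metric.closedBall y d, Metric.closedBall y d \ Metric.closedBall x d,
    Metric.closedBall x d ∩ Metric.closedBall y d]

theorem measurableSet_discParts (x y : Plane) (i : Fin 3) : MeasurableSet (discParts d x y i) := by
  fin_cases i
  · exact measurableSet_closedBall.diff measurableSet_closedBall
  · exact measurableSet_closedBall.diff measurableSet_closedBall
  · exact measurableSet_closedBall.inter measurableSet_closedBall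

theorem isBounded_discParts (x y : Plane) (i : Fin 3) :
    Bornology.IsBounded (discParts d x y i) := by
  fin_cases i
  · exact Metric.isBounded_closedBall.subset sdiff_subset
  · exact Metric.isBounded_closedBall.subset sdiff_subset
  · exact Metric.isBounded_closedBall.subset inter_subset_left

theorem pairwise_disjoint_discParts (x y : Plane) :
    Pairwise fun i j => Disjoint (discParts d x y i) (discParts d x y j) := by
  have h01 : Disjoint (discParts d x y 0) (discParts d x y 1) :=
    Set.disjoint_left.2 fun a h h' => h.2 h'.1
  have h02 : Disjoint (discParts d x y 0) (discParts d x y 2) :=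
    Set.disjoint_left.2 fun a h h' => h.2 h'.2
  have h12 : Disjoint (discParts d x y 1) (discParts d x y 2) :=
    Set.disjoint_left.2 fun a h h' => h.2 h'.1
  intro i j hij
  fin_cases i <;> fin_cases j <;> first | exact absurd rfl hij | skip
  exacts [h01, h02, h01.symm, h12, h02.symm, h12.symm]

/-- The averaged probability of two points at `x` and `y` surviving, for a joint survival
probability `f z * p z ^ a * q z ^ b * w z ^ c` given the numbers of further points in the parts
of the union of the discs around them. -/
theorem IsPoissonProcess.lintegral_discParts (hX : IsPoissonProcess lam X P)
    (hlam : 0 ≤ lam) (x y : Plane) {f w : ℝ × ℝ → ℝ} (hf : Measurable f)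
    (hw : Measurable w)
    (h0 : ∀ z : ℝ × ℝ, z.1 ∈ Icc (0 : ℝ) 1 → z.2 ∈ Icc (0 : ℝ) 1 → 0 ≤ f z ∧ 0 ≤ w z)
    {K : Measure Plane → ENNReal}
    (hK : ∀ (φ : Measure Plane) (a b c : ℕ), φ (discParts d x y 0) = a → φ (discParts d x y 1) = b →
      φ (discParts d x y 2) = c → K (φ + Measure.dirac x + Measure.dirac y)
        = ∫⁻ z, ENNReal.ofReal (f z * ((1 - z.1) ^ a * (1 - z.2) ^ b * w z ^ c))
          ∂(unif.prod unif)) :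
    ∫⁻ ω, K (pointMeasure X ω + Measure.dirac x + Measure.dirac y) ∂P
      = ∫⁻ z, ENNReal.ofReal (f z * Real.exp (-(lam *
          (((volume (Metric.closedBall x d)).toReal
            - (volume (Metric.closedBall x d ∩ Metric.closedBall y d)).toReal) * z.1
          + ((volume (Metric.closedBall y d)).toReal
            - (volume (Metric.closedBall x d ∩ Metric.closedBall y d)).toReal) * z.2
          + (volume (Metric.closedBall x d ∩ Metric.closedBall y d)).toReal * (1 - w z)))))
        ∂(unif.prod unif) := by
  have h := hX.lintegral_lintegral_pow_count hlam (measurableSet_discParts (d := d) x y)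
    (pairwise_disjoint_discParts x y) (fun i => (isBounded_discParts x y i).measure_lt_top.ne)
    (p := fun z => 1 - z.1) (q := fun z => 1 - z.2) hf (by fun_prop) (by fun_prop) hw
    (fun z hz hz' => ⟨(h0 z hz hz').1, sub_nonneg.2 hz.2, sub_nonneg.2 hz'.2, (h0 z hz hz').2⟩)
  have v0 : (volume (discParts d x y 0)).toReal = (volume (Metric.closedBall x d)).toReal
      - (volume (Metric.closedBall x d ∩ Metric.closedBall y d)).toReal :=
    toReal_volume_closedBall_diff x y d
  have v1 : (volume (discParts d x y 1)).toReal = (volume (Metric.closedBall y d)).toReal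
      - (volume (Metric.closedBall x d ∩ Metric.closedBall y d)).toReal := by
    rw [inter_comm]
    exact toReal_volume_closedBall_diff y x d
  have v2 : (volume (discParts d x y 2)).toReal
      = (volume (Metric.closedBall x d ∩ Metric.closedBall y d)).toReal := rfl
  simp only [v0, v1, v2, sub_sub_cancel] at h
  rw [← h]
  refine lintegral_congr_ae ?_
  filter_upwards [hX.ae_locallyFinite] with ω hω
  have hn : ∀ i, ∃ k : ℕ, pointMeasure X ω (discParts d x y i) = k := fun i =>
    exists_nat_pointMeasure (measurableSet_discParts x y i)
      (lt_top_of_locallyFinite hω (isBounded_discParts x y i))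
  obtain ⟨a, ha⟩ := hn 0
  obtain ⟨b, hb⟩ := hn 1
  obtain ⟨c, hc⟩ := hn 2
  rw [hK _ a b c ha hb hc, ha, hb, hc]
  simp only [count_natCast]

/-- A point in the lens must exceed u in the first slot and v in the second, which has probability
(1-u)(1-v). If the two centres are within distance `d`, each also competes with the other in the
slot where the other is to be retained; this is the extra factor with exponent `i`. -/
theorem IsPoissonProcess.lintegral_retainProbTwoSlots (hX : IsPoissonProcess lam X P)
    (hlam : 0 ≤ lam) (hd : 0 ≤ d) (x y : Plane) {i : ℕ} (hi : i = if dist x y ≤ d then 1 else 0) :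
    ∫⁻ ω, retainProbTwoSlots d x y (pointMeasure X ω + Measure.dirac x + Measure.dirac y) ∂P
      = ∫⁻ z, ENNReal.ofReal (((1 - z.1) * (1 - z.2)) ^ i * Real.exp (-(lam *
          (((volume (Metric.closedBall x d)).toReal
            - (volume (Metric.closedBall x d ∩ Metric.closedBall y d)).toReal) * z.1
          + ((volume (Metric.closedBall y d)).toReal
            - (volume (Metric.closedBall x d ∩ Metric.closedBall y d)).toReal) * z.2
          + (volume (Metric.closedBall x d ∩ Metric.closedBall y d)).toReal
            * (1 - (1 - z.1) * (1 - z.2))))))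
        ∂(unif.prod unif) := by
  refine hX.lintegral_discParts hlam x y (by fun_prop) (by fun_prop) (fun z hz hz' => ?_)
    fun φ a b c ha hb hc => ?_
  · have := mul_nonneg (sub_nonneg.2 hz.2) (sub_nonneg.2 hz'.2)
    exact ⟨pow_nonneg this _, this⟩
  have hx : φ (Metric.closedBall x d) = (a + c : ℕ) := by
    rw [← measure_sdiff_add_inter _ (measurableSet_closedBall (x := y) (ε := d)), Nat.cast_add,
      ← ha, ← hc]
    rfl
  have hy : φ (Metric.closedBall y d) = (b + c : ℕ) := by
    rw [← measure_sdiff_add_inter _ (measurableSet_closedBall (x := x) (ε := d)), Nat.cast_add,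
      ← hb, ← hc, inter_comm]
    rfl
  have d1 : Measure.dirac x (Metric.closedBall x d) = (1 : ℕ) := by simp [hd]
  have d2 : Measure.dirac y (Metric.closedBall y d) = (1 : ℕ) := by simp [hd]
  have d3 : Measure.dirac y (Metric.closedBall x d) = (i : ℕ) := by
    rw [Measure.dirac_apply' _ measurableSet_closedBall, indicator, hi]
    simp [dist_comm]
  have d4 : Measure.dirac x (Metric.closedBall y d) = (i : ℕ) := by
    rw [Measure.dirac_apply' _ measurableSet_closedBall, indicator, hi]
    simp
  simp only [retainProbTwoSlots, Measure.add_apply, hx, hy, d1, d2, d3, d4, ← Nat.cast_add,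
    count_natCast, markProb]
  refine lintegral_congr fun z => ?_
  rw [show a + c + 1 + i - 1 = a + c + i by omega, show b + c + i + 1 - 1 = b + c + i by omega]
  congr 1
  rw [mul_pow, mul_pow, pow_add, pow_add, pow_add, pow_add]
  ring

/-- In a common slot a point of the lens has a single mark exceeding both u and v, hence weight 1 -
max(u,v). Each added centre lies only in its own crescent and cancels the subtraction of one there.
-/
theorem IsPoissonProcess.lintegral_retainProbPair (hX : IsPoissonProcess lam X P)
    (hlam : 0 ≤ lam) (hd : 0 ≤ d) {x y : Plane} (hxy : d < dist x y) :
    ∫⁻ ω, retainProbPair d x y (pointMeasure X ω + Measure.dirac x + Measure.dirac y) ∂P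
      = ∫⁻ z, ENNReal.ofReal (Real.exp (-(lam *
          (((volume (Metric.closedBall x d)).toReal
            - (volume (Metric.closedBall x d ∩ Metric.closedBall y d)).toReal) * z.1
          + ((volume (Metric.closedBall y d)).toReal
            - (volume (Metric.closedBall x d ∩ Metric.closedBall y d)).toReal) * z.2
          + (volume (Metric.closedBall x d ∩ Metric.closedBall y d)).toReal * max z.1 z.2))))
        ∂(unif.prod unif) := by
  have h := hX.lintegral_discParts (d := d) hlam x y (f := fun _ => 1)
    (w := fun z => 1 - max z.1 z.2) (K := retainProbPair d x y) (by fun_prop) (by fun_prop)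
    (fun z hz hz' => ⟨zero_le_one, sub_nonneg.2 (max_le hz.2 hz'.2)⟩) fun φ a b c ha hb hc => ?_
  · simpa only [one_mul, sub_sub_cancel] using h
  have hyx : d < dist y x := by rwa [dist_comm]
  have d1 : Measure.dirac x (discParts d x y 0) = (1 : ℕ) := by
    rw [Measure.dirac_apply' _ (measurableSet_discParts x y 0)]
    simp [discParts, indicator, hd, hxy]
  have d2 : Measure.dirac x (discParts d x y 1) = (0 : ℕ) := by
    rw [Measure.dirac_apply' _ (measurableSet_discParts x y 1)]
    simp [discParts, indicator, hd]
  have d3 : Measure.dirac x (discParts d x y 2) = (0 : ℕ) := by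
    rw [Measure.dirac_apply' _ (measurableSet_discParts x y 2)]
    simp [discParts, indicator, hxy]
  have e1 : Measure.dirac y (discParts d x y 0) = (0 : ℕ) := by
    rw [Measure.dirac_apply' _ (measurableSet_discParts x y 0)]
    simp [discParts, indicator, hd]
  have e2 : Measure.dirac y (discParts d x y 1) = (1 : ℕ) := by
    rw [Measure.dirac_apply' _ (measurableSet_discParts x y 1)]
    simp [discParts, indicator, hd, hyx]
  have e3 : Measure.dirac y (discParts d x y 2) = (0 : ℕ) := by
    rw [Measure.dirac_apply' _ (measurableSet_discParts x y 2)]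
    simp [discParts, indicator, hyx]
  rw [retainProbPair, if_neg hxy.not_ge]
  change markProb (count ((φ + Measure.dirac x + Measure.dirac y) (discParts d x y 0)) - 1)
    (count ((φ + Measure.dirac x + Measure.dirac y) (discParts d x y 1)) - 1)
    (count ((φ + Measure.dirac x + Measure.dirac y) (discParts d x y 2))) = _
  simp only [Measure.add_apply, d1, d2, d3, e1, e2, e3, ha, hb, hc, ← Nat.cast_add,
    count_natCast, markProb, add_zero, Nat.add_sub_cancel, one_mul]

end Average

/-! ### Calculus of the exponential integral -/

/-- Continuous extension of difference quotients; it removes the singularity at 0 of the integrands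
f(t)/t with f(0) = 0. -/
theorem continuous_dslope_of_differentiable {f : ℝ → ℝ} (hf : Differentiable ℝ f) (a : ℝ) :
    Continuous (dslope f a) := by
  rw [continuous_iff_continuousAt]
  intro t
  by_cases ht : t = a
  · subst ht
    rw [continuousAt_dslope_same]
    exact hf t
  · rw [continuousAt_dslope_of_ne ht]
    exact hf.continuous.continuousAt

theorem intervalIntegrable_div_of_differentiable {f : ℝ → ℝ} (hf : Differentiable ℝ f)
    (h0 : f 0 = 0) (a b : ℝ) : IntervalIntegrable (fun t => f t / t) volume a b := by
  refine ((continuous_dslope_of_differentiable hf 0).intervalIntegrable a b).congr_ae ?_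
  refine ae_restrict_of_ae ?_
  filter_upwards [compl_mem_ae_iff.2 (measure_singleton (μ := (volume : Measure ℝ)) 0)] with t ht
  have ht' : t ≠ 0 := ht
  rw [dslope_of_ne _ ht', slope_def_field, h0, sub_zero, sub_zero]

theorem hasDerivAt_integral_div {f : ℝ → ℝ} (hf : Differentiable ℝ f) (h0 : f 0 = 0) {x : ℝ}
    (hx : 0 < x) : HasDerivAt (fun x => ∫ t in (0 : ℝ)..x, f t / t) (f x / x) x := by
  have hc : ContinuousOn (fun t => f t / t) (Ioi 0) :=
    hf.continuous.continuousOn.div continuousOn_id fun t ht => (ne_of_gt ht)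
  exact intervalIntegral.integral_hasDerivAt_right
    (intervalIntegrable_div_of_differentiable hf h0 0 x)
    (hc.stronglyMeasurableAtFilter isOpen_Ioi x hx) (hc.continuousAt (Ioi_mem_nhds hx))

theorem integrableOn_exp_div_Iic {y : ℝ} (hy : 0 < y) :
    IntegrableOn (fun t : ℝ => Real.exp t / t) (Iic (-y)) := by
  have he : IntegrableOn (fun t : ℝ => Real.exp t) (Iic (-y)) := integrableOn_exp_Iic _
  refine (he.const_mul (1 / y)).mono' ?_ ?_
  · exact (Real.measurable_exp.div measurable_id).aestronglyMeasurable
  · refine (ae_restrict_iff' measurableSet_Iic).2 (Eventually.of_forall fun t ht => ?_)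
    have ht' : t ≤ -y := ht
    rw [Real.norm_eq_abs, abs_div, Real.abs_exp, abs_of_neg (by linarith), one_div,
      div_eq_inv_mul]
    gcongr
    linarith

/-- The tail contributes e^(-x)/x through its moving endpoint and the folded part (e^x - e^(-x))/x;
the terms in e^(-x) cancel. -/
theorem hasDerivAt_expIntegralEi {x : ℝ} (hx : 0 < x) :
    HasDerivAt expIntegralEi (Real.exp x / x) x := by
  have h1 : HasDerivAt (fun x : ℝ => ∫ t in Iic (-x), Real.exp t / t) (Real.exp (-x) / x) x := by
    have h2 : HasDerivAt (fun y : ℝ => ∫ t in (-x)..y, Real.exp t / t) (Real.exp (-x) / (-x)) (-x) := by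
      have hc : ContinuousOn (fun t => Real.exp t / t) (Iio 0) :=
        Real.continuous_exp.continuousOn.div continuousOn_id fun t ht => ne_of_lt ht
      exact intervalIntegral.integral_hasDerivAt_right (by simp)
        (hc.stronglyMeasurableAtFilter isOpen_Iio _ (by simpa using hx))
        (hc.continuousAt (Iio_mem_nhds (by simpa using hx)))
    have h3 := (h2.comp x (hasDerivAt_neg x)).const_add (∫ t in Iic (-x), Real.exp t / t)
    rw [show Real.exp (-x) / (-x) * -1 = Real.exp (-x) / x by rw [div_neg]; ring] at h3
    refine h3.congr_of_eventuallyEq ?_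
    filter_upwards [Ioi_mem_nhds hx] with y hy
    have := intervalIntegral.integral_Iic_sub_Iic (integrableOn_exp_div_Iic hx)
      (integrableOn_exp_div_Iic hy)
    simp only [Function.comp]
    rw [← this]; ring
  have h2 := hasDerivAt_integral_div (f := fun t => Real.exp t - Real.exp (-t)) (by fun_prop)
    (by simp) hx
  have h3 := h1.add h2
  rw [show Real.exp (-x) / x + (Real.exp x - Real.exp (-x)) / x = Real.exp x / x by ring] at h3
  exact h3

theorem abs_log_le_self {t : ℝ} (ht : 1 < t) : |Real.log t| ≤ t := by
  rw [abs_of_pos (Real.log_pos ht)]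
  exact (Real.log_le_sub_one_of_pos (by linarith)).trans (by linarith)

theorem integrableOn_log_mul_exp_neg_Ioi_one :
    IntegrableOn (fun t : ℝ => Real.log t * Real.exp (-t)) (Ioi 1) := by
  have h := (Real.GammaIntegral_convergent (s := 2) (by norm_num)).mono_set
    (Ioi_subset_Ioi (zero_le_one (α := ℝ)))
  refine h.mono' (by fun_prop) ?_
  refine (ae_restrict_iff' measurableSet_Ioi).2 (Eventually.of_forall fun t ht => ?_)
  have ht' : 1 < t := ht
  rw [norm_mul, Real.norm_eq_abs, Real.norm_eq_abs, Real.abs_exp, mul_comm,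
    show (2 : ℝ) - 1 = 1 by norm_num, Real.rpow_one]
  gcongr
  exact abs_log_le_self ht'

theorem intervalIntegrable_log_mul_exp_neg :
    IntervalIntegrable (fun t : ℝ => Real.log t * Real.exp (-t)) volume 0 1 :=
  intervalIntegral.intervalIntegrable_log'.mul_continuousOn (by fun_prop)

/-- Both sides are Γ'(1): the left by differentiating Euler's integral under the integral sign, the
right by the known derivative of the Gamma function. -/
theorem integral_log_mul_exp_neg :
    ∫ t in Ioi (0 : ℝ), Real.log t * Real.exp (-t) = -Real.eulerMascheroniConstant := by
  have h1 := Complex.hasDerivAt_GammaIntegral (s := 1) (by simp)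
  have h2 : HasDerivAt Complex.Gamma (∫ t : ℝ in Ioi 0, (t : ℂ) ^ ((1 : ℂ) - 1) *
      (Real.log t * Real.exp (-t))) ((1 : ℝ) : ℂ) := by
    rw [Complex.ofReal_one]
    refine h1.congr_of_eventuallyEq ?_
    have : {s : ℂ | 0 < s.re} ∈ 𝓝 (1 : ℂ) :=
      (isOpen_lt continuous_const Complex.continuous_re).mem_nhds (by simp)
    filter_upwards [this] with s hs
    exact Complex.Gamma_eq_integral hs
  have h3 := h2.real_of_complex
  have h4 : (fun x : ℝ => (Complex.Gamma x).re) = Real.Gamma := rfl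
  rw [h4] at h3
  rw [Real.eulerMascheroniConstant_eq_neg_deriv, h3.deriv, neg_neg]
  have h5 : (∫ t : ℝ in Ioi 0, (t : ℂ) ^ ((1 : ℂ) - 1) * (Real.log t * Real.exp (-t)))
      = ((∫ t in Ioi (0 : ℝ), Real.log t * Real.exp (-t) : ℝ) : ℂ) := by
    rw [← integral_complex_ofReal]
    refine integral_congr_ae (Eventually.of_forall fun t => ?_)
    simp
  rw [h5, Complex.ofReal_re]

/-- Integration by parts in the integral of log t · e^(-t), split at 1. The primitive of e^(-t) is
taken as 1 - e^(-t) on the unit interval and as -e^(-t) beyond, so that all boundary terms vanish.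
-/
theorem eulerMascheroniConstant_eq_integral :
    Real.eulerMascheroniConstant = (∫ t in (0 : ℝ)..1, (1 - Real.exp (-t)) / t)
      + ∫ t in Iic (-1 : ℝ), Real.exp t / t := by
  have hsplit : ∫ t in Ioi (0 : ℝ), Real.log t * Real.exp (-t)
      = (∫ t in (0 : ℝ)..1, Real.log t * Real.exp (-t))
        + ∫ t in Ioi (1 : ℝ), Real.log t * Real.exp (-t) := by
    rw [intervalIntegral.integral_of_le zero_le_one, ← setIntegral_union
      Ioc_disjoint_Ioi_same measurableSet_Ioi
      ((intervalIntegrable_iff_integrableOn_Ioc_of_le zero_le_one).1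
        intervalIntegrable_log_mul_exp_neg) integrableOn_log_mul_exp_neg_Ioi_one,
      Ioc_union_Ioi_eq_Ioi zero_le_one]
  -- integration by parts on the unit interval
  have hdiff : Differentiable ℝ fun t : ℝ => 1 - Real.exp (-t) := by fun_prop
  have hI1 := intervalIntegrable_div_of_differentiable hdiff (by simp) 0 1
  have hpart1 : ∫ t in (0 : ℝ)..1, (Real.log t * Real.exp (-t) + (1 - Real.exp (-t)) / t) = 0 := by
    -- Continuity at 0 follows from writing the boundary term as ((1 - e^(-t))/t) · (t log t), both
    -- factors extending continuously.
    have hcont : Continuous fun t : ℝ => (1 - Real.exp (-t)) * Real.log t := by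
      have : (fun t : ℝ => (1 - Real.exp (-t)) * Real.log t)
          = fun t => dslope (fun t : ℝ => 1 - Real.exp (-t)) 0 t * (t * Real.log t) := by
        ext t
        rcases eq_or_ne t 0 with rfl | ht
        · simp
        · rw [dslope_of_ne _ ht, slope_def_field]
          simp only [neg_zero, Real.exp_zero, sub_self, sub_zero]
          field_simp
      rw [this]
      exact (continuous_dslope_of_differentiable hdiff 0).mul Real.continuous_mul_log
    rw [intervalIntegral.integral_eq_sub_of_hasDerivAt_of_le zero_le_one hcont.continuousOn
      (fun t ht => ?_) (intervalIntegrable_log_mul_exp_neg.add hI1)]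
    · simp
    · have h1 : HasDerivAt (fun t : ℝ => 1 - Real.exp (-t)) (Real.exp (-t)) t := by
        simpa using ((hasDerivAt_neg t).exp).const_sub 1
      exact (h1.mul (Real.hasDerivAt_log ht.1.ne')).congr_deriv (by rw [div_eq_mul_inv]; ring)
  rw [intervalIntegral.integral_add intervalIntegrable_log_mul_exp_neg hI1] at hpart1
  -- integration by parts on the half line
  have hE : IntegrableOn (fun t : ℝ => Real.exp (-t) / t) (Ioi 1) := by
    have h := (exp_neg_integrableOn_Ioi 1 one_pos)
    simp only [neg_mul, one_mul] at h
    refine h.mono' (Measurable.aestronglyMeasurable (by fun_prop)) ?_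
    refine (ae_restrict_iff' measurableSet_Ioi).2 (Eventually.of_forall fun t ht => ?_)
    have ht' : 1 < t := ht
    rw [norm_div, Real.norm_eq_abs, Real.norm_eq_abs, Real.abs_exp, abs_of_pos (by linarith)]
    exact div_le_self (Real.exp_pos _).le ht'.le
  have hpart2 : ∫ t in Ioi (1 : ℝ), (Real.log t * Real.exp (-t) - Real.exp (-t) / t) = 0 := by
    have hlim : Tendsto (fun t : ℝ => -(Real.log t * Real.exp (-t))) atTop (𝓝 0) := by
      have h1 : Tendsto (fun t : ℝ => t * Real.exp (-t)) atTop (𝓝 0) := by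
        simpa using Real.tendsto_pow_mul_exp_neg_atTop_nhds_zero 1
      refine squeeze_zero_norm' ?_ h1
      filter_upwards [eventually_gt_atTop 1] with t ht
      rw [norm_neg, norm_mul, Real.norm_eq_abs, Real.norm_eq_abs, Real.abs_exp]
      gcongr
      exact abs_log_le_self ht
    rw [integral_Ioi_of_hasDerivAt_of_tendsto (a := 1) (m := 0)
      (f := fun t => -(Real.log t * Real.exp (-t)))
      (f' := fun t => Real.log t * Real.exp (-t) - Real.exp (-t) / t) ?_ (fun t ht => ?_)
      (integrableOn_log_mul_exp_neg_Ioi_one.sub hE) hlim]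
    · simp
    · refine ContinuousAt.continuousWithinAt ?_
      have := Real.continuousAt_log one_ne_zero
      fun_prop
    · have ht' : (1 : ℝ) < t := ht
      exact (((Real.hasDerivAt_log (by linarith : t ≠ 0)).mul
        ((hasDerivAt_neg t).exp)).neg).congr_deriv (by rw [div_eq_mul_inv]; ring)
  rw [integral_sub integrableOn_log_mul_exp_neg_Ioi_one hE] at hpart2
  have hE1 : ∫ t in Iic (-1 : ℝ), Real.exp t / t = -∫ t in Ioi (1 : ℝ), Real.exp (-t) / t := by
    rw [← integral_comp_neg_Ioi, ← integral_neg]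
    refine setIntegral_congr_fun measurableSet_Ioi fun t _ => ?_
    simp [div_neg]
  have := integral_log_mul_exp_neg
  rw [hE1]
  linarith

/-- Both sides have derivative (e^x - 1)/x on the half line; the constant is fixed at x = 1 by the
integral formula for Euler's constant. -/
theorem expIntegralEi_sub_log_sub_eulerMascheroniConstant {x : ℝ} (hx : 0 < x) :
    expIntegralEi x - Real.log x - Real.eulerMascheroniConstant
      = ∫ t in (0 : ℝ)..x, (Real.exp t - 1) / t := by
  let D : ℝ → ℝ := fun x => expIntegralEi x - Real.log x - ∫ t in (0 : ℝ)..x, (Real.exp t - 1) / t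
  have hD : ∀ x ∈ Ioi (0 : ℝ), HasDerivAt D 0 x := by
    intro x hx
    have h := ((hasDerivAt_expIntegralEi hx).sub (Real.hasDerivAt_log (ne_of_gt hx))).sub
      (hasDerivAt_integral_div (f := fun t => Real.exp t - 1) (by fun_prop) (by simp) hx)
    rw [show Real.exp x / x - x⁻¹ - (Real.exp x - 1) / x = 0 by
      rw [sub_div, one_div]; ring] at h
    exact h
  have hconst : D x = D 1 :=
    (convex_Ioi (0 : ℝ)).is_const_of_fderivWithin_eq_zero (𝕜 := ℝ)
      (fun x hx => (hD x hx).differentiableAt.differentiableWithinAt)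
      (fun x hx => by
        rw [fderivWithin_of_isOpen isOpen_Ioi hx]
        ext
        simpa using (hD x hx).deriv) hx (mem_Ioi.2 one_pos)
  have h1 : D 1 = Real.eulerMascheroniConstant := by
    simp only [D, expIntegralEi, Real.log_one, sub_zero]
    rw [eulerMascheroniConstant_eq_integral, add_sub_assoc, ← intervalIntegral.integral_sub
      (intervalIntegrable_div_of_differentiable (by fun_prop) (by simp) 0 1)
      (intervalIntegrable_div_of_differentiable (by fun_prop) (by simp) 0 1), add_comm]
    congr 1
    refine intervalIntegral.integral_congr fun t _ => ?_
    rw [← sub_div]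
    ring
  rw [h1] at hconst
  simp only [D] at hconst
  linarith

/-! ### Closed forms of the retainment probabilities -/

theorem integral_exp_neg_mul {k : ℝ} (hk : k ≠ 0) :
    ∫ u in (0 : ℝ)..1, Real.exp (-(k * u)) = (1 - Real.exp (-k)) / k := by
  have h : ∀ u ∈ uIcc (0 : ℝ) 1,
      HasDerivAt (fun u => -(Real.exp (-(k * u)) / k)) (Real.exp (-(k * u))) u := by
    intro u _
    have h1 : HasDerivAt (fun u => -(k * u)) (-k) u :=
      (((hasDerivAt_id u).const_mul k).neg).congr_deriv (by simp)
    exact ((h1.exp.div_const k).neg).congr_deriv (by field_simp)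
  rw [intervalIntegral.integral_eq_sub_of_hasDerivAt h
    (Continuous.intervalIntegrable (by fun_prop) _ _)]
  simp only [mul_one, mul_zero, neg_zero, Real.exp_zero]
  ring

theorem retainOnce_eq_integral {lam c : ℝ} (h : lam * c ≠ 0) :
    ∫ u in (0 : ℝ)..1, Real.exp (-(lam * (c * u))) = (1 - Real.exp (-(lam * c))) / (lam * c) := by
  simp only [← mul_assoc]
  exact integral_exp_neg_mul h

theorem integral_comp_one_sub (f : ℝ → ℝ) :
    ∫ u in (0 : ℝ)..1, f (1 - u) = ∫ u in (0 : ℝ)..1, f u := by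
  simp [intervalIntegral.integral_comp_sub_left]

/-- Reflecting both variables turns the exponent into k(uv - 1). The inner integral is then
e^(-k)(e^(ku) - 1)/(ku), and the substitution t = ku leads to the integral of (e^t - 1)/t. -/
theorem integral_exp_retainTwice {k : ℝ} (hk : 0 < k) :
    ∫ u in (0 : ℝ)..1, ∫ v in (0 : ℝ)..1, Real.exp (-(k * (1 - (1 - u) * (1 - v))))
      = Real.exp (-k) * (expIntegralEi k - Real.log k - Real.eulerMascheroniConstant) / k := by
  have h1 : ∀ u : ℝ, ∫ v in (0 : ℝ)..1, Real.exp (-(k * (1 - (1 - u) * (1 - v))))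
      = ∫ v in (0 : ℝ)..1, Real.exp (-(k * (1 - (1 - u) * v))) := fun u =>
    integral_comp_one_sub fun v => Real.exp (-(k * (1 - (1 - u) * v)))
  simp only [h1]
  rw [integral_comp_one_sub fun u => ∫ v in (0 : ℝ)..1, Real.exp (-(k * (1 - u * v)))]
  have h2 : ∀ u : ℝ, u ≠ 0 → ∫ v in (0 : ℝ)..1, Real.exp (-(k * (1 - u * v)))
      = Real.exp (-k) * ((Real.exp (k * u) - 1) / (k * u)) := by
    intro u hu
    have h3 : ∀ v : ℝ, Real.exp (-(k * (1 - u * v))) = Real.exp (-k) * Real.exp (-(-(k * u) * v)) :=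
      fun v => by rw [← Real.exp_add]; congr 1; ring
    simp only [h3]
    rw [intervalIntegral.integral_const_mul, integral_exp_neg_mul (neg_ne_zero.2 (mul_ne_zero hk.ne' hu)),
      neg_neg]
    congr 1
    rw [div_neg, ← neg_div, neg_sub]
  have h4 : ∫ u in (0 : ℝ)..1, ∫ v in (0 : ℝ)..1, Real.exp (-(k * (1 - u * v)))
      = ∫ u in (0 : ℝ)..1, Real.exp (-k) * ((Real.exp (k * u) - 1) / (k * u)) := by
    refine intervalIntegral.integral_congr_ae ?_
    filter_upwards [compl_mem_ae_iff.2 (measure_singleton (μ := (volume : Measure ℝ)) 0)]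
      with u hu _
    exact h2 u hu
  rw [h4, intervalIntegral.integral_const_mul,
    intervalIntegral.integral_comp_mul_left (fun t => (Real.exp t - 1) / t) hk.ne', mul_zero,
    mul_one, ← expIntegralEi_sub_log_sub_eulerMascheroniConstant hk, smul_eq_mul]
  ring

theorem hasDerivAt_expIntegralEi_mul {k s : ℝ} (hk : 0 < k) (hs : 0 < s) :
    HasDerivAt (fun s => expIntegralEi (k * s)) (Real.exp (k * s) / s) s := by
  have h := (hasDerivAt_expIntegralEi (mul_pos hk hs)).comp s ((hasDerivAt_id s).const_mul k)
  exact h.congr_deriv (by field_simp)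

/-- The inner integral leaves terms e^(qs)/s, whose primitives are exponential integrals; the four
corners of the square give the three values, the mixed one twice. -/
theorem integral_exp_mul_mul {k a : ℝ} (hk : 0 < k) (ha : 0 < a) :
    ∫ s in a..(a + 1), ∫ t in a..(a + 1), Real.exp (k * s * t)
      = (expIntegralEi (k * (a + 1) * (a + 1)) + expIntegralEi (k * a * a)
          - 2 * expIntegralEi (k * a * (a + 1))) / k := by
  have hpos : ∀ s ∈ uIcc a (a + 1), 0 < s := fun s hs => by
    rw [uIcc_of_le (by linarith)] at hs
    exact ha.trans_le hs.1
  have h1 : ∀ s ∈ uIcc a (a + 1), ∫ t in a..(a + 1), Real.exp (k * s * t)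
      = (Real.exp (k * (a + 1) * s) / s - Real.exp (k * a * s) / s) / k := by
    intro s hs
    have hs0 := hpos s hs
    rw [intervalIntegral.integral_eq_sub_of_hasDerivAt
      (f := fun t => Real.exp (k * s * t) / (k * s)) (fun t _ => ?_)
      (Continuous.intervalIntegrable (by fun_prop) _ _)]
    · rw [mul_right_comm k s (a + 1), mul_right_comm k s a]
      field_simp
    · have h2 : HasDerivAt (fun t => k * s * t) (k * s) t := by
        simpa using (hasDerivAt_id t).const_mul (k * s)
      exact (h2.exp.div_const (k * s)).congr_deriv (by field_simp)
  rw [intervalIntegral.integral_congr h1, intervalIntegral.integral_eq_sub_of_hasDerivAt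
      (f := fun s => (expIntegralEi (k * (a + 1) * s) - expIntegralEi (k * a * s)) / k)
      (fun s hs => ?_) (ContinuousOn.intervalIntegrable ?_)]
  · rw [mul_right_comm k (a + 1) a]; ring
  · have : ∀ s ∈ uIcc a (a + 1), s ≠ 0 := fun s hs => (hpos s hs).ne'
    fun_prop (disch := assumption)
  · exact ((hasDerivAt_expIntegralEi_mul (by positivity) (hpos s hs)).sub
      (hasDerivAt_expIntegralEi_mul (by positivity) (hpos s hs))).div_const k

theorem integral_sub_mul_exp_mul_mul {k a : ℝ} (hk : 0 < k) (ha : 0 < a) :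
    ∫ s in a..(a + 1), ∫ t in a..(a + 1), (s - a) * (t - a) * Real.exp (k * s * t)
      = (Real.exp (k * (a + 1) * (a + 1)) - Real.exp (k * (a + 1) * a)) / (k ^ 2 * (a + 1))
        - a / k * (expIntegralEi (k * (a + 1) * (a + 1)) - expIntegralEi (k * (a + 1) * a))
        - (expIntegralEi (k * (a + 1) * (a + 1)) - 2 * expIntegralEi (k * (a + 1) * a)
          + expIntegralEi (k * a * a)) / k ^ 2
        + a / k ^ 2 * ((Real.exp (k * (a + 1) * a) - Real.exp (k * (a + 1) * (a + 1))) / (a + 1)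
          + (Real.exp (k * (a + 1) * a) - Real.exp (k * a * a)) / a
          + k * (a + 1) * (expIntegralEi (k * (a + 1) * (a + 1)) - expIntegralEi (k * (a + 1) * a))
          - k * a * (expIntegralEi (k * (a + 1) * a) - expIntegralEi (k * a * a))) := by
  have hpos : ∀ s ∈ uIcc a (a + 1), 0 < s := fun s hs => by
    rw [uIcc_of_le (by linarith)] at hs
    exact ha.trans_le hs.1
  have h1 : ∀ s ∈ uIcc a (a + 1), ∫ t in a..(a + 1), (s - a) * (t - a) * Real.exp (k * s * t)
      = (s - a) * (Real.exp (k * (a + 1) * s) / (k * s)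
        - (Real.exp (k * (a + 1) * s) - Real.exp (k * a * s)) / (k * s) ^ 2) := by
    intro s hs
    have hs0 := hpos s hs
    rw [intervalIntegral.integral_eq_sub_of_hasDerivAt
      (f := fun t => (s - a) * ((t - a) * Real.exp (k * s * t) / (k * s)
        - Real.exp (k * s * t) / (k * s) ^ 2)) (fun t _ => ?_)
      (Continuous.intervalIntegrable (by fun_prop) _ _)]
    · rw [mul_right_comm k s (a + 1), mul_right_comm k s a]
      field_simp
      ring
    · have h2 : HasDerivAt (fun t => k * s * t) (k * s) t := by
        simpa using (hasDerivAt_id t).const_mul (k * s)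
      refine (((((hasDerivAt_id t).sub_const a).mul h2.exp).div_const (k * s)).sub
        (h2.exp.div_const ((k * s) ^ 2))).const_mul (s - a) |>.congr_deriv ?_
      simp only [id]
      field_simp
      ring
  have hE : ∀ {q s : ℝ}, HasDerivAt (fun s => Real.exp (q * s)) (Real.exp (q * s) * q) s := by
    intro q s
    have h2 : HasDerivAt (fun t => q * t) q s := by
      simpa using (hasDerivAt_id s).const_mul q
    exact h2.exp
  -- With A = e^(k(a+1)s) and B = e^(kas) the integrand is A/k - aA/(ks) - (A-B)/(k²s) +
  -- a(A-B)/(k²s²). The primitive is taken term by term, the last one by parts.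
  rw [intervalIntegral.integral_congr h1, intervalIntegral.integral_eq_sub_of_hasDerivAt
      (f := fun s => Real.exp (k * (a + 1) * s) / (k ^ 2 * (a + 1))
        - a / k * expIntegralEi (k * (a + 1) * s)
        - (expIntegralEi (k * (a + 1) * s) - expIntegralEi (k * a * s)) / k ^ 2
        + a / k ^ 2 * (-(Real.exp (k * (a + 1) * s) / s) + Real.exp (k * a * s) / s
          + k * (a + 1) * expIntegralEi (k * (a + 1) * s) - k * a * expIntegralEi (k * a * s)))
      (fun s hs => ?_) (ContinuousOn.intervalIntegrable ?_)]
  · rw [mul_right_comm k a (a + 1)]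
    field_simp
    ring
  · have : ∀ s ∈ uIcc a (a + 1), k * s ≠ 0 := fun s hs => (mul_pos hk (hpos s hs)).ne'
    have : ∀ s ∈ uIcc a (a + 1), (k * s) ^ 2 ≠ 0 := fun s hs =>
      pow_ne_zero 2 (mul_pos hk (hpos s hs)).ne'
    fun_prop (disch := assumption)
  · have hs0 := hpos s hs
    have e1 := hasDerivAt_expIntegralEi_mul (k := k * (a + 1)) (by positivity) hs0
    have e2 := hasDerivAt_expIntegralEi_mul (k := k * a) (by positivity) hs0
    have x1 := (hE (q := k * (a + 1)) (s := s))
    have x2 := (hE (q := k * a) (s := s))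
    have hid := hasDerivAt_id s
    have := (((x1.div_const (k ^ 2 * (a + 1))).sub (e1.const_mul (a / k))).sub
      ((e1.sub e2).div_const (k ^ 2))).add
      (((((x1.div hid hs0.ne').neg.add (x2.div hid hs0.ne')).add
        (e1.const_mul (k * (a + 1)))).sub (e2.const_mul (k * a))).const_mul (a / k ^ 2))
    refine this.congr_deriv ?_
    simp only [id]
    field_simp
    ring

/-- Completing the product: with a = (c-g)/g, s = 1-u+a and t = 1-v+a, the exponent equals λgst -
λc²/g. The linear terms disappear, and the closeness factor becomes (s-a)(t-a). -/
theorem integral_exp_pair_shift {lam c g : ℝ} (hg : 0 < g) (i : ℕ) :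
    ∫ u in (0 : ℝ)..1, ∫ v in (0 : ℝ)..1, ((1 - u) * (1 - v)) ^ i * Real.exp (-(lam *
        ((c - g) * u + (c - g) * v + g * (1 - (1 - u) * (1 - v)))))
      = Real.exp (-(c ^ 2 * lam / g)) * ∫ s in ((c - g) / g)..((c - g) / g + 1),
        ∫ t in ((c - g) / g)..((c - g) / g + 1),
          ((s - (c - g) / g) * (t - (c - g) / g)) ^ i * Real.exp (lam * g * s * t) := by
  set a := (c - g) / g with ha
  have hc : c = (a + 1) * g := by rw [ha]; field_simp; ring
  have h1 : ∀ u v : ℝ, ((1 - u) * (1 - v)) ^ i * Real.exp (-(lam *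
        ((c - g) * u + (c - g) * v + g * (1 - (1 - u) * (1 - v)))))
      = Real.exp (-(c ^ 2 * lam / g)) * ((((1 - u) + a - a) * ((1 - v) + a - a)) ^ i *
        Real.exp (lam * g * ((1 - u) + a) * ((1 - v) + a))) := by
    intro u v
    rw [mul_left_comm, ← Real.exp_add, add_sub_cancel_right, add_sub_cancel_right, hc]
    congr 2
    field_simp
    ring
  simp only [h1, intervalIntegral.integral_const_mul]
  congr 1
  have h2 : ∀ u : ℝ, ∫ v in (0 : ℝ)..1, (((1 - u) + a - a) * ((1 - v) + a - a)) ^ i *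
        Real.exp (lam * g * ((1 - u) + a) * ((1 - v) + a))
      = ∫ t in a..(a + 1), (((1 - u) + a - a) * (t - a)) ^ i *
        Real.exp (lam * g * ((1 - u) + a) * t) := by
    intro u
    rw [integral_comp_one_sub fun v => (((1 - u) + a - a) * (v + a - a)) ^ i *
        Real.exp (lam * g * ((1 - u) + a) * (v + a)),
      intervalIntegral.integral_comp_add_right (fun t => (((1 - u) + a - a) * (t - a)) ^ i *
        Real.exp (lam * g * ((1 - u) + a) * t)), zero_add, add_comm 1 a]
  simp only [h2]
  rw [integral_comp_one_sub fun u => ∫ t in a..(a + 1), ((u + a - a) * (t - a)) ^ i *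
        Real.exp (lam * g * (u + a) * t),
    intervalIntegral.integral_comp_add_right (fun s => ∫ t in a..(a + 1),
      ((s - a) * (t - a)) ^ i * Real.exp (lam * g * s * t)), zero_add, add_comm 1 a]

theorem integral_exp_pair_far {lam c g : ℝ} (hlam : 0 < lam) (hg : 0 < g) (hgc : g < c) :
    ∫ u in (0 : ℝ)..1, ∫ v in (0 : ℝ)..1, Real.exp (-(lam *
        ((c - g) * u + (c - g) * v + g * (1 - (1 - u) * (1 - v)))))
      = Real.exp (-(c ^ 2 * lam / g)) *
        (expIntegralEi (c ^ 2 * lam / g) + expIntegralEi (lam * (g - c) ^ 2 / g)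
          - 2 * expIntegralEi (c * lam * (c / g - 1))) /
      (lam * g) := by
  have h := integral_exp_pair_shift (lam := lam) (c := c) hg 0
  simp only [pow_zero, one_mul] at h
  rw [h, integral_exp_mul_mul (by positivity) (div_pos (sub_pos.2 hgc) hg)]
  have e1 : lam * g * ((c - g) / g + 1) * ((c - g) / g + 1) = c ^ 2 * lam / g := by
    field_simp; ring
  have e2 : lam * g * ((c - g) / g) * ((c - g) / g) = lam * (g - c) ^ 2 / g := by
    field_simp; ring
  have e3 : lam * g * ((c - g) / g) * ((c - g) / g + 1) = c * lam * (c / g - 1) := by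
    field_simp; ring
  rw [e1, e2, e3]
  ring

theorem integral_exp_pair_near {lam c g : ℝ} (hlam : 0 < lam) (hg : 0 < g) (hgc : g < c) :
    ∫ u in (0 : ℝ)..1, ∫ v in (0 : ℝ)..1, ((1 - u) * (1 - v)) * Real.exp (-(lam *
        ((c - g) * u + (c - g) * v + g * (1 - (1 - u) * (1 - v)))))
      = Real.exp (-(c * lam * (2 + c / g))) / (c * lam ^ 2 * g ^ 3) *
      (c * Real.exp (2 * c * lam) * (g * (1 + 2 * c * lam - g * lam) - c ^ 2 * lam) *
          (2 * expIntegralEi (c * lam * (c / g - 1)) - expIntegralEi (c ^ 2 * lam / g)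
            - expIntegralEi (lam * (g - c) ^ 2 / g))
        - g * Real.exp (c ^ 2 * lam / g) *
          (Real.exp (lam * g) * c + Real.exp (2 * c * lam) * (c - 2 * g)
            - 2 * Real.exp (c * lam) * (c - g))) := by
  have h := integral_exp_pair_shift (lam := lam) (c := c) hg 1
  simp only [pow_one] at h
  rw [h, integral_sub_mul_exp_mul_mul (by positivity) (div_pos (sub_pos.2 hgc) hg)]
  have e1 : lam * g * ((c - g) / g + 1) * ((c - g) / g + 1) = c ^ 2 * lam / g := by
    field_simp; ring
  have e2 : lam * g * ((c - g) / g) * ((c - g) / g) = lam * (g - c) ^ 2 / g := by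
    field_simp; ring
  have e3 : lam * g * ((c - g) / g + 1) * ((c - g) / g) = c * lam * (c / g - 1) := by
    field_simp; ring
  have hc : 0 < c := hg.trans hgc
  have hcg : 0 < c - g := sub_pos.2 hgc
  have e4 : (c - g) / g + 1 = c / g := by field_simp; ring
  rw [e1, e2, e3, e4]
  -- All exponentials are reduced to e^(λc²/g), e^(λc) and e^(λg). Treated with the three values of
  -- Ei as independent unknowns, they leave a rational identity.
  have x1 : Real.exp (c * lam * (c / g - 1))
      = Real.exp (c ^ 2 * lam / g) * (Real.exp (c * lam))⁻¹ := by
    rw [← Real.exp_neg, ← Real.exp_add]; congr 1; field_simp; ring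
  have x2 : Real.exp (lam * (g - c) ^ 2 / g)
      = Real.exp (c ^ 2 * lam / g) * (Real.exp (c * lam))⁻¹ ^ 2 * Real.exp (lam * g) := by
    rw [← Real.exp_neg, ← Real.exp_nat_mul, ← Real.exp_add, ← Real.exp_add]; congr 1
    push_cast; field_simp; ring
  have x3 : Real.exp (-(c * lam * (2 + c / g)))
      = (Real.exp (c ^ 2 * lam / g))⁻¹ * (Real.exp (c * lam))⁻¹ ^ 2 := by
    rw [← Real.exp_neg, ← Real.exp_neg, ← Real.exp_nat_mul, ← Real.exp_add]; congr 1
    push_cast; field_simp; ring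
  have x4 : Real.exp (2 * c * lam) = Real.exp (c * lam) ^ 2 := by
    rw [← Real.exp_nat_mul]; congr 1; push_cast; ring
  rw [x1, x2, x3, x4, Real.exp_neg]
  have hA := (Real.exp_pos (c ^ 2 * lam / g)).ne'
  have hY := (Real.exp_pos (c * lam)).ne'
  generalize Real.exp (c ^ 2 * lam / g) = A at *
  generalize Real.exp (c * lam) = Y at *
  generalize Real.exp (lam * g) = Z at *
  generalize expIntegralEi (c ^ 2 * lam / g) = E1 at *
  generalize expIntegralEi (lam * (g - c) ^ 2 / g) = E2 at *
  generalize expIntegralEi (c * lam * (c / g - 1)) = E3 at *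
  clear h e1 e2 e3 e4 x1 x2 x3 x4
  field_simp
  ring

/-- Cutting the square along the diagonal makes the exponent linear on each half, so the result is
elementary and no exponential integral appears. -/
theorem integral_exp_pair_same {lam c g : ℝ} (hlam : 0 < lam) (hg : 0 ≤ g) (hgc : g < c) :
    ∫ u in (0 : ℝ)..1, ∫ v in (0 : ℝ)..1, Real.exp (-(lam *
        ((c - g) * u + (c - g) * v + g * max u v)))
      = 2 * (2 * c - g) * (1 - Real.exp (-(lam * c))) /
        (lam ^ 2 * c * (2 * c - g) * ((2 * c - g) - c))
      - 2 * (1 - Real.exp (-(lam * (2 * c - g)))) /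
        (lam ^ 2 * (2 * c - g) * ((2 * c - g) - c)) := by
  have hc : 0 < c := hg.trans_lt hgc
  have hcg : 0 < c - g := sub_pos.2 hgc
  have hΓ : 0 < 2 * c - g := by linarith
  have h1 : ∀ u ∈ uIcc (0 : ℝ) 1, ∫ v in (0 : ℝ)..1, Real.exp (-(lam *
        ((c - g) * u + (c - g) * v + g * max u v)))
      = (1 / (lam * (c - g))) * Real.exp (-(lam * c * u))
        - (1 / (lam * (c - g)) - 1 / (lam * c)) * Real.exp (-(lam * (2 * c - g) * u))
        - Real.exp (-(lam * c)) / (lam * c) * Real.exp (-(lam * (c - g) * u)) := by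
    intro u hu
    rw [uIcc_of_le zero_le_one] at hu
    have hcont : Continuous fun v : ℝ =>
      Real.exp (-(lam * ((c - g) * u + (c - g) * v + g * max u v))) := by fun_prop
    rw [← intervalIntegral.integral_add_adjacent_intervals (b := u)
      (hcont.intervalIntegrable _ _) (hcont.intervalIntegrable _ _)]
    have p1 : ∫ v in (0 : ℝ)..u, Real.exp (-(lam * ((c - g) * u + (c - g) * v + g * max u v)))
        = (Real.exp (-(lam * c * u)) - Real.exp (-(lam * (2 * c - g) * u))) / (lam * (c - g)) := by
      have : ∀ v ∈ uIcc 0 u, Real.exp (-(lam * ((c - g) * u + (c - g) * v + g * max u v)))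
          = Real.exp (-(lam * c * u) + -(lam * (c - g) * v)) := by
        intro v hv
        rw [uIcc_of_le hu.1] at hv
        rw [max_eq_left hv.2]
        congr 1; ring
      rw [intervalIntegral.integral_congr this, intervalIntegral.integral_eq_sub_of_hasDerivAt
        (f := fun v => -(Real.exp (-(lam * c * u) + -(lam * (c - g) * v)) / (lam * (c - g))))
        (fun v _ => ?_) (Continuous.intervalIntegrable (by fun_prop) _ _)]
      · rw [show -(lam * c * u) + -(lam * (c - g) * u) = -(lam * (2 * c - g) * u) by ring,
          mul_zero, neg_zero, add_zero]
        ring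
      · have h2 : HasDerivAt (fun v => -(lam * c * u) + -(lam * (c - g) * v)) (-(lam * (c - g))) v := by
          simpa using (((hasDerivAt_id v).const_mul (lam * (c - g))).neg).const_add (-(lam * c * u))
        exact ((h2.exp.div_const (lam * (c - g))).neg).congr_deriv (by field_simp)
    have p2 : ∫ v in u..(1 : ℝ), Real.exp (-(lam * ((c - g) * u + (c - g) * v + g * max u v)))
        = (Real.exp (-(lam * (2 * c - g) * u))
          - Real.exp (-(lam * c)) * Real.exp (-(lam * (c - g) * u))) / (lam * c) := by
      have : ∀ v ∈ uIcc u 1, Real.exp (-(lam * ((c - g) * u + (c - g) * v + g * max u v)))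
          = Real.exp (-(lam * (c - g) * u) + -(lam * c * v)) := by
        intro v hv
        rw [uIcc_of_le hu.2] at hv
        rw [max_eq_right hv.1]
        congr 1; ring
      rw [intervalIntegral.integral_congr this, intervalIntegral.integral_eq_sub_of_hasDerivAt
        (f := fun v => -(Real.exp (-(lam * (c - g) * u) + -(lam * c * v)) / (lam * c)))
        (fun v _ => ?_) (Continuous.intervalIntegrable (by fun_prop) _ _)]
      · rw [show -(lam * (c - g) * u) + -(lam * c * u) = -(lam * (2 * c - g) * u) by ring,
          mul_one, ← Real.exp_add, add_comm (-(lam * c))]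
        ring
      · have h2 : HasDerivAt (fun v => -(lam * (c - g) * u) + -(lam * c * v)) (-(lam * c)) v := by
          simpa using (((hasDerivAt_id v).const_mul (lam * c)).neg).const_add (-(lam * (c - g) * u))
        exact ((h2.exp.div_const (lam * c)).neg).congr_deriv (by field_simp)
    rw [p1, p2]
    field_simp
    ring
  have hi : ∀ q k : ℝ, IntervalIntegrable (fun u => q * Real.exp (-(k * u))) volume 0 1 :=
    fun q k => Continuous.intervalIntegrable (by fun_prop) _ _
  rw [intervalIntegral.integral_congr h1, intervalIntegral.integral_sub ((hi _ _).sub (hi _ _))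
    (hi _ _), intervalIntegral.integral_sub (hi _ _) (hi _ _),
    intervalIntegral.integral_const_mul, intervalIntegral.integral_const_mul,
    intervalIntegral.integral_const_mul, integral_exp_neg_mul (by positivity),
    integral_exp_neg_mul (by positivity), integral_exp_neg_mul (by positivity)]
  have x1 : Real.exp (-(lam * (2 * c - g)))
      = Real.exp (-(lam * c)) * Real.exp (-(lam * (c - g))) := by
    rw [← Real.exp_add]; congr 1; ring
  rw [x1, show 2 * c - g - c = c - g by ring, show 2 * c - g = c + (c - g) by ring]
  clear x1 hΓ h1
  generalize c - g = A at *
  field_simp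
  ring

/-! ### Radial integrals and the area of the lens -/

theorem measurePreserving_complex_repr :
    MeasurePreserving Complex.orthonormalBasisOneI.repr (volume : Measure ℂ)
      (volume : Measure Plane) :=
  LinearIsometryEquiv.measurePreserving _

theorem lintegral_plane_eq_complex (f : Plane → ENNReal) :
    ∫⁻ x, f x = ∫⁻ w : ℂ, f (Complex.orthonormalBasisOneI.repr w) :=
  (measurePreserving_complex_repr.lintegral_comp_emb
    Complex.orthonormalBasisOneI.repr.toHomeomorph.measurableEmbedding f).symm

theorem lintegral_norm_complex {f : ℝ → ENNReal} (hf : Measurable f) :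
    ∫⁻ w : ℂ, f ‖w‖ = ENNReal.ofReal (2 * Real.pi) * ∫⁻ r in Ioi (0 : ℝ), ENNReal.ofReal r * f r := by
  rw [← Complex.lintegral_comp_polarCoord_symm, polarCoord_target,
    Measure.volume_eq_prod, ← Measure.prod_restrict]
  have h : ∀ p : ℝ × ℝ, ENNReal.ofReal p.1 • f ‖Complex.polarCoord.symm p‖
      = ENNReal.ofReal p.1 * f |p.1| := fun p => by
    rw [Complex.norm_polarCoord_symm, smul_eq_mul]
  simp only [h]
  rw [lintegral_prod _ (by fun_prop)]
  simp only [lintegral_const, Measure.restrict_apply_univ, Real.volume_Ioo]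
  rw [lintegral_mul_const _ (by fun_prop), mul_comm, sub_neg_eq_add, ← two_mul]
  congr 1
  refine setLIntegral_congr_fun measurableSet_Ioi fun r hr => ?_
  rw [abs_of_pos hr]

theorem lintegral_norm_plane {f : ℝ → ENNReal} (hf : Measurable f) :
    ∫⁻ x : Plane, f ‖x‖
      = ENNReal.ofReal (2 * Real.pi) * ∫⁻ r in Ioi (0 : ℝ), ENNReal.ofReal r * f r := by
  rw [lintegral_plane_eq_complex, ← lintegral_norm_complex hf]
  simp only [LinearIsometryEquiv.norm_map]

theorem measurable_pathGain (α : ℝ) : Measurable (pathGain α) :=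
  Measurable.ite (measurableSet_singleton 0) measurable_const (by fun_prop)

theorem pathGain_nonneg {α r : ℝ} (hr : 0 ≤ r) : 0 ≤ pathGain α r := by
  unfold pathGain; split_ifs <;> positivity

theorem pathGain_le_one (α r : ℝ) : pathGain α r ≤ 1 := by
  unfold pathGain; split_ifs
  · exact le_rfl
  · exact min_le_left _ _

theorem pathGain_sq {α r : ℝ} (hr : 0 ≤ r) : pathGain α r ^ 2 = pathGain (2 * α) r := by
  unfold pathGain
  split_ifs with h
  · norm_num
  · have h0 : 0 ≤ r ^ (-α) := by positivity
    have h1 : r ^ (-(2 * α)) = (r ^ (-α)) ^ 2 := by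
      rw [← Real.rpow_natCast, ← Real.rpow_mul hr]; congr 1; push_cast; ring
    rw [h1]
    rcases le_total 1 (r ^ (-α)) with h2 | h2
    · rw [min_eq_left h2, min_eq_left (one_le_pow₀ h2), one_pow]
    · rw [min_eq_right h2, min_eq_right (pow_le_one₀ h0 h2)]

/-- In polar coordinates the unit disc contributes 1/2 and the rest 1/(α-2), each times 2π; the
latter converges because α > 2. -/
theorem lintegral_pathGain {α : ℝ} (hα : 2 < α) :
    ∫⁻ x : Plane, ENNReal.ofReal (pathGain α ‖x‖) = ENNReal.ofReal (α * Real.pi / (α - 2)) := by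
  rw [lintegral_norm_plane (f := fun r => ENNReal.ofReal (pathGain α r))
    (measurable_pathGain α).ennreal_ofReal]
  have hsplit : Ioi (0 : ℝ) = Ioc 0 1 ∪ Ioi 1 := (Ioc_union_Ioi_eq_Ioi zero_le_one).symm
  rw [hsplit, lintegral_union measurableSet_Ioi Ioc_disjoint_Ioi_same]
  have h1 : ∫⁻ r in Ioc (0 : ℝ) 1, ENNReal.ofReal r * ENNReal.ofReal (pathGain α r)
      = ENNReal.ofReal (1 / 2) := by
    have : ∀ r ∈ Ioc (0 : ℝ) 1, ENNReal.ofReal r * ENNReal.ofReal (pathGain α r)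
        = ENNReal.ofReal r := by
      intro r hr
      rw [pathGain, if_neg hr.1.ne', min_eq_left
        (Real.one_le_rpow_of_pos_of_le_one_of_nonpos hr.1 hr.2 (by linarith))]
      simp
    rw [setLIntegral_congr_fun measurableSet_Ioc this, ← ofReal_integral_eq_lintegral_ofReal,
      ← intervalIntegral.integral_of_le zero_le_one, integral_id]
    · norm_num
    · exact (continuous_id.integrableOn_Icc).mono_set Ioc_subset_Icc_self
    · exact (ae_restrict_iff' measurableSet_Ioc).2 (Eventually.of_forall fun r hr => hr.1.le)
  have h2 : ∫⁻ r in Ioi (1 : ℝ), ENNReal.ofReal r * ENNReal.ofReal (pathGain α r)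
      = ENNReal.ofReal (1 / (α - 2)) := by
    have : ∀ r ∈ Ioi (1 : ℝ), ENNReal.ofReal r * ENNReal.ofReal (pathGain α r)
        = ENNReal.ofReal (r ^ (1 - α)) := by
      intro r hr
      have hr1 : (1 : ℝ) < r := hr
      have hr0 : 0 < r := by linarith
      rw [pathGain, if_neg hr0.ne', min_eq_right
        (Real.rpow_le_one_of_one_le_of_nonpos hr1.le (by linarith)),
        ← ENNReal.ofReal_mul hr0.le, sub_eq_add_neg, Real.rpow_add hr0, Real.rpow_one]
    rw [setLIntegral_congr_fun measurableSet_Ioi this, ← ofReal_integral_eq_lintegral_ofReal,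
      integral_Ioi_rpow_of_lt (by linarith) one_pos]
    · congr 1
      rw [Real.one_rpow, show 1 - α + 1 = -(α - 2) by ring, div_neg, neg_div, neg_neg]
    · exact integrableOn_Ioi_rpow_of_lt (by linarith) one_pos
    · exact (ae_restrict_iff' measurableSet_Ioi).2 (Eventually.of_forall fun r hr =>
        Real.rpow_nonneg (zero_le_one.trans (le_of_lt hr)) _)
  have h3 : 0 < α - 2 := by linarith
  rw [h1, h2, ← ENNReal.ofReal_add (by norm_num) (by positivity),
    ← ENNReal.ofReal_mul (by positivity)]
  congr 1
  field_simp
  ring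

/-- Squaring the gain doubles its exponent, so this is the previous integral at 2α. -/
theorem lintegral_pathGain_sq {α : ℝ} (hα : 2 < α) :
    ∫⁻ x : Plane, ENNReal.ofReal (pathGain α ‖x‖) ^ 2
      = ENNReal.ofReal (α * Real.pi / (α - 1)) := by
  have h : ∀ x : Plane, ENNReal.ofReal (pathGain α ‖x‖) ^ 2
      = ENNReal.ofReal (pathGain (2 * α) ‖x‖) := fun x => by
    rw [← pathGain_sq (norm_nonneg x), ENNReal.ofReal_pow (pathGain_nonneg (norm_nonneg x))]
  simp only [h]
  rw [lintegral_pathGain (by linarith)]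
  congr 1
  rw [show 2 * α - 2 = 2 * (α - 1) by ring]
  have : α - 1 ≠ 0 := by linarith
  field_simp

/-- A linear isometry of the plane that maps a given vector to the positive real axis. -/
theorem exists_isometry_complex (z : Plane) :
    ∃ e : Plane ≃ₗᵢ[ℝ] ℂ, e z = (‖z‖ : ℂ) := by
  let f := Complex.orthonormalBasisOneI.repr.symm
  rcases eq_or_ne z 0 with rfl | hz
  · exact ⟨f, by simp⟩
  · have hz' : f z ≠ 0 := by simpa using hz
    have hn : ‖f z‖ = ‖z‖ := f.norm_map z
    let u : Circle := ⟨(‖z‖ : ℂ) / f z, mem_sphere_zero_iff_norm.2 (by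
      rw [norm_div, hn]
      simp [hz])⟩
    refine ⟨f.trans (rotation u), ?_⟩
    rw [LinearIsometryEquiv.trans_apply, rotation_apply]
    exact div_mul_cancel₀ _ hz'

theorem volume_abs_le (k : ℝ) : volume {b : ℝ | b ^ 2 ≤ k} = ENNReal.ofReal (2 * √k) := by
  rcases lt_or_ge k 0 with hk | hk
  · have : {b : ℝ | b ^ 2 ≤ k} = ∅ := by
      ext b; simp only [mem_ofPred_eq, mem_empty_iff_false, iff_false, not_le]
      exact hk.trans_le (sq_nonneg b)
    rw [this, Real.sqrt_eq_zero_of_nonpos hk.le]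
    simp
  · have : {b : ℝ | b ^ 2 ≤ k} = Icc (-√k) (√k) := by
      ext b
      rw [mem_ofPred_eq, mem_Icc, ← abs_le, Real.le_sqrt (abs_nonneg b) hk, sq_abs]
    rw [this, Real.volume_Icc]
    congr 1; ring

theorem integral_sqrt_sub_sq {d s : ℝ} (hd : 0 < d) (hs : 0 ≤ s) (hsd : s ≤ d) :
    ∫ t in s..d, √(d ^ 2 - t ^ 2) = (d ^ 2 * Real.arccos (s / d) - s * √(d ^ 2 - s ^ 2)) / 2 := by
  rw [intervalIntegral.integral_eq_sub_of_hasDerivAt_of_le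
    (f := fun t => (t * √(d ^ 2 - t ^ 2) - d ^ 2 * Real.arccos (t / d)) / 2) hsd
    (Continuous.continuousOn (by
      have := Real.continuous_arccos
      fun_prop)) (fun t ht => ?_)
    (Continuous.intervalIntegrable (by fun_prop) _ _)]
  · simp [div_self hd.ne']
    ring
  · have ht0 : 0 < t := hs.trans_lt ht.1
    have hp : 0 < d ^ 2 - t ^ 2 := by
      have := ht.2
      nlinarith
    have h1 : HasDerivAt (fun t : ℝ => d ^ 2 - t ^ 2) (-(2 * t)) t := by
      simpa using ((hasDerivAt_pow 2 t).const_sub (d ^ 2))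
    have h2 := h1.sqrt hp.ne'
    have h3 : HasDerivAt (fun t => Real.arccos (t / d)) (-(1 / √(1 - (t / d) ^ 2)) * (1 / d)) t :=
      (Real.hasDerivAt_arccos (by
        have : 0 < t / d := by positivity
        linarith) (by
        rw [Ne, div_eq_one_iff_eq hd.ne']
        exact ht.2.ne)).comp t ((hasDerivAt_id t).div_const d)
    refine ((((hasDerivAt_id t).mul h2).sub (h3.const_mul (d ^ 2))).div_const 2).congr_deriv ?_
    have h4 : √(1 - (t / d) ^ 2) = √(d ^ 2 - t ^ 2) / d := by
      rw [show 1 - (t / d) ^ 2 = (d ^ 2 - t ^ 2) / d ^ 2 by field_simp, Real.sqrt_div hp.le,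
        Real.sqrt_sq hd.le]
    have h5 := Real.sqrt_pos.2 hp
    have h6 := Real.sq_sqrt hp.le
    rw [h4]
    simp only [id]
    field_simp
    rw [h6]
    ring

/-- After an isometry the centres are ∓r/2 on the real axis. A point with abscissa a lies in both
discs exactly if it lies in the disc with the farther centre, so its vertical section is a chord of
half length √(d² - (|a| + r/2)²). Evenness in a gives four times an integral of √(d² - t²). -/
theorem volume_closedBall_inter {d : ℝ} (hd : 0 < d) (x y : Plane) :
    volume (Metric.closedBall x d ∩ Metric.closedBall y d)
      = ENNReal.ofReal (lensArea d (dist x y)) := by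
  set r := dist x y with hr
  have hr0 : 0 ≤ r := dist_nonneg
  -- move the discs to centres on the real axis
  obtain ⟨e, he⟩ := exists_isometry_complex (y - x)
  let T : ℂ → Plane := fun w => e.symm (w + (r / 2 : ℝ)) + x
  have hT : MeasurePreserving T volume volume :=
    (measurePreserving_add_right volume x).comp
      (e.symm.measurePreserving.comp (measurePreserving_add_right volume _))
  have hnorm : ‖y - x‖ = r := by rw [hr, dist_comm, dist_eq_norm]
  have hTx : ∀ w : ℂ, dist (T w) x = ‖w + (r / 2 : ℝ)‖ := by
    intro w
    simp only [T]
    rw [dist_eq_norm, add_sub_cancel_right, LinearIsometryEquiv.norm_map]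
  have hTy : ∀ w : ℂ, dist (T w) y = ‖w - (r / 2 : ℝ)‖ := by
    intro w
    have : T w - y = e.symm (w - (r / 2 : ℝ)) := by
      apply e.injective
      have h1 : T w - y = e.symm (w + (r / 2 : ℝ)) - (y - x) := by simp only [T]; abel
      rw [h1, map_sub, e.apply_symm_apply, e.apply_symm_apply, he, hnorm]
      push_cast; ring
    rw [dist_eq_norm, this, LinearIsometryEquiv.norm_map]
  have hm : MeasurableSet (Metric.closedBall x d ∩ Metric.closedBall y d) :=
    measurableSet_closedBall.inter measurableSet_closedBall
  rw [← hT.measure_preimage hm.nullMeasurableSet]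
  have hpre : T ⁻¹' (Metric.closedBall x d ∩ Metric.closedBall y d)
      = Complex.measurableEquivRealProd ⁻¹' {p : ℝ × ℝ | p.2 ^ 2 ≤ d ^ 2 - (|p.1| + r / 2) ^ 2} := by
    ext w
    rw [mem_preimage, mem_inter_iff, Metric.mem_closedBall, Metric.mem_closedBall, hTx, hTy,
      ← abs_of_pos hd, ← abs_of_nonneg (norm_nonneg (w + (r / 2 : ℝ))),
      ← abs_of_nonneg (norm_nonneg (w - (r / 2 : ℝ))), ← sq_le_sq, ← sq_le_sq, ← Complex.normSq_eq_norm_sq,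
      ← Complex.normSq_eq_norm_sq, Complex.normSq_apply, Complex.normSq_apply]
    simp only [Complex.add_re, Complex.sub_re, Complex.add_im, Complex.sub_im, Complex.ofReal_re,
      Complex.ofReal_im, add_zero, sub_zero, mem_preimage, Complex.measurableEquivRealProd_apply,
      mem_ofPred_eq, sq_abs]
    rcases abs_cases w.re with ⟨h, h'⟩ | ⟨h, h'⟩ <;> rw [h]
    · constructor
      · rintro ⟨h1, -⟩; nlinarith
      · intro h1; constructor <;> nlinarith
    · constructor
      · rintro ⟨-, h1⟩; nlinarith
      · intro h1; constructor <;> nlinarith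
  have hS : MeasurableSet {p : ℝ × ℝ | p.2 ^ 2 ≤ d ^ 2 - (|p.1| + r / 2) ^ 2} :=
    measurableSet_le (by fun_prop) (by fun_prop)
  rw [hpre, Complex.volume_preserving_equiv_real_prod.measure_preimage hS.nullMeasurableSet,
    Measure.volume_eq_prod, Measure.prod_apply hS]
  have hsec : ∀ a : ℝ, volume (Prod.mk a ⁻¹' {p : ℝ × ℝ | p.2 ^ 2 ≤ d ^ 2 - (|p.1| + r / 2) ^ 2})
      = ENNReal.ofReal (2 * √(d ^ 2 - (|a| + r / 2) ^ 2)) := fun a =>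
    volume_abs_le (d ^ 2 - (|a| + r / 2) ^ 2)
  simp only [hsec]
  -- This upper limit treats overlapping and disjoint discs together: the square root of a negative
  -- number is 0, so nothing is contributed beyond `d`.
  set R := max d (r / 2) with hR
  have hRd : d ≤ R := le_max_left _ _
  have hRr : r / 2 ≤ R := le_max_right _ _
  have hint : ∫ a, 2 * √(d ^ 2 - (|a| + r / 2) ^ 2) = 4 * ∫ t in (r / 2)..R, √(d ^ 2 - t ^ 2) := by
    rw [integral_const_mul, integral_comp_abs (f := fun a => √(d ^ 2 - (a + r / 2) ^ 2)), ← mul_assoc]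
    norm_num
    rw [intervalIntegral.integral_of_le hRr]
    have h1 : ∫ a in Ioi (0 : ℝ), √(d ^ 2 - (a + r / 2) ^ 2) = ∫ t in Ioi (r / 2), √(d ^ 2 - t ^ 2) := by
      have := (measurePreserving_add_right (volume : Measure ℝ) (r / 2)).setIntegral_preimage_emb
        (MeasurableEquiv.addRight (r / 2)).measurableEmbedding (fun t => √(d ^ 2 - t ^ 2))
        (Ioi (r / 2))
      simpa using this
    rw [h1]
    refine setIntegral_eq_of_subset_of_forall_sdiff_eq_zero measurableSet_Ioi Ioc_subset_Ioi_self ?_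
    intro t ht
    have ht' : R < t := by
      by_contra h
      exact ht.2 ⟨ht.1, not_lt.1 h⟩
    refine Real.sqrt_eq_zero_of_nonpos ?_
    nlinarith
  have hInt : Integrable fun a : ℝ => 2 * √(d ^ 2 - (|a| + r / 2) ^ 2) := by
    refine Continuous.integrable_of_hasCompactSupport (by fun_prop) ?_
    refine HasCompactSupport.intro (isCompact_Icc (a := -d) (b := d)) fun a ha => ?_
    have ha' : d < |a| := by
      by_contra h
      exact ha (abs_le.1 (not_lt.1 h))
    rw [Real.sqrt_eq_zero_of_nonpos (by nlinarith), mul_zero]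
  rw [← ofReal_integral_eq_lintegral_ofReal hInt (Eventually.of_forall fun a => by positivity), hint]
  congr 1
  rw [lensArea]
  split_ifs with h
  · have hR' : R = d := max_eq_left (by linarith)
    rw [hR', integral_sqrt_sub_sq hd (by linarith) (by linarith),
      show r / 2 / d = r / (2 * d) by field_simp,
      show 4 * d ^ 2 - r ^ 2 = 2 ^ 2 * (d ^ 2 - (r / 2) ^ 2) by ring,
      Real.sqrt_mul (by norm_num), Real.sqrt_sq (by norm_num)]
    ring
  · have hR' : R = r / 2 := max_eq_right (by linarith)
    rw [hR', intervalIntegral.integral_same, mul_zero]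

theorem volume_closedBall_plane {d : ℝ} (hd : 0 < d) (x : Plane) :
    volume (Metric.closedBall x d) = ENNReal.ofReal (discArea d) := by
  rw [EuclideanSpace.volume_closedBall_fin_two, discArea, ENNReal.ofReal_mul (by positivity),
    ENNReal.ofReal_pow hd.le]

/-! ### Elliptic coordinates -/

/-- Elliptic coordinates with foci `(±r, 0)`. -/
def ellipticCoord (r : ℝ) (p : ℝ × ℝ) : ℝ × ℝ :=
  (r * (Real.cosh p.1 * Real.cos p.2), r * (Real.sinh p.1 * Real.sin p.2))

/-- The derivative of elliptic coordinates. -/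
def fderivEllipticCoord (r : ℝ) (p : ℝ × ℝ) : ℝ × ℝ →L[ℝ] ℝ × ℝ :=
  (Matrix.toLin (Module.Basis.finTwoProd ℝ) (Module.Basis.finTwoProd ℝ)
    !![r * (Real.sinh p.1 * Real.cos p.2), -(r * (Real.cosh p.1 * Real.sin p.2));
       r * (Real.cosh p.1 * Real.sin p.2), r * (Real.sinh p.1 * Real.cos p.2)]).toContinuousLinearMap

theorem hasFDerivAt_ellipticCoord (r : ℝ) (p : ℝ × ℝ) :
    HasFDerivAt (ellipticCoord r) (fderivEllipticCoord r p) p := by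
  unfold fderivEllipticCoord ellipticCoord
  rw [Matrix.toLin_finTwoProd_toContinuousLinearMap]
  have h1 : HasFDerivAt (fun p : ℝ × ℝ => p.1) (ContinuousLinearMap.fst ℝ ℝ ℝ) p := hasFDerivAt_fst
  have h2 : HasFDerivAt (fun p : ℝ × ℝ => p.2) (ContinuousLinearMap.snd ℝ ℝ ℝ) p := hasFDerivAt_snd
  have c1 := (Real.hasDerivAt_cosh p.1).comp_hasFDerivAt p h1
  have s1 := (Real.hasDerivAt_sinh p.1).comp_hasFDerivAt p h1
  have c2 := (Real.hasDerivAt_cos p.2).comp_hasFDerivAt p h2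
  have s2 := (Real.hasDerivAt_sin p.2).comp_hasFDerivAt p h2
  refine (((c1.mul c2).const_mul r).prodMk ((s1.mul s2).const_mul r)).congr_fderiv ?_
  ext <;> simp [mul_comm, mul_left_comm]

theorem det_fderivEllipticCoord (r : ℝ) (p : ℝ × ℝ) :
    (fderivEllipticCoord r p).det
      = r ^ 2 / 2 * (Real.cosh (2 * p.1) - Real.cos (2 * p.2)) := by
  unfold fderivEllipticCoord
  simp only [LinearMap.det_toContinuousLinearMap, LinearMap.det_toLin, Matrix.det_fin_two_of]
  rw [Real.cosh_two_mul, Real.cos_two_mul]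
  have h1 := Real.cosh_sq p.1
  have h2 := Real.sin_sq_add_cos_sq p.2
  linear_combination (r ^ 2 * Real.cosh p.1 ^ 2) * h2
    + (r ^ 2 / 2 * (1 - 2 * Real.cos p.2 ^ 2)) * h1

theorem cos_lt_cosh {μ : ℝ} (hμ : 0 < μ) (ν : ℝ) : Real.cos ν < Real.cosh μ :=
  (Real.cos_le_one ν).trans_lt (Real.one_lt_cosh.2 hμ.ne')

theorem neg_cos_lt_cosh {μ : ℝ} (hμ : 0 < μ) (ν : ℝ) : -Real.cos ν < Real.cosh μ := by
  have := Real.neg_one_le_cos ν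
  have := Real.one_lt_cosh.2 hμ.ne'
  linarith

/-- With its companion for the other focus this is the reason for elliptic coordinates: the
distances to the foci become r(cosh μ ∓ cos ν). -/
theorem ellipticCoord_dist_sub (r : ℝ) (p : ℝ × ℝ) :
    ((ellipticCoord r p).1 - r) ^ 2 + (ellipticCoord r p).2 ^ 2
      = (r * (Real.cosh p.1 - Real.cos p.2)) ^ 2 := by
  unfold ellipticCoord
  have h1 := Real.cosh_sq p.1
  have h2 := Real.sin_sq_add_cos_sq p.2
  linear_combination (r ^ 2 * Real.sinh p.1 ^ 2) * h2 + r ^ 2 * (Real.cos p.2 ^ 2 - 1) * h1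

theorem ellipticCoord_dist_add (r : ℝ) (p : ℝ × ℝ) :
    ((ellipticCoord r p).1 + r) ^ 2 + (ellipticCoord r p).2 ^ 2
      = (r * (Real.cosh p.1 + Real.cos p.2)) ^ 2 := by
  unfold ellipticCoord
  have h1 := Real.cosh_sq p.1
  have h2 := Real.sin_sq_add_cos_sq p.2
  linear_combination (r ^ 2 * Real.sinh p.1 ^ 2) * h2 + r ^ 2 * (Real.cos p.2 ^ 2 - 1) * h1

/-- The focal distances determine cosh μ and cos ν, hence μ > 0; the second coordinate then gives
sin ν. Equal sine and cosine force the cosine of the difference of the angles to be 1, and that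
difference is smaller than 2π in absolute value. -/
theorem injOn_ellipticCoord {r : ℝ} (hr : 0 < r) :
    InjOn (ellipticCoord r) (Ioi 0 ×ˢ Ioo 0 (2 * Real.pi)) := by
  rintro ⟨μ, ν⟩ ⟨hμ, hν⟩ ⟨μ', ν'⟩ ⟨hμ', hν'⟩ h
  simp only [mem_Ioi, mem_Ioo] at hμ hν hμ' hν'
  have e1 := ellipticCoord_dist_sub r (μ, ν)
  rw [h, ellipticCoord_dist_sub r (μ', ν')] at e1
  have e2 := ellipticCoord_dist_add r (μ, ν)
  rw [h, ellipticCoord_dist_add r (μ', ν')] at e2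
  have f1 := cos_lt_cosh hμ ν
  have f1' := cos_lt_cosh hμ' ν'
  have f2 := neg_cos_lt_cosh hμ ν
  have f2' := neg_cos_lt_cosh hμ' ν'
  have g1 := (sq_eq_sq₀ (mul_nonneg hr.le (by simp only; linarith))
    (mul_nonneg hr.le (by simp only; linarith))).1 e1
  have g2 := (sq_eq_sq₀ (mul_nonneg hr.le (by simp only; linarith))
    (mul_nonneg hr.le (by simp only; linarith))).1 e2
  have g1 := mul_left_cancel₀ hr.ne' g1
  have g2 := mul_left_cancel₀ hr.ne' g2
  simp only at g1 g2
  have hcosh : Real.cosh μ = Real.cosh μ' := by linarith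
  have hcos : Real.cos ν = Real.cos ν' := by linarith
  have hμμ : μ = μ' := by
    have := Real.cosh_strictMonoOn.injOn (mem_Ici.2 hμ.le) (mem_Ici.2 hμ'.le) hcosh
    exact this
  subst hμμ
  have hsin : Real.sin ν = Real.sin ν' := by
    have h2 := congrArg Prod.snd h
    simp only [ellipticCoord] at h2
    exact mul_left_cancel₀ (Real.sinh_pos_iff.2 hμ).ne' (mul_left_cancel₀ hr.ne' h2)
  have hνν : ν - ν' = 0 := by
    rw [← Real.cos_eq_one_iff_of_lt_of_lt (by linarith) (by linarith), Real.cos_sub, hcos, hsin]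
    nlinarith [Real.sin_sq_add_cos_sq ν']
  rw [sub_eq_zero.1 hνν]

/-- Up to signs the map is the complex cosine, cos(x+iy) = cos x cosh y - i sin x sinh y, which is
surjective. Off the real axis sinh y and sin x are nonzero, so μ can be made positive and the angle
avoids the excluded endpoint. -/
theorem mem_image_ellipticCoord {r : ℝ} (hr : 0 < r) {q : ℝ × ℝ} (hq : q.2 ≠ 0) :
    q ∈ ellipticCoord r '' (Ioi 0 ×ˢ Ioo 0 (2 * Real.pi)) := by
  obtain ⟨w, hw⟩ := Complex.cos_surjective (((q.1 / r : ℝ) : ℂ) + ((q.2 / r : ℝ) : ℂ) * Complex.I)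
  have hre := congrArg Complex.re hw
  have him := congrArg Complex.im hw
  rw [Complex.cos_eq] at hre him
  simp only [← Complex.ofReal_cos, ← Complex.ofReal_sin, ← Complex.ofReal_cosh,
    ← Complex.ofReal_sinh, Complex.sub_re, Complex.sub_im, Complex.mul_re, Complex.mul_im,
    Complex.add_re, Complex.add_im, Complex.ofReal_re, Complex.ofReal_im, Complex.I_re,
    Complex.I_im, mul_zero, mul_one, zero_mul, sub_zero, add_zero, zero_add, zero_sub] at hre him
  -- adjust the signs
  obtain ⟨μ, θ, hμ, h1, h2⟩ : ∃ μ θ : ℝ, 0 < μ ∧ Real.cosh μ * Real.cos θ = q.1 / r ∧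
      Real.sinh μ * Real.sin θ = q.2 / r := by
    have hne : q.2 / r ≠ 0 := div_ne_zero hq hr.ne'
    have hy : w.im ≠ 0 := by
      intro h
      rw [h] at him
      simp at him
      exact hne (by simpa using him.symm)
    rcases lt_or_gt_of_ne hy with h | h
    · exact ⟨-w.im, w.re, by linarith, by rw [Real.cosh_neg, mul_comm]; exact hre,
        by rw [Real.sinh_neg, ← him]; ring⟩
    · exact ⟨w.im, -w.re, h, by rw [Real.cos_neg, mul_comm]; exact hre,
        by rw [Real.sin_neg, ← him]; ring⟩
  have hπ : 0 < 2 * Real.pi := Real.two_pi_pos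
  -- The angle is reduced modulo 2π, which changes neither sine nor cosine.
  have hmem := toIcoMod_mem_Ico hπ 0 θ
  rw [zero_add] at hmem
  obtain ⟨n, hn⟩ : ∃ n : ℤ, toIcoMod hπ 0 θ = θ - n * (2 * Real.pi) :=
    ⟨toIcoDiv hπ 0 θ, by rw [toIcoMod, zsmul_eq_mul]⟩
  have hcos : Real.cos (toIcoMod hπ 0 θ) = Real.cos θ := by
    rw [hn, Real.cos_sub_int_mul_two_pi]
  have hsin : Real.sin (toIcoMod hπ 0 θ) = Real.sin θ := by
    rw [hn, Real.sin_sub_int_mul_two_pi]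
  refine ⟨(μ, toIcoMod hπ 0 θ), ⟨hμ, lt_of_le_of_ne hmem.1 fun h => ?_, hmem.2⟩, ?_⟩
  · have h' : 0 = toIcoMod hπ 0 θ := h
    rw [← h', Real.sin_zero] at hsin
    rw [← hsin, mul_zero] at h2
    exact div_ne_zero hq hr.ne' h2.symm
  · ext
    · simp only [ellipticCoord]
      rw [hcos, h1]
      field_simp
    · simp only [ellipticCoord]
      rw [hsin, h2]
      field_simp

theorem volume_snd_eq_zero : volume {q : ℝ × ℝ | q.2 = 0} = 0 := by
  have : {q : ℝ × ℝ | q.2 = 0} = univ ×ˢ {0} := by ext; simp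
  rw [this, Measure.volume_eq_prod, Measure.prod_prod]
  simp

theorem lintegral_ellipticCoord {r : ℝ} (hr : 0 < r) (f : ℝ × ℝ → ENNReal) :
    ∫⁻ q, f q = ∫⁻ p in Ioi 0 ×ˢ Ioo 0 (2 * Real.pi),
      ENNReal.ofReal (r ^ 2 / 2 * (Real.cosh (2 * p.1) - Real.cos (2 * p.2)))
        * f (ellipticCoord r p) := by
  have hae : ellipticCoord r '' (Ioi 0 ×ˢ Ioo 0 (2 * Real.pi)) =ᵐ[volume] univ := by
    rw [ae_eq_univ]
    refine measure_mono_null (fun q hq => ?_) volume_snd_eq_zero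
    by_contra h
    exact hq (mem_image_ellipticCoord hr h)
  rw [← setLIntegral_univ, ← setLIntegral_congr hae,
    lintegral_image_eq_lintegral_abs_det_fderiv_mul volume
      (measurableSet_Ioi.prod measurableSet_Ioo)
      (fun p _ => (hasFDerivAt_ellipticCoord r p).hasFDerivWithinAt) (injOn_ellipticCoord hr)]
  refine setLIntegral_congr_fun (measurableSet_Ioi.prod measurableSet_Ioo) fun p hp => ?_
  have hp1 : 0 < 2 * p.1 := by
    have := hp.1
    simp only [mem_Ioi] at this
    linarith
  rw [det_fderivEllipticCoord, abs_of_nonneg]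
  have := cos_lt_cosh hp1 (2 * p.2)
  have h3 : 0 ≤ Real.cosh (2 * p.1) - Real.cos (2 * p.2) := by linarith
  positivity

/-- The integral over the plane of a product of functions of the distances to two points, in
elliptic coordinates. -/
theorem lintegral_norm_mul_norm {r : ℝ} (hr : 0 < r) {f g : ℝ → ENNReal} (hf : Measurable f)
    (hg : Measurable g) :
    ∫⁻ w : ℂ, f ‖w + (r : ℂ)‖ * g ‖w - (r : ℂ)‖
      = ∫⁻ μ in Ioi (0 : ℝ), ∫⁻ ν in Ioo 0 (2 * Real.pi),
        f (r * (Real.cosh μ + Real.cos ν)) * g (r * (Real.cosh μ - Real.cos ν)) *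
          ENNReal.ofReal (r ^ 2 / 2 * (Real.cosh (2 * μ) - Real.cos (2 * ν))) := by
  rw [← (Complex.volume_preserving_equiv_real_prod.symm _).lintegral_comp_emb
    Complex.measurableEquivRealProd.symm.measurableEmbedding, lintegral_ellipticCoord hr]
  have hnorm : ∀ p ∈ Ioi (0 : ℝ) ×ˢ Ioo 0 (2 * Real.pi),
      ENNReal.ofReal (r ^ 2 / 2 * (Real.cosh (2 * p.1) - Real.cos (2 * p.2)))
        * (f ‖Complex.measurableEquivRealProd.symm (ellipticCoord r p) + (r : ℂ)‖ *
          g ‖Complex.measurableEquivRealProd.symm (ellipticCoord r p) - (r : ℂ)‖)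
      = f (r * (Real.cosh p.1 + Real.cos p.2)) * g (r * (Real.cosh p.1 - Real.cos p.2)) *
          ENNReal.ofReal (r ^ 2 / 2 * (Real.cosh (2 * p.1) - Real.cos (2 * p.2))) := by
    rintro p ⟨hp, -⟩
    have f1 := cos_lt_cosh hp p.2
    have f2 := neg_cos_lt_cosh hp p.2
    have e1 : ‖Complex.measurableEquivRealProd.symm (ellipticCoord r p) + (r : ℂ)‖
        = r * (Real.cosh p.1 + Real.cos p.2) := by
      rw [← sq_eq_sq₀ (norm_nonneg _) (mul_nonneg hr.le (by linarith)),
        ← ellipticCoord_dist_add, ← Complex.normSq_eq_norm_sq, Complex.normSq_apply]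
      simp [Complex.measurableEquivRealProd]
      ring
    have e2 : ‖Complex.measurableEquivRealProd.symm (ellipticCoord r p) - (r : ℂ)‖
        = r * (Real.cosh p.1 - Real.cos p.2) := by
      rw [← sq_eq_sq₀ (norm_nonneg _) (mul_nonneg hr.le (by linarith)),
        ← ellipticCoord_dist_sub, ← Complex.normSq_eq_norm_sq, Complex.normSq_apply]
      simp [Complex.measurableEquivRealProd]
      ring
    rw [e1, e2, mul_comm]
  rw [setLIntegral_congr_fun (measurableSet_Ioi.prod measurableSet_Ioo) hnorm,
    Measure.volume_eq_prod, ← Measure.prod_restrict]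
  exact lintegral_prod _ (Measurable.aemeasurable (by fun_prop))

/-! ### Pair integrals over the plane -/

/-- The integral of the product of the path gains from two points at distance `2 r`. -/
def pairGain (α r : ℝ) : ENNReal :=
  ∫⁻ w : ℂ, ENNReal.ofReal (pathGain α ‖w + (r : ℂ)‖) * ENNReal.ofReal (pathGain α ‖w - (r : ℂ)‖)

theorem measurable_pairGain (α : ℝ) : Measurable (pairGain α) := by
  have := measurable_pathGain α
  unfold pairGain
  refine Measurable.lintegral_prod_right' (f := fun p : ℝ × ℂ =>
    ENNReal.ofReal (pathGain α ‖p.2 + (p.1 : ℂ)‖) * ENNReal.ofReal (pathGain α ‖p.2 - (p.1 : ℂ)‖)) ?_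
  fun_prop

/-- Rotating z to the real axis and translating by half of it places the two relevant points
symmetrically about the origin, at the foci. -/
theorem lintegral_pathGain_add (α : ℝ) (z : Plane) :
    ∫⁻ x : Plane, ENNReal.ofReal (pathGain α ‖x‖) * ENNReal.ofReal (pathGain α ‖x + z‖)
      = pairGain α (‖z‖ / 2) := by
  obtain ⟨e, he⟩ := exists_isometry_complex z
  have h1 : MeasurePreserving e volume volume := e.measurePreserving
  have h2 : MeasurePreserving (fun w : ℂ => w + ((‖z‖ / 2 : ℝ) : ℂ)) volume volume :=
    measurePreserving_add_right _ _
  have h3 := h2.comp h1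
  have h4 : MeasurableEmbedding fun x : Plane => e x + ((‖z‖ / 2 : ℝ) : ℂ) :=
    (MeasurableEquiv.addRight _).measurableEmbedding.comp e.toHomeomorph.measurableEmbedding
  rw [pairGain, ← h3.lintegral_comp_emb h4]
  refine lintegral_congr fun x => ?_
  have e1 : e x + ((‖z‖ / 2 : ℝ) : ℂ) + ((‖z‖ / 2 : ℝ) : ℂ) = e (x + z) := by
    rw [map_add, he]; push_cast; ring
  simp only [Function.comp]
  rw [add_sub_cancel_right, e1, LinearIsometryEquiv.norm_map, LinearIsometryEquiv.norm_map, mul_comm]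

/-- One of the two gains is bounded by 1, and the other one is integrable. -/
theorem pairGain_lt_top {α : ℝ} (hα : 2 < α) (r : ℝ) : pairGain α r < ⊤ := by
  have h : pairGain α r ≤ ∫⁻ w : ℂ, ENNReal.ofReal (pathGain α ‖w + (r : ℂ)‖) := by
    refine lintegral_mono fun w => ?_
    exact mul_le_of_le_one_right' (by
      rw [← ENNReal.ofReal_one]; exact ENNReal.ofReal_le_ofReal (pathGain_le_one _ _))
  refine h.trans_lt ?_
  rw [lintegral_add_right_eq_self (fun w : ℂ => ENNReal.ofReal (pathGain α ‖w‖)) (r : ℂ)]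
  have h2 := lintegral_plane_eq_complex fun x => ENNReal.ofReal (pathGain α ‖x‖)
  simp only [LinearIsometryEquiv.norm_map] at h2
  rw [← h2, lintegral_pathGain hα]
  exact ENNReal.ofReal_lt_top

theorem ellipticIntegral_eq_toReal {α r : ℝ} (hα : 2 < α) (hr : 0 < r) :
    ellipticIntegral α r = (pairGain α r).toReal := by
  have hm := measurable_pathGain α
  let F : ℝ → ℝ → ℝ := fun μ ν =>
    pathGain α (r * (Real.cosh μ + Real.cos ν)) * pathGain α (r * (Real.cosh μ - Real.cos ν)) *
      (r ^ 2 / 2 * (Real.cosh (2 * μ) - Real.cos (2 * ν)))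
  have hF0 : ∀ μ ∈ Ioi (0 : ℝ), ∀ ν, 0 ≤ F μ ν := by
    intro μ hμ ν
    have f1 := cos_lt_cosh hμ ν
    have f2 := neg_cos_lt_cosh hμ ν
    have f3 := cos_lt_cosh (μ := 2 * μ) (by simp only [mem_Ioi] at hμ; linarith) (2 * ν)
    exact mul_nonneg (mul_nonneg (pathGain_nonneg (mul_nonneg hr.le (by linarith)))
      (pathGain_nonneg (mul_nonneg hr.le (by linarith)))) (mul_nonneg (by positivity) (by linarith))
  have hFm : Measurable (Function.uncurry F) := by
    unfold Function.uncurry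
    simp only [F]
    fun_prop
  have hpair : pairGain α r
      = ∫⁻ μ in Ioi (0 : ℝ), ∫⁻ ν in Ioo 0 (2 * Real.pi), ENNReal.ofReal (F μ ν) := by
    rw [pairGain, lintegral_norm_mul_norm hr (f := fun s => ENNReal.ofReal (pathGain α s))
      (g := fun s => ENNReal.ofReal (pathGain α s)) (by fun_prop) (by fun_prop)]
    refine setLIntegral_congr_fun measurableSet_Ioi fun μ hμ => ?_
    refine lintegral_congr fun ν => ?_
    have f1 := cos_lt_cosh hμ ν
    have f2 := neg_cos_lt_cosh hμ ν
    have g1 := pathGain_nonneg (α := α) (mul_nonneg hr.le (by linarith :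
      0 ≤ Real.cosh μ + Real.cos ν))
    have g2 := pathGain_nonneg (α := α) (mul_nonneg hr.le (by linarith :
      0 ≤ Real.cosh μ - Real.cos ν))
    rw [← ENNReal.ofReal_mul g1, ← ENNReal.ofReal_mul (mul_nonneg g1 g2)]
  have hGm : Measurable fun μ => ∫⁻ ν in Ioo 0 (2 * Real.pi), ENNReal.ofReal (F μ ν) :=
    Measurable.lintegral_prod_right' (f := fun p : ℝ × ℝ => ENNReal.ofReal (F p.1 p.2))
      hFm.ennreal_ofReal
  have hfin := pairGain_lt_top hα r
  -- The finite total makes almost every inner integral finite, so the iterated real integral agrees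
  -- with the extended one.
  rw [hpair, ← integral_toReal hGm.aemeasurable (ae_lt_top hGm (hpair ▸ hfin.ne))]
  unfold ellipticIntegral
  refine setIntegral_congr_fun measurableSet_Ioi fun μ hμ => ?_
  rw [intervalIntegral.integral_of_le Real.two_pi_pos.le, integral_Ioc_eq_integral_Ioo,
    integral_eq_lintegral_of_nonneg_ae (Eventually.of_forall fun ν => hF0 μ hμ ν)]
  exact (hFm.comp (measurable_const.prodMk measurable_id)).aestronglyMeasurable

theorem ellipticIntegral_eq {α r : ℝ} (hα : 2 < α) (hr : 0 < r) :
    ENNReal.ofReal (ellipticIntegral α r) = pairGain α r := by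
  rw [ellipticIntegral_eq_toReal hα hr, ENNReal.ofReal_toReal (pairGain_lt_top hα r).ne]

theorem lintegral_Ioi_comp_two_mul (f : ℝ → ENNReal) :
    ∫⁻ s in Ioi (0 : ℝ), f s = ∫⁻ r in Ioi (0 : ℝ), 2 * f (2 * r) := by
  have himg : (fun r : ℝ => 2 * r) '' Ioi 0 = Ioi 0 := by
    ext s
    simp only [mem_image, mem_Ioi]
    exact ⟨fun ⟨r, hr, h⟩ => by linarith, fun h => ⟨s / 2, by linarith, by ring⟩⟩
  conv_lhs => rw [← himg]
  rw [lintegral_image_eq_lintegral_abs_deriv_mul measurableSet_Ioi (f' := fun _ => 2)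
    (fun x _ => by simpa using ((hasDerivAt_id x).const_mul (2 : ℝ)).hasDerivWithinAt)
    (fun a _ b _ h => by simpa using h)]
  simp

/-- Integration over pairs of points against the path gains and a function of the distance. -/
theorem lintegral_pair {α : ℝ} (hα : 2 < α) {f : ℝ → ENNReal} (hf : Measurable f) :
    ∫⁻ x : Plane, ∫⁻ y : Plane, ENNReal.ofReal (pathGain α ‖x‖) * ENNReal.ofReal (pathGain α ‖y‖)
        * f (dist x y)
      = ENNReal.ofReal (8 * Real.pi) * ∫⁻ r in Ioi (0 : ℝ),
        ENNReal.ofReal (ellipticIntegral α r) * f (2 * r) * ENNReal.ofReal r := by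
  have hm := measurable_pathGain α
  have hp := measurable_pairGain α
  have h1 : ∀ x : Plane, ∫⁻ y : Plane, ENNReal.ofReal (pathGain α ‖x‖) *
        ENNReal.ofReal (pathGain α ‖y‖) * f (dist x y)
      = ∫⁻ z : Plane, f ‖z‖ * (ENNReal.ofReal (pathGain α ‖x‖) *
        ENNReal.ofReal (pathGain α ‖x + z‖)) := by
    intro x
    rw [← lintegral_add_left_eq_self (fun y : Plane => ENNReal.ofReal (pathGain α ‖x‖) *
        ENNReal.ofReal (pathGain α ‖y‖) * f (dist x y)) x]
    refine lintegral_congr fun z => ?_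
    rw [dist_self_add_right, mul_comm]
  simp only [h1]
  -- With the difference z held fixed, the first point is integrated out, leaving a function of ‖z‖
  -- alone.
  rw [lintegral_lintegral_swap (by fun_prop)]
  have h2 : ∀ z : Plane, ∫⁻ x : Plane, f ‖z‖ * (ENNReal.ofReal (pathGain α ‖x‖) *
        ENNReal.ofReal (pathGain α ‖x + z‖)) = f ‖z‖ * pairGain α (‖z‖ / 2) := by
    intro z
    rw [lintegral_const_mul _ (by fun_prop), lintegral_pathGain_add]
  simp only [h2]
  -- The constant is 2π from the angle times 4 from s = 2r: the polar factor s and the differential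
  -- ds each give a 2.
  rw [lintegral_norm_plane (f := fun s => f s * pairGain α (s / 2)) (by fun_prop),
    lintegral_Ioi_comp_two_mul, show (8 : ℝ) * Real.pi = 2 * Real.pi * 4 by ring,
    ENNReal.ofReal_mul (p := 2 * Real.pi) (by positivity), mul_assoc]
  congr 1
  rw [← lintegral_const_mul' _ _ ENNReal.ofReal_ne_top]
  refine setLIntegral_congr_fun measurableSet_Ioi fun r hr => ?_
  have hr0 : 0 < r := hr
  rw [ellipticIntegral_eq hα hr0, ENNReal.ofReal_mul (by norm_num : (0 : ℝ) ≤ 2),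
    show 2 * r / 2 = r by ring, show (4 : ℝ) = 2 * 2 by norm_num,
    ENNReal.ofReal_mul (by norm_num : (0 : ℝ) ≤ 2)]
  norm_num
  ring

/-! ### Averages over the unit square -/

theorem lintegral_unif_prod {F : ℝ → ℝ → ℝ} (hF : Continuous (Function.uncurry F))
    (h0 : ∀ u ∈ Icc (0 : ℝ) 1, ∀ v ∈ Icc (0 : ℝ) 1, 0 ≤ F u v) :
    ∫⁻ z, ENNReal.ofReal (F z.1 z.2) ∂(unif.prod unif)
      = ENNReal.ofReal (∫ u in (0 : ℝ)..1, ∫ v in (0 : ℝ)..1, F u v) := by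
  have hint : Integrable (Function.uncurry F) (unif.prod unif) := by
    rw [unif, Measure.prod_restrict, ← Measure.volume_eq_prod]
    exact hF.continuousOn.integrableOn_compact (isCompact_Icc.prod isCompact_Icc)
  have hnn : 0 ≤ᵐ[unif.prod unif] Function.uncurry F := by
    filter_upwards [ae_unif_prod_mem] with z hz
    exact h0 z.1 hz.1 z.2 hz.2
  have h1 := ofReal_integral_eq_lintegral_ofReal hint hnn
  rw [integral_prod _ hint] at h1
  rw [show (∫⁻ z, ENNReal.ofReal (F z.1 z.2) ∂(unif.prod unif))
    = ∫⁻ z, ENNReal.ofReal (Function.uncurry F z) ∂(unif.prod unif) from rfl, ← h1]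
  congr 1
  rw [intervalIntegral.integral_of_le zero_le_one, ← integral_Icc_eq_integral_Ioc]
  refine integral_congr_ae (Eventually.of_forall fun u => ?_)
  simp only
  rw [intervalIntegral.integral_of_le zero_le_one, ← integral_Icc_eq_integral_Ioc]
  rfl

/-! ### The averaged retainment probabilities in closed form -/

theorem discArea_pos {d : ℝ} (hd : 0 < d) : 0 < discArea d := by
  unfold discArea; positivity

theorem lensArea_eq_integral {d r : ℝ} (hd : 0 < d) (hr : 0 ≤ r) (hrd : r ≤ 2 * d) :
    lensArea d r = 4 * ∫ t in (r / 2)..d, √(d ^ 2 - t ^ 2) := by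
  rw [lensArea, if_pos hrd, integral_sqrt_sub_sq hd (by linarith) (by linarith),
    show r / 2 / d = r / (2 * d) by field_simp,
    show 4 * d ^ 2 - r ^ 2 = 2 ^ 2 * (d ^ 2 - (r / 2) ^ 2) by ring,
    Real.sqrt_mul (by norm_num), Real.sqrt_sq (by norm_num)]
  ring

theorem lensArea_pos {d r : ℝ} (hd : 0 < d) (hr : 0 ≤ r) (hrd : r < 2 * d) : 0 < lensArea d r := by
  rw [lensArea_eq_integral hd hr hrd.le]
  refine mul_pos (by norm_num) (intervalIntegral.intervalIntegral_pos_of_pos_on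
    (Continuous.intervalIntegrable (by fun_prop) _ _) (fun t ht => Real.sqrt_pos.2 ?_)
    (by linarith))
  nlinarith [ht.1, ht.2]

theorem lensArea_of_le {d r : ℝ} (hd : 0 < d) (hrd : 2 * d ≤ r) : lensArea d r = 0 := by
  rcases hrd.eq_or_lt with h | h
  · rw [lensArea_eq_integral hd (by linarith) h.ge, show r / 2 = d by linarith,
      intervalIntegral.integral_same, mul_zero]
  · rw [lensArea, if_neg (not_le.2 h)]

theorem lensArea_nonneg {d r : ℝ} (hd : 0 < d) (hr : 0 ≤ r) : 0 ≤ lensArea d r := by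
  rcases lt_or_ge r (2 * d) with h | h
  · exact (lensArea_pos hd hr h).le
  · exact (lensArea_of_le hd h).ge

/-- Strictness comes from arccos < π/2 at a positive argument. It keeps c - g positive, hence the
arguments of Ei positive and the denominators nonzero. -/
theorem lensArea_lt_discArea {d r : ℝ} (hd : 0 < d) (hr : 0 < r) : lensArea d r < discArea d := by
  unfold lensArea
  split_ifs with h
  · have h1 : Real.arccos (r / (2 * d)) < Real.pi / 2 := by
      rw [Real.arccos_lt_pi_div_two]; positivity
    have h2 : 0 ≤ r / 2 * √(4 * d ^ 2 - r ^ 2) := by positivity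
    have h3 : 2 * d ^ 2 * Real.arccos (r / (2 * d)) < 2 * d ^ 2 * (Real.pi / 2) :=
      mul_lt_mul_of_pos_left h1 (by positivity)
    unfold discArea
    linarith
  · exact discArea_pos hd

theorem measurable_lensArea (d : ℝ) : Measurable (lensArea d) :=
  Measurable.ite (measurableSet_le measurable_id measurable_const)
    (by have := Real.continuous_arccos.measurable; fun_prop) measurable_const

theorem integral_square_nonneg {F : ℝ → ℝ → ℝ}
    (h0 : ∀ u ∈ Icc (0 : ℝ) 1, ∀ v ∈ Icc (0 : ℝ) 1, 0 ≤ F u v) :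
    0 ≤ ∫ u in (0 : ℝ)..1, ∫ v in (0 : ℝ)..1, F u v :=
  intervalIntegral.integral_nonneg zero_le_one fun u hu =>
    intervalIntegral.integral_nonneg zero_le_one fun v hv => h0 u hu v hv

/-- The survival probability of one of two points in a first and the other one in a second slot,
as an average over the two marks. -/
def pairIndepAverage (lam d r : ℝ) : ENNReal :=
  ∫⁻ z, ENNReal.ofReal (((1 - z.1) * (1 - z.2)) ^ (if r ≤ d then 1 else 0) * Real.exp (-(lam *
      ((discArea d - lensArea d r) * z.1 + (discArea d - lensArea d r) * z.2
        + lensArea d r * (1 - (1 - z.1) * (1 - z.2)))))) ∂(unif.prod unif)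

theorem measurable_pairIndepAverage (lam d : ℝ) : Measurable (pairIndepAverage lam d) := by
  have := measurable_lensArea d
  refine Measurable.lintegral_prod_right' (f := fun p : ℝ × (ℝ × ℝ) =>
    ENNReal.ofReal (((1 - p.2.1) * (1 - p.2.2)) ^ (if p.1 ≤ d then 1 else 0) * Real.exp (-(lam *
      ((discArea d - lensArea d p.1) * p.2.1 + (discArea d - lensArea d p.1) * p.2.2
        + lensArea d p.1 * (1 - (1 - p.2.1) * (1 - p.2.2))))))) ?_
  have h : Measurable fun p : ℝ × (ℝ × ℝ) => if p.1 ≤ d then 1 else 0 :=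
    Measurable.ite (measurableSet_le measurable_fst measurable_const) measurable_const
      measurable_const
  fun_prop

/-- Competition includes distance exactly `d`, whereas the closed form switches branch there; this
single radius is excluded and is negligible later. From 2d on the lens has area zero and the
integral factorises. -/
theorem pairIndep_integrals {lam d r : ℝ} (hlam : 0 < lam) (hd : 0 < d) (hr : 0 < r) (hrd : r ≠ d) :
    retainPairIndep lam d r = ∫ u in (0 : ℝ)..1, ∫ v in (0 : ℝ)..1,
      ((1 - u) * (1 - v)) ^ (if r ≤ d then 1 else 0) * Real.exp (-(lam *
      ((discArea d - lensArea d r) * u + (discArea d - lensArea d r) * v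
        + lensArea d r * (1 - (1 - u) * (1 - v))))) := by
  have hc := discArea_pos hd
  have hgc := lensArea_lt_discArea hd hr
  unfold retainPairIndep
  rcases lt_trichotomy r d with h | h | h
  · have hg := lensArea_pos hd hr.le (by linarith)
    simp only [if_pos h, if_pos h.le, pow_one]
    exact (integral_exp_pair_near hlam hg hgc).symm
  · exact absurd h hrd
  · simp only [if_neg h.not_gt, if_neg h.not_ge, pow_zero, one_mul]
    split_ifs with h2
    · exact (integral_exp_pair_far hlam (lensArea_pos hd hr.le h2) hgc).symm
    · simp only [lensArea_of_le hd (not_lt.1 h2), sub_zero, zero_mul, add_zero, mul_add, neg_add,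
        Real.exp_add, intervalIntegral.integral_const_mul, intervalIntegral.integral_mul_const]
      rw [retainOnce_eq_integral (by positivity), retainOnce, sq]

theorem retainPairIndep_nonneg {lam d r : ℝ} (hlam : 0 < lam) (hd : 0 < d) (hr : 0 < r)
    (hrd : r ≠ d) : 0 ≤ retainPairIndep lam d r := by
  rw [pairIndep_integrals hlam hd hr hrd]
  refine integral_square_nonneg fun u hu v hv => ?_
  exact mul_nonneg (pow_nonneg (mul_nonneg (sub_nonneg.2 hu.2) (sub_nonneg.2 hv.2)) _)
    (Real.exp_pos _).le

theorem pairIndepAverage_eq {lam d r : ℝ} (hlam : 0 < lam) (hd : 0 < d) (hr : 0 < r)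
    (hrd : r ≠ d) : pairIndepAverage lam d r = ENNReal.ofReal (retainPairIndep lam d r) := by
  rw [pairIndep_integrals hlam hd hr hrd]
  refine lintegral_unif_prod (F := fun u v => ((1 - u) * (1 - v)) ^ (if r ≤ d then 1 else 0) *
      Real.exp (-(lam * ((discArea d - lensArea d r) * u + (discArea d - lensArea d r) * v
        + lensArea d r * (1 - (1 - u) * (1 - v)))))) ?_ fun u hu v hv => ?_
  · unfold Function.uncurry
    fun_prop
  · exact mul_nonneg (pow_nonneg (mul_nonneg (sub_nonneg.2 hu.2) (sub_nonneg.2 hv.2)) _)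
      (Real.exp_pos _).le

theorem measurable_retainPairSame (lam d : ℝ) : Measurable (retainPairSame lam d) := by
  have := measurable_lensArea d
  unfold retainPairSame unionArea
  exact Measurable.ite (measurableSet_lt measurable_const measurable_id) (by fun_prop)
    measurable_const

theorem retainPairSame_eq_integral {lam d r : ℝ} (hlam : 0 < lam) (hd : 0 < d) (hr : d < r) :
    retainPairSame lam d r = ∫ u in (0 : ℝ)..1, ∫ v in (0 : ℝ)..1, Real.exp (-(lam *
      ((discArea d - lensArea d r) * u + (discArea d - lensArea d r) * v
        + lensArea d r * max u v))) := by
  rw [integral_exp_pair_same hlam (lensArea_nonneg hd (by linarith))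
    (lensArea_lt_discArea hd (by linarith)), retainPairSame, if_pos hr]
  rfl

theorem retainPairSame_nonneg {lam d : ℝ} (hlam : 0 < lam) (hd : 0 < d) (r : ℝ) :
    0 ≤ retainPairSame lam d r := by
  rcases lt_or_ge d r with h | h
  · rw [retainPairSame_eq_integral hlam hd h]
    exact integral_square_nonneg fun u _ v _ => (Real.exp_pos _).le
  · rw [retainPairSame, if_neg h.not_gt]

theorem retainOnce_pos {lam d : ℝ} (hlam : 0 < lam) (hd : 0 < d) : 0 < retainOnce lam d := by
  have hc := mul_pos hlam (discArea_pos hd)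
  unfold retainOnce
  refine div_pos (sub_pos.2 ?_) hc
  rw [Real.exp_lt_one_iff]
  linarith

theorem retainTwice_nonneg {lam d : ℝ} (hlam : 0 < lam) (hd : 0 < d) : 0 ≤ retainTwice lam d := by
  rw [retainTwice, ← integral_exp_retainTwice (mul_pos hlam (discArea_pos hd))]
  exact integral_square_nonneg fun u _ v _ => (Real.exp_pos _).le

section Average

variable {Ω : Type*} [MeasurableSpace Ω] {P : Measure Ω} [IsProbabilityMeasure P] {lam d : ℝ}
  {X : ℕ → Ω → Plane}

theorem toReal_volume_closedBall {d : ℝ} (hd : 0 < d) (x : Plane) :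
    (volume (Metric.closedBall x d)).toReal = discArea d := by
  rw [volume_closedBall_plane hd, ENNReal.toReal_ofReal (discArea_pos hd).le]

theorem toReal_volume_closedBall_inter {d : ℝ} (hd : 0 < d) (x y : Plane) :
    (volume (Metric.closedBall x d ∩ Metric.closedBall y d)).toReal = lensArea d (dist x y) := by
  rw [volume_closedBall_inter hd, ENNReal.toReal_ofReal (lensArea_nonneg hd dist_nonneg)]

theorem IsPoissonProcess.average_retainProb (hX : IsPoissonProcess lam X P) (hlam : 0 < lam)
    (hd : 0 < d) (x : Plane) :
    ∫⁻ ω, retainProb d x (pointMeasure X ω + Measure.dirac x) ∂P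
      = ENNReal.ofReal (retainOnce lam d) := by
  rw [hX.lintegral_retainProb hlam.le, toReal_volume_closedBall hd,
    lintegral_unif_prod (F := fun u _ => Real.exp (-(lam * (discArea d * u))))
      (by unfold Function.uncurry; fun_prop) (fun u _ v _ => (Real.exp_pos _).le)]
  simp only [intervalIntegral.integral_const, sub_zero, one_smul]
  rw [retainOnce_eq_integral (mul_pos hlam (discArea_pos hd)).ne', retainOnce]

theorem IsPoissonProcess.average_retainProbTwoSlots_self (hX : IsPoissonProcess lam X P)
    (hlam : 0 < lam) (hd : 0 < d) (x : Plane) :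
    ∫⁻ ω, retainProbTwoSlots d x x (pointMeasure X ω + Measure.dirac x) ∂P
      = ENNReal.ofReal (retainTwice lam d) := by
  rw [hX.lintegral_retainProbTwoSlots_self hlam.le, toReal_volume_closedBall hd,
    lintegral_unif_prod
      (F := fun u v => Real.exp (-(lam * (discArea d * (1 - (1 - u) * (1 - v))))))
      (by unfold Function.uncurry; fun_prop) (fun u _ v _ => (Real.exp_pos _).le)]
  simp only [← mul_assoc lam]
  rw [integral_exp_retainTwice (mul_pos hlam (discArea_pos hd)), retainTwice]

theorem IsPoissonProcess.average_retainProbTwoSlots (hX : IsPoissonProcess lam X P)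
    (hlam : 0 < lam) (hd : 0 < d) (x y : Plane) :
    ∫⁻ ω, retainProbTwoSlots d x y (pointMeasure X ω + Measure.dirac x + Measure.dirac y) ∂P
      = pairIndepAverage lam d (dist x y) := by
  rw [hX.lintegral_retainProbTwoSlots hlam.le hd.le x y rfl]
  simp only [toReal_volume_closedBall hd, toReal_volume_closedBall_inter hd]
  rfl

theorem IsPoissonProcess.average_retainProbPair (hX : IsPoissonProcess lam X P)
    (hlam : 0 < lam) (hd : 0 < d) (x y : Plane) :
    ∫⁻ ω, retainProbPair d x y (pointMeasure X ω + Measure.dirac x + Measure.dirac y) ∂P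
      = ENNReal.ofReal (retainPairSame lam d (dist x y)) := by
  rcases lt_or_ge d (dist x y) with h | h
  · rw [hX.lintegral_retainProbPair hlam.le hd.le h, retainPairSame_eq_integral hlam hd h]
    simp only [toReal_volume_closedBall hd, toReal_volume_closedBall_inter hd]
    exact lintegral_unif_prod (F := fun u v => Real.exp (-(lam *
      ((discArea d - lensArea d (dist x y)) * u + (discArea d - lensArea d (dist x y)) * v
        + lensArea d (dist x y) * max u v))))
      (by unfold Function.uncurry; fun_prop) (fun u _ v _ => (Real.exp_pos _).le)
  · simp only [retainProbPair, if_pos h, retainPairSame, if_neg h.not_gt, lintegral_zero,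
      ENNReal.ofReal_zero]

/-! ### Sums over points and pairs of points -/

/-- Needed because retainment depends on the mass of a disc whose centre varies with the
configuration: the kernel gives measurability in both jointly. -/
theorem measurable_configKernel_apply {Z : Type*} [MeasurableSpace Z] {h : Z → Measure Plane}
    (hh : Measurable h) {S : Set (Z × Plane)} (hS : MeasurableSet S) :
    Measurable fun z => configKernel (h z) {y | (z, y) ∈ S} :=
  Kernel.measurable_kernel_prodMk_left (κ := configKernel.comap h hh) hS

theorem measurable_markProb {Z : Type*} [MeasurableSpace Z] {a b c : Z → ℕ} (ha : Measurable a)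
    (hb : Measurable b) (hc : Measurable c) : Measurable fun z => markProb (a z) (b z) (c z) := by
  have h : Measurable fun p : ℕ × ℕ × ℕ => markProb p.1 p.2.1 p.2.2 := .of_discrete
  have h2 : Measurable fun z => (a z, b z, c z) := ha.prodMk (hb.prodMk hc)
  exact h.comp h2

theorem measurable_count_closedBall {Z : Type*} [MeasurableSpace Z] {h : Z → Measure Plane}
    (hh : Measurable h) {x : Z → Plane} (hx : Measurable x) (d : ℝ) :
    Measurable fun z => count (configKernel (h z) (Metric.closedBall (x z) d)) := by
  refine measurable_count.comp (measurable_configKernel_apply hh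
    (S := {p | dist p.2 (x p.1) ≤ d}) ?_)
  exact measurableSet_le (by fun_prop) measurable_const

theorem measurable_retainProb_configKernel (d : ℝ) :
    Measurable fun z : Plane × Measure Plane => retainProb d z.1 (configKernel z.2) := by
  have h := measurable_count_closedBall (Z := Plane × Measure Plane) measurable_snd measurable_fst d
  exact measurable_markProb (h.sub_const 1) measurable_const measurable_const

theorem measurable_retainProbTwoSlots_configKernel (d : ℝ) :
    Measurable fun z : Plane × Plane × Measure Plane =>
      retainProbTwoSlots d z.1 z.2.1 (configKernel z.2.2) := by
  have h1 := measurable_count_closedBall (Z := Plane × Plane × Measure Plane)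
    (measurable_snd.comp measurable_snd) measurable_fst d
  have h2 := measurable_count_closedBall (Z := Plane × Plane × Measure Plane)
    (measurable_snd.comp measurable_snd) (measurable_fst.comp measurable_snd) d
  exact measurable_markProb (h1.sub_const 1) (h2.sub_const 1) measurable_const

theorem measurable_retainProbPair_configKernel (d : ℝ) :
    Measurable fun z : Plane × Plane × Measure Plane =>
      retainProbPair d z.1 z.2.1 (configKernel z.2.2) := by
  have hφ : Measurable fun z : Plane × Plane × Measure Plane => z.2.2 := by fun_prop
  have b1 : MeasurableSet {p : (Plane × Plane × Measure Plane) × Plane | dist p.2 p.1.1 ≤ d} :=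
    measurableSet_le (by fun_prop) measurable_const
  have b2 : MeasurableSet {p : (Plane × Plane × Measure Plane) × Plane | dist p.2 p.1.2.1 ≤ d} :=
    measurableSet_le (by fun_prop) measurable_const
  have h1 := measurable_count.comp (measurable_configKernel_apply hφ (b1.diff b2))
  have h2 := measurable_count.comp (measurable_configKernel_apply hφ (b2.diff b1))
  have h3 := measurable_count.comp (measurable_configKernel_apply hφ (b1.inter b2))
  refine Measurable.ite (measurableSet_le (by fun_prop) measurable_const) measurable_const ?_
  exact measurable_markProb (h1.sub_const 1) (h2.sub_const 1) h3

variable {α : ℝ}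

/-- Campbell's formula with a weight. `K` is evaluated at `configKernel` of the configuration only
for measurability; almost surely nothing changes, before or after adding a point. -/
theorem IsPoissonProcess.lintegral_tsum_point (hX : IsPoissonProcess lam X P) (hlam : 0 < lam)
    {w : Plane → ENNReal} (hw : Measurable w) {K : Plane → Measure Plane → ENNReal}
    (hK : Measurable fun z : Plane × Measure Plane => K z.1 (configKernel z.2)) {q : ENNReal}
    (hq : ∀ x, ∫⁻ ω, K x (pointMeasure X ω + Measure.dirac x) ∂P = q) :
    ∫⁻ ω, ∑' n, w (X n ω) * K (X n ω) (pointMeasure X ω) ∂P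
      = ENNReal.ofReal lam * q * ∫⁻ x, w x := by
  have hΦ := hX.measurable_pointMeasure
  have h := hX.mecke hlam.le (G := fun z => w z.1 * K z.1 (configKernel z.2))
    (Measurable.mul (by fun_prop) hK)
  simp only at h
  have hadd := fun x : Plane => measurable_add_dirac.comp
    (measurable_const (a := x).prodMk (measurable_id (α := Measure Plane)))
  simp only [Function.comp_def, id] at hadd
  have h1 : ∀ x, ∫⁻ ω, w x * K x (configKernel (pointMeasure X ω + Measure.dirac x)) ∂P
      = w x * q := by
    intro x
    have hm : Measurable fun ω => K x (configKernel (pointMeasure X ω + Measure.dirac x)) :=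
      hK.comp (measurable_const.prodMk ((hadd x).comp hΦ))
    rw [lintegral_const_mul _ hm, ← hq x]
    congr 1
    refine lintegral_congr_ae ?_
    filter_upwards [hX.ae_locallyFinite] with ω hω
    rw [configKernel_apply (add_dirac_mem_locallyFinite hω x)]
  simp only [h1] at h
  rw [lintegral_mul_const _ hw, mul_comm _ q, ← mul_assoc] at h
  rw [← h]
  refine lintegral_congr_ae ?_
  filter_upwards [hX.ae_locallyFinite] with ω hω
  simp only [configKernel_apply hω]

theorem IsPoissonProcess.lintegral_tsum_retainProb (hX : IsPoissonProcess lam X P) (hlam : 0 < lam)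
    (hd : 0 < d) {w : Plane → ENNReal} (hw : Measurable w) :
    ∫⁻ ω, ∑' n, w (X n ω) * retainProb d (X n ω) (pointMeasure X ω) ∂P
      = ENNReal.ofReal (lam * retainOnce lam d) * ∫⁻ x, w x := by
  rw [hX.lintegral_tsum_point hlam hw (measurable_retainProb_configKernel d)
    (hX.average_retainProb hlam hd), ENNReal.ofReal_mul hlam.le]

/-- The diagonal of the Mecke equation for pairs gives the integral of the squared gain, the
off-diagonal part the radial integral with elliptic coordinates inside. -/
theorem IsPoissonProcess.lintegral_tsum_pair (hX : IsPoissonProcess lam X P) (hlam : 0 < lam)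
    (hα : 2 < α) {K : Plane → Plane → Measure Plane → ENNReal}
    (hK : Measurable fun z : Plane × Plane × Measure Plane => K z.1 z.2.1 (configKernel z.2.2))
    {q : ENNReal} {f : ℝ → ENNReal} (hf : Measurable f)
    (hq : ∀ x, ∫⁻ ω, K x x (pointMeasure X ω + Measure.dirac x) ∂P = q)
    (hKf : ∀ x y, ∫⁻ ω, K x y (pointMeasure X ω + Measure.dirac x + Measure.dirac y) ∂P
      = f (dist x y)) :
    ∫⁻ ω, ∑' n, ∑' k, ENNReal.ofReal (pathGain α ‖X n ω‖) * ENNReal.ofReal (pathGain α ‖X k ω‖) *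
        K (X n ω) (X k ω) (pointMeasure X ω) ∂P
      = ENNReal.ofReal lam * (ENNReal.ofReal (α * Real.pi / (α - 1)) * q)
        + ENNReal.ofReal lam ^ 2 * (ENNReal.ofReal (8 * Real.pi) * ∫⁻ r in Ioi (0 : ℝ),
          ENNReal.ofReal (ellipticIntegral α r) * f (2 * r) * ENNReal.ofReal r) := by
  have hp := measurable_pathGain α
  have hΦ := hX.measurable_pointMeasure
  have h := hX.mecke_pair hlam.le (G := fun z => ENNReal.ofReal (pathGain α ‖z.1‖) *
    ENNReal.ofReal (pathGain α ‖z.2.1‖) * K z.1 z.2.1 (configKernel z.2.2)) (Measurable.mul (by fun_prop) hK)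
  simp only at h
  have hadd := fun x : Plane => measurable_add_dirac.comp
    (measurable_const (a := x).prodMk (measurable_id (α := Measure Plane)))
  simp only [Function.comp_def, id] at hadd
  have h1 : ∀ x : Plane, ∫⁻ ω, ENNReal.ofReal (pathGain α ‖x‖) * ENNReal.ofReal (pathGain α ‖x‖) *
      K x x (configKernel (pointMeasure X ω + Measure.dirac x)) ∂P
      = ENNReal.ofReal (pathGain α ‖x‖) ^ 2 * q := by
    intro x
    have hm : Measurable fun ω => K x x (configKernel (pointMeasure X ω + Measure.dirac x)) :=
      hK.comp (measurable_const.prodMk (measurable_const.prodMk ((hadd x).comp hΦ)))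
    rw [lintegral_const_mul _ hm, ← sq, ← hq x]
    congr 1
    refine lintegral_congr_ae ?_
    filter_upwards [hX.ae_locallyFinite] with ω hω
    rw [configKernel_apply (add_dirac_mem_locallyFinite hω x)]
  have h2 : ∀ x y : Plane, ∫⁻ ω, ENNReal.ofReal (pathGain α ‖x‖) *
      ENNReal.ofReal (pathGain α ‖y‖) *
      K x y (configKernel (pointMeasure X ω + Measure.dirac x + Measure.dirac y)) ∂P
      = ENNReal.ofReal (pathGain α ‖x‖) * ENNReal.ofReal (pathGain α ‖y‖) * f (dist x y) := by
    intro x y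
    have hm : Measurable fun ω =>
        K x y (configKernel (pointMeasure X ω + Measure.dirac x + Measure.dirac y)) :=
      hK.comp (measurable_const.prodMk (measurable_const.prodMk
        ((hadd y).comp ((hadd x).comp hΦ))))
    rw [lintegral_const_mul _ hm, ← hKf x y]
    congr 1
    refine lintegral_congr_ae ?_
    filter_upwards [hX.ae_locallyFinite] with ω hω
    rw [configKernel_apply (add_dirac_mem_locallyFinite (add_dirac_mem_locallyFinite hω x) y)]
  simp only [h1, h2] at h
  rw [lintegral_mul_const _ (by fun_prop), lintegral_pathGain_sq hα, lintegral_pair hα hf] at h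
  rw [← h]
  refine lintegral_congr_ae ?_
  filter_upwards [hX.ae_locallyFinite] with ω hω
  simp only [configKernel_apply hω]

end Average

/-! ### Moments of the fading coefficients -/

/-- Size biasing a gamma law raises its shape by one, by Γ(a+1) = aΓ(a). Iterating it yields the
moments without further integration. -/
theorem mul_gammaPDF {a r : ℝ} (ha : 0 < a) (hr : 0 < r) (x : ℝ) :
    ENNReal.ofReal x * gammaPDF a r x = ENNReal.ofReal (a / r) * gammaPDF (a + 1) r x := by
  rcases lt_trichotomy x 0 with hx | hx | hx
  · simp [gammaPDF_of_neg hx]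
  · subst hx
    simp [gammaPDF, gammaPDFReal, Real.zero_rpow ha.ne']
  · rw [gammaPDF_of_nonneg hx.le, gammaPDF_of_nonneg hx.le, ← ENNReal.ofReal_mul hx.le,
      ← ENNReal.ofReal_mul (by positivity)]
    congr 1
    rw [Real.Gamma_add_one ha.ne', Real.rpow_add_one hr.ne', add_sub_cancel_right,
      Real.rpow_sub_one hx.ne']
    have := (Real.Gamma_pos_of_pos ha).ne'
    field_simp

theorem lintegral_gammaMeasure {a r : ℝ} (ha : 0 < a) (hr : 0 < r) :
    ∫⁻ x, ENNReal.ofReal x ∂(gammaMeasure a r) = ENNReal.ofReal (a / r) := by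
  have hg : Measurable (gammaPDF a r) := (measurable_gammaPDFReal a r).ennreal_ofReal
  rw [gammaMeasure, lintegral_withDensity_eq_lintegral_mul _ hg (by fun_prop)]
  simp only [Pi.mul_apply, mul_comm (gammaPDF a r _), mul_gammaPDF ha hr]
  rw [lintegral_const_mul' _ _ ENNReal.ofReal_ne_top, lintegral_gammaPDF_eq_one (by linarith) hr,
    mul_one]

theorem lintegral_sq_gammaMeasure {a r : ℝ} (ha : 0 < a) (hr : 0 < r) :
    ∫⁻ x, ENNReal.ofReal x * ENNReal.ofReal x ∂(gammaMeasure a r)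
      = ENNReal.ofReal (a / r * ((a + 1) / r)) := by
  have hg : Measurable (gammaPDF a r) := (measurable_gammaPDFReal a r).ennreal_ofReal
  rw [gammaMeasure, lintegral_withDensity_eq_lintegral_mul _ hg (by fun_prop)]
  have h : ∀ x, gammaPDF a r x * (ENNReal.ofReal x * ENNReal.ofReal x)
      = ENNReal.ofReal (a / r * ((a + 1) / r)) * gammaPDF (a + 1 + 1) r x := by
    intro x
    rw [mul_comm, mul_assoc, mul_gammaPDF ha hr, mul_left_comm, mul_gammaPDF (by linarith) hr,
      ← mul_assoc, ← ENNReal.ofReal_mul (by positivity)]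
  simp only [Pi.mul_apply, h]
  rw [lintegral_const_mul' _ _ ENNReal.ofReal_ne_top, lintegral_gammaPDF_eq_one (by linarith) hr,
    mul_one]

section Network

variable {Ω : Type*} [MeasurableSpace Ω] {P : Measure Ω} {lam m d α : ℝ}
  {X : ℕ → Ω → Plane} {U H : ℤ → ℕ → Ω → ℝ}

theorem IsNetwork.ae_fading_nonneg (hN : IsNetwork lam m X U H P) :
    ∀ᵐ ω ∂P, ∀ t n, 0 ≤ H t n ω := by
  rw [ae_all_iff]; intro t
  rw [ae_all_iff]; intro n
  refine (hN.fading_law t n).ae_iff (p := fun x : ℝ => 0 ≤ x) (measurableSet_Ici (a := (0 : ℝ))).mem |>.2 ?_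
  have hg : Measurable (gammaPDF m m) := (measurable_gammaPDFReal m m).ennreal_ofReal
  rw [gammaMeasure, ae_withDensity_iff hg]
  refine Eventually.of_forall fun x hx => ?_
  by_contra h
  exact hx (gammaPDF_of_neg (not_le.1 h))

theorem IsNetwork.lintegral_fading (hN : IsNetwork lam m X U H P) (hm : 0 < m) (t : ℤ) (n : ℕ) :
    ∫⁻ ω, ENNReal.ofReal (H t n ω) ∂P = 1 := by
  rw [(hN.fading_law t n).lintegral_comp (f := fun x => ENNReal.ofReal x) (by fun_prop),
    lintegral_gammaMeasure hm hm, div_self hm.ne', ENNReal.ofReal_one]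

theorem IsNetwork.lintegral_fading_sq (hN : IsNetwork lam m X U H P) (hm : 0 < m) (t : ℤ) (n : ℕ) :
    ∫⁻ ω, ENNReal.ofReal (H t n ω) * ENNReal.ofReal (H t n ω) ∂P
      = ENNReal.ofReal ((m + 1) / m) := by
  rw [(hN.fading_law t n).lintegral_comp (f := fun x => ENNReal.ofReal x * ENNReal.ofReal x)
    (by fun_prop), lintegral_sq_gammaMeasure hm hm, div_self hm.ne', one_mul]

theorem IsNetwork.lintegral_fading_mul [IsProbabilityMeasure P] (hN : IsNetwork lam m X U H P) (hm : 0 < m)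
    {p q : ℤ × ℕ} (hpq : p ≠ q) :
    ∫⁻ ω, ENNReal.ofReal (H p.1 p.2 ω) * ENNReal.ofReal (H q.1 q.2 ω) ∂P = 1 := by
  have h1 := hN.fading_measurable p.1 p.2
  have h2 := hN.fading_measurable q.1 q.2
  have h := lintegral_comp_prodMk_of_indepFun (hN.fading_indep.indepFun hpq) h1.aemeasurable
    h2.aemeasurable (F := fun z => ENNReal.ofReal z.1 * ENNReal.ofReal z.2) (by fun_prop)
  simp only at h
  rw [h]
  simp only [lintegral_const_mul' _ _ ENNReal.ofReal_ne_top, hN.lintegral_fading hm, mul_one]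

/-! ### Separating locations, marks and fading -/

theorem measurableSet_retainedAt (d : ℝ) (t : ℤ) (n : ℕ) :
    MeasurableSet {z : (ℕ → Plane) × (ℤ × ℕ → ℝ) | RetainedAt d z.1 z.2 t n} := by
  have : {z : (ℕ → Plane) × (ℤ × ℕ → ℝ) | RetainedAt d z.1 z.2 t n}
      = ⋂ k : ℕ, {z | k ≠ n → dist (z.1 n) (z.1 k) ≤ d → z.2 (t, n) < z.2 (t, k)} := by
    ext z; simp [RetainedAt]
  rw [this]
  refine MeasurableSet.iInter fun k => ?_
  refine MeasurableSet.imp (MeasurableSet.const _) (MeasurableSet.imp ?_ ?_)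
  · exact measurableSet_le (by fun_prop) measurable_const
  · exact measurableSet_lt (by fun_prop) (by fun_prop)

/-- Locations are split off first, then fading from marks. The product form lets fading be averaged
alone and leaves the marks to be averaged for frozen locations. -/
theorem IsNetwork.lintegral_separate [IsProbabilityMeasure P] (hN : IsNetwork lam m X U H P)
    {F : (ℕ → Plane) × (ℤ × ℕ → ℝ) → ENNReal} (hF : Measurable F)
    {G : (ℤ × ℕ → ℝ) → ENNReal} (hG : Measurable G) :
    ∫⁻ ω, G (fun p => H p.1 p.2 ω) * F (fun n => X n ω, fun p => U p.1 p.2 ω) ∂P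
      = (∫⁻ ω, G (fun p => H p.1 p.2 ω) ∂P) *
        ∫⁻ ω', ∫⁻ ω, F (fun n => X n ω', fun p => U p.1 p.2 ω) ∂P ∂P := by
  have hXm : Measurable fun ω n => X n ω := measurable_pi_lambda _ hN.poisson.measurable
  have hUm : Measurable fun ω (p : ℤ × ℕ) => U p.1 p.2 ω :=
    measurable_pi_lambda _ fun p => hN.mark_measurable p.1 p.2
  have hHm : Measurable fun ω (p : ℤ × ℕ) => H p.1 p.2 ω :=
    measurable_pi_lambda _ fun p => hN.fading_measurable p.1 p.2
  have hGH : Measurable fun ω => G fun p => H p.1 p.2 ω := hG.comp hHm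
  have hFXU : Measurable fun z : Ω × Ω => F (fun n => X n z.1, fun p => U p.1 p.2 z.2) :=
    hF.comp ((hXm.comp measurable_fst).prodMk (hUm.comp measurable_snd))
  have e1 := lintegral_comp_prodMk_of_indepFun hN.location_indep hXm.aemeasurable
    (hUm.prodMk hHm).aemeasurable (F := fun z => G z.2.2 * F (z.1, z.2.1)) (by fun_prop)
  simp only at e1
  rw [e1, ← lintegral_const_mul _ (hFXU.lintegral_prod_right')]
  refine lintegral_congr fun ω' => ?_
  have e2 := lintegral_comp_prodMk_of_indepFun hN.mark_fading_indep hUm.aemeasurable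
    hHm.aemeasurable (F := fun z => G z.2 * F (fun n => X n ω', z.1)) (by fun_prop)
  simp only at e2
  have hFU : Measurable fun ω => F (fun n => X n ω', fun p => U p.1 p.2 ω) :=
    hFXU.comp measurable_prodMk_left
  rw [e2, ← lintegral_const_mul _ hFU]
  refine lintegral_congr fun ω => ?_
  rw [lintegral_mul_const _ hGH]

end Network

/-! ### Received power without fading -/

/-- The power received from the `n`-th sender in slot `t`, up to the fading coefficient, as a
function of the locations and the marks. -/
def senderGain (d α : ℝ) (t : ℤ) (n : ℕ) : (ℕ → Plane) × (ℤ × ℕ → ℝ) → ENNReal :=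
  {z | RetainedAt d z.1 z.2 t n}.indicator fun z => ENNReal.ofReal (pathGain α ‖z.1 n‖)

theorem measurable_senderGain (d α : ℝ) (t : ℤ) (n : ℕ) : Measurable (senderGain d α t n) := by
  have := measurable_pathGain α
  exact Measurable.indicator (by fun_prop) (measurableSet_retainedAt d t n)

theorem senderGain_mul (d α : ℝ) (t s : ℤ) (n k : ℕ) (z : (ℕ → Plane) × (ℤ × ℕ → ℝ)) :
    senderGain d α t n z * senderGain d α s k z
      = ({z | RetainedAt d z.1 z.2 t n} ∩ {z | RetainedAt d z.1 z.2 s k}).indicator (fun z =>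
        ENNReal.ofReal (pathGain α ‖z.1 n‖) * ENNReal.ofReal (pathGain α ‖z.1 k‖)) z := by
  rw [Set.inter_indicator_mul]
  rfl

theorem lintegral_indicator_section {Ω A B : Type*} [MeasurableSpace Ω] [MeasurableSpace A]
    [MeasurableSpace B] (P : Measure Ω) {S : Set (A × B)} (hS : MeasurableSet S) {u : Ω → B}
    (hu : Measurable u) (f : A → ENNReal) (x : A) :
    ∫⁻ ω, S.indicator (fun z => f z.1) (x, u ω) ∂P = f x * P {ω | (x, u ω) ∈ S} := by
  have h : MeasurableSet {ω | (x, u ω) ∈ S} := (measurable_const.prodMk hu) hS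
  rw [← lintegral_indicator_const h]
  rfl

section Network

variable {Ω : Type*} [MeasurableSpace Ω] {P : Measure Ω} {lam m d α : ℝ}
  {X : ℕ → Ω → Plane} {U H : ℤ → ℕ → Ω → ℝ}

theorem IsNetwork.measurable_marks (hN : IsNetwork lam m X U H P) :
    Measurable fun ω (p : ℤ × ℕ) => U p.1 p.2 ω :=
  measurable_pi_lambda _ fun p => hN.mark_measurable p.1 p.2

theorem IsNetwork.lintegral_senderGain [IsProbabilityMeasure P]
    (hN : IsNetwork lam m X U H P) (hd : 0 < d) (t : ℤ) (n : ℕ) :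
    ∫⁻ ω', ∫⁻ ω, senderGain d α t n (fun n => X n ω', fun p => U p.1 p.2 ω) ∂P ∂P
      = ∫⁻ ω, ENNReal.ofReal (pathGain α ‖X n ω‖) *
        retainProb d (X n ω) (pointMeasure X ω) ∂P := by
  refine lintegral_congr_ae ?_
  filter_upwards [hN.poisson.ae_locallyFinite] with ω' hω'
  rw [← prob_retainedAt hN.mark_measurable hN.mark_law hN.mark_indep hd.le hω' t n]
  exact lintegral_indicator_section P (measurableSet_retainedAt d t n) hN.measurable_marks
    (fun x => ENNReal.ofReal (pathGain α ‖x n‖)) _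

theorem IsNetwork.lintegral_senderGain_mul [IsProbabilityMeasure P] (hN : IsNetwork lam m X U H P) (hd : 0 < d)
    {t s : ℤ} (hts : t ≠ s) (n k : ℕ) :
    ∫⁻ ω', ∫⁻ ω, senderGain d α t n (fun n => X n ω', fun p => U p.1 p.2 ω) *
        senderGain d α s k (fun n => X n ω', fun p => U p.1 p.2 ω) ∂P ∂P
      = ∫⁻ ω, ENNReal.ofReal (pathGain α ‖X n ω‖) * ENNReal.ofReal (pathGain α ‖X k ω‖) *
        retainProbTwoSlots d (X n ω) (X k ω) (pointMeasure X ω) ∂P := by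
  refine lintegral_congr_ae ?_
  filter_upwards [hN.poisson.ae_locallyFinite] with ω' hω'
  rw [← prob_retainedAt_two_slots hN.mark_measurable hN.mark_law hN.mark_indep hd.le hω' hts n k]
  simp only [senderGain_mul]
  exact lintegral_indicator_section P
    ((measurableSet_retainedAt d t n).inter (measurableSet_retainedAt d s k)) hN.measurable_marks
    (fun x => ENNReal.ofReal (pathGain α ‖x n‖) * ENNReal.ofReal (pathGain α ‖x k‖)) _

theorem IsNetwork.lintegral_senderGain_pair [IsProbabilityMeasure P]
    (hN : IsNetwork lam m X U H P) (hd : 0 < d) (t : ℤ)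
    {n k : ℕ} (hnk : n ≠ k) :
    ∫⁻ ω', ∫⁻ ω, senderGain d α t n (fun n => X n ω', fun p => U p.1 p.2 ω) *
        senderGain d α t k (fun n => X n ω', fun p => U p.1 p.2 ω) ∂P ∂P
      = ∫⁻ ω, ENNReal.ofReal (pathGain α ‖X n ω‖) * ENNReal.ofReal (pathGain α ‖X k ω‖) *
        retainProbPair d (X n ω) (X k ω) (pointMeasure X ω) ∂P := by
  refine lintegral_congr_ae ?_
  filter_upwards [hN.poisson.ae_locallyFinite] with ω' hω'
  rw [← prob_retainedAt_pair hN.mark_measurable hN.mark_law hN.mark_indep hd.le hω' t hnk]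
  simp only [senderGain_mul]
  exact lintegral_indicator_section P
    ((measurableSet_retainedAt d t n).inter (measurableSet_retainedAt d t k)) hN.measurable_marks
    (fun x => ENNReal.ofReal (pathGain α ‖x n‖) * ENNReal.ofReal (pathGain α ‖x k‖)) _

theorem IsNetwork.lintegral_senderGain_sq [IsProbabilityMeasure P]
    (hN : IsNetwork lam m X U H P) (hd : 0 < d) (t : ℤ)
    (n : ℕ) :
    ∫⁻ ω', ∫⁻ ω, senderGain d α t n (fun n => X n ω', fun p => U p.1 p.2 ω) *
        senderGain d α t n (fun n => X n ω', fun p => U p.1 p.2 ω) ∂P ∂P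
      = ∫⁻ ω, ENNReal.ofReal (pathGain α ‖X n ω‖) ^ 2 *
        retainProb d (X n ω) (pointMeasure X ω) ∂P := by
  refine lintegral_congr_ae ?_
  filter_upwards [hN.poisson.ae_locallyFinite] with ω' hω'
  rw [← prob_retainedAt hN.mark_measurable hN.mark_law hN.mark_indep hd.le hω' t n]
  simp only [senderGain_mul, inter_self]
  simp only [← sq]
  exact lintegral_indicator_section P (measurableSet_retainedAt d t n) hN.measurable_marks
    (fun x => ENNReal.ofReal (pathGain α ‖x n‖) ^ 2) _

/-! ### Moments of the interference as an extended nonnegative number -/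

/-- The sum over all senders of the product of a fading coefficient and the sender gain. -/
def totalPower (d α : ℝ) (X : ℕ → Ω → Plane) (U H : ℤ → ℕ → Ω → ℝ) (t : ℤ) (ω : Ω) : ENNReal :=
  ∑' n, ENNReal.ofReal (H t n ω) * senderGain d α t n (fun n => X n ω, fun p => U p.1 p.2 ω)

theorem IsNetwork.measurable_senderGain_comp (hN : IsNetwork lam m X U H P) (d α : ℝ) (t : ℤ)
    (n : ℕ) : Measurable fun ω => senderGain d α t n (fun n => X n ω, fun p => U p.1 p.2 ω) :=
  (measurable_senderGain d α t n).comp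
    ((measurable_pi_lambda _ hN.poisson.measurable).prodMk hN.measurable_marks)

theorem IsNetwork.measurable_power (hN : IsNetwork lam m X U H P) (d α : ℝ) (t : ℤ) (n : ℕ) :
    Measurable fun ω => ENNReal.ofReal (H t n ω) *
      senderGain d α t n (fun n => X n ω, fun p => U p.1 p.2 ω) :=
  (hN.fading_measurable t n).ennreal_ofReal.mul (hN.measurable_senderGain_comp d α t n)

theorem IsNetwork.measurable_totalPower (hN : IsNetwork lam m X U H P) (d α : ℝ) (t : ℤ) :
    Measurable (totalPower d α X U H t) :=
  Measurable.tsum fun n => hN.measurable_power d α t n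

theorem IsNetwork.lintegral_power_mul [IsProbabilityMeasure P]
    (hN : IsNetwork lam m X U H P) (t s : ℤ) (n k : ℕ) :
    ∫⁻ ω, (ENNReal.ofReal (H t n ω) * senderGain d α t n (fun n => X n ω, fun p => U p.1 p.2 ω)) *
        (ENNReal.ofReal (H s k ω) * senderGain d α s k (fun n => X n ω, fun p => U p.1 p.2 ω)) ∂P
      = (∫⁻ ω, ENNReal.ofReal (H t n ω) * ENNReal.ofReal (H s k ω) ∂P) *
        ∫⁻ ω', ∫⁻ ω, senderGain d α t n (fun n => X n ω', fun p => U p.1 p.2 ω) *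
          senderGain d α s k (fun n => X n ω', fun p => U p.1 p.2 ω) ∂P ∂P := by
  have h := hN.lintegral_separate
    (F := fun z => senderGain d α t n z * senderGain d α s k z)
    ((measurable_senderGain d α t n).mul (measurable_senderGain d α s k))
    (G := fun h => ENNReal.ofReal (h (t, n)) * ENNReal.ofReal (h (s, k))) (by fun_prop)
  simp only at h
  rw [← h]
  exact lintegral_congr fun ω => mul_mul_mul_comm _ _ _ _

theorem lintegral_tsum_tsum {f : ℕ → ℕ → Ω → ENNReal} (hf : ∀ n k, AEMeasurable (f n k) P) :
    ∫⁻ ω, ∑' n, ∑' k, f n k ω ∂P = ∑' n, ∑' k, ∫⁻ ω, f n k ω ∂P := by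
  rw [lintegral_tsum fun n => AEMeasurable.tsum fun k => hf n k]
  exact tsum_congr fun n => lintegral_tsum fun k => hf n k

theorem lintegral_tsum_mul_tsum {f g : ℕ → Ω → ENNReal} (hf : ∀ n, Measurable (f n))
    (hg : ∀ n, Measurable (g n)) :
    ∫⁻ ω, (∑' n, f n ω) * ∑' k, g k ω ∂P = ∑' n, ∑' k, ∫⁻ ω, f n ω * g k ω ∂P := by
  have hfg : ∀ n k, AEMeasurable (fun ω => f n ω * g k ω) P := fun n k =>
    ((hf n).mul (hg k)).aemeasurable
  rw [← lintegral_tsum_tsum hfg]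
  simp only [← ENNReal.tsum_mul_left, ← ENNReal.tsum_mul_right]
  exact lintegral_congr fun ω => ENNReal.tsum_comm

/-- As `b` vanishes on the diagonal, its sum may run over all pairs, which is the form the Mecke
equation for pairs requires. -/
theorem tsum_tsum_ite_diag {a : ℕ → ENNReal} {b : ℕ → ℕ → ENNReal} (hb : ∀ n, b n n = 0) :
    ∑' n, ∑' k, (if n = k then a n else b n k) = ∑' n, a n + ∑' n, ∑' k, b n k := by
  rw [← ENNReal.tsum_add]
  refine tsum_congr fun n => ?_
  rw [← tsum_ite_eq n fun _ => a n, ← ENNReal.tsum_add]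
  refine tsum_congr fun k => ?_
  rcases eq_or_ne n k with rfl | h
  · simp [hb]
  · simp [h, h.symm]

theorem IsPoissonProcess.aemeasurable_mul_point [IsProbabilityMeasure P]
    (hX : IsPoissonProcess lam X P) {w : Plane → ENNReal} (hw : Measurable w)
    {K : Plane → Measure Plane → ENNReal}
    (hK : Measurable fun z : Plane × Measure Plane => K z.1 (configKernel z.2)) (n : ℕ) :
    AEMeasurable (fun ω => w (X n ω) * K (X n ω) (pointMeasure X ω)) P := by
  have hm : Measurable fun ω => K (X n ω) (configKernel (pointMeasure X ω)) :=
    hK.comp ((hX.measurable n).prodMk hX.measurable_pointMeasure)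
  refine ⟨fun ω => w (X n ω) * K (X n ω) (configKernel (pointMeasure X ω)),
    (hw.comp (hX.measurable n)).mul hm, ?_⟩
  filter_upwards [hX.ae_locallyFinite] with ω hω
  rw [configKernel_apply hω]

theorem IsPoissonProcess.aemeasurable_mul_retainProb [IsProbabilityMeasure P]
    (hX : IsPoissonProcess lam X P) (d : ℝ) {w : Plane → ENNReal} (hw : Measurable w) (n : ℕ) :
    AEMeasurable (fun ω => w (X n ω) * retainProb d (X n ω) (pointMeasure X ω)) P :=
  hX.aemeasurable_mul_point hw (measurable_retainProb_configKernel d) n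

theorem IsPoissonProcess.aemeasurable_gain_pair [IsProbabilityMeasure P]
    (hX : IsPoissonProcess lam X P) (α : ℝ) {K : Plane → Plane → Measure Plane → ENNReal}
    (hK : Measurable fun z : Plane × Plane × Measure Plane => K z.1 z.2.1 (configKernel z.2.2))
    (n k : ℕ) :
    AEMeasurable (fun ω => ENNReal.ofReal (pathGain α ‖X n ω‖) *
      ENNReal.ofReal (pathGain α ‖X k ω‖) * K (X n ω) (X k ω) (pointMeasure X ω)) P := by
  have h1 := measurable_pathGain α
  have h2 := hX.measurable n
  have h3 := hX.measurable k
  have hm : Measurable fun ω => K (X n ω) (X k ω) (configKernel (pointMeasure X ω)) :=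
    hK.comp (h2.prodMk (h3.prodMk hX.measurable_pointMeasure))
  refine ⟨fun ω => ENNReal.ofReal (pathGain α ‖X n ω‖) * ENNReal.ofReal (pathGain α ‖X k ω‖) *
    K (X n ω) (X k ω) (configKernel (pointMeasure X ω)), Measurable.mul (by fun_prop) hm, ?_⟩
  filter_upwards [hX.ae_locallyFinite] with ω hω
  rw [configKernel_apply hω]

/-- The contribution of pairs of distinct senders to the product of two interferences, for a
retainment probability `f` at distance `r`. -/
def pairTerm (lam α : ℝ) (f : ℝ → ENNReal) : ENNReal :=
  ENNReal.ofReal lam ^ 2 * (ENNReal.ofReal (8 * Real.pi) * ∫⁻ r in Ioi (0 : ℝ),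
    ENNReal.ofReal (ellipticIntegral α r) * f (2 * r) * ENNReal.ofReal r)

variable [IsProbabilityMeasure P]

theorem IsNetwork.tsum_lintegral_gain_sq (hN : IsNetwork lam m X U H P) (hlam : 0 < lam)
    (hd : 0 < d) (hα : 2 < α) :
    ∑' n, ∫⁻ ω, ENNReal.ofReal (pathGain α ‖X n ω‖) ^ 2 *
        retainProb d (X n ω) (pointMeasure X ω) ∂P
      = ENNReal.ofReal (senderIntensity lam d * (α * Real.pi / (α - 1))) := by
  have h1 := measurable_pathGain α
  rw [← lintegral_tsum (hN.poisson.aemeasurable_mul_retainProb d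
    (w := fun x => ENNReal.ofReal (pathGain α ‖x‖) ^ 2) (by fun_prop))]
  have h := hN.poisson.lintegral_tsum_retainProb hlam hd
    (w := fun x => ENNReal.ofReal (pathGain α ‖x‖) ^ 2) (by fun_prop)
  refine h.trans ?_
  rw [lintegral_pathGain_sq hα, ← ENNReal.ofReal_mul (mul_pos hlam (retainOnce_pos hlam hd)).le]
  rfl

theorem IsNetwork.tsum_lintegral_gain_pair (hN : IsNetwork lam m X U H P) (hlam : 0 < lam)
    (hd : 0 < d) (hα : 2 < α) :
    ∑' n, ∑' k, ∫⁻ ω, ENNReal.ofReal (pathGain α ‖X n ω‖) * ENNReal.ofReal (pathGain α ‖X k ω‖) *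
        retainProbPair d (X n ω) (X k ω) (pointMeasure X ω) ∂P
      = pairTerm lam α fun r => ENNReal.ofReal (retainPairSame lam d r) := by
  have hs := measurable_retainPairSame lam d
  rw [← lintegral_tsum_tsum (hN.poisson.aemeasurable_gain_pair α
      (measurable_retainProbPair_configKernel d)),
    hN.poisson.lintegral_tsum_pair hlam hα (measurable_retainProbPair_configKernel d)
      (q := 0) (f := fun r => ENNReal.ofReal (retainPairSame lam d r)) (by fun_prop) ?_
      (hN.poisson.average_retainProbPair hlam hd), mul_zero, mul_zero, zero_add]
  · rfl
  · intro x
    simp [retainProbPair, hd.le]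

theorem IsNetwork.lintegral_totalPower (hN : IsNetwork lam m X U H P) (hlam : 0 < lam)
    (hd : 0 < d) (hα : 2 < α) (hm : 0 < m) (t : ℤ) :
    ∫⁻ ω, totalPower d α X U H t ω ∂P
      = ENNReal.ofReal (senderIntensity lam d * (α * Real.pi / (α - 2))) := by
  have h1 := measurable_pathGain α
  unfold totalPower
  rw [lintegral_tsum fun n => (hN.measurable_power d α t n).aemeasurable]
  have e : ∀ n, ∫⁻ ω, ENNReal.ofReal (H t n ω) *
      senderGain d α t n (fun n => X n ω, fun p => U p.1 p.2 ω) ∂P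
      = ∫⁻ ω, ENNReal.ofReal (pathGain α ‖X n ω‖) *
        retainProb d (X n ω) (pointMeasure X ω) ∂P := by
    intro n
    have h := hN.lintegral_separate (measurable_senderGain d α t n)
      (G := fun h => ENNReal.ofReal (h (t, n))) (by fun_prop)
    simp only at h
    rw [h, hN.lintegral_fading hm, one_mul, hN.lintegral_senderGain hd]
  simp only [e]
  rw [← lintegral_tsum (hN.poisson.aemeasurable_mul_retainProb d
    (w := fun x => ENNReal.ofReal (pathGain α ‖x‖)) (by fun_prop))]
  have h := hN.poisson.lintegral_tsum_retainProb hlam hd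
    (w := fun x => ENNReal.ofReal (pathGain α ‖x‖)) (by fun_prop)
  refine h.trans ?_
  rw [lintegral_pathGain hα, ← ENNReal.ofReal_mul (mul_pos hlam (retainOnce_pos hlam hd)).le]
  rfl

/-- In different slots two fading coefficients are always independent, even at the same point. Their
factor is 1 throughout, so no diagonal has to be separated beforehand. -/
theorem IsNetwork.lintegral_totalPower_mul (hN : IsNetwork lam m X U H P) (hlam : 0 < lam)
    (hd : 0 < d) (hα : 2 < α) (hm : 0 < m) {t s : ℤ} (hts : t ≠ s) :
    ∫⁻ ω, totalPower d α X U H t ω * totalPower d α X U H s ω ∂P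
      = ENNReal.ofReal (lam * retainTwice lam d * (α * Real.pi / (α - 1)))
        + pairTerm lam α (pairIndepAverage lam d) := by
  unfold totalPower
  rw [lintegral_tsum_mul_tsum (hN.measurable_power d α t) (hN.measurable_power d α s)]
  have e : ∀ n k, (∫⁻ ω, ENNReal.ofReal (H t n ω) * ENNReal.ofReal (H s k ω) ∂P) = 1 :=
    fun n k => hN.lintegral_fading_mul hm (p := (t, n)) (q := (s, k)) (by simp [hts])
  simp only [hN.lintegral_power_mul, e, one_mul, hN.lintegral_senderGain_mul hd hts]
  rw [← lintegral_tsum_tsum (hN.poisson.aemeasurable_gain_pair α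
      (measurable_retainProbTwoSlots_configKernel d)),
    hN.poisson.lintegral_tsum_pair hlam hα (measurable_retainProbTwoSlots_configKernel d)
      (measurable_pairIndepAverage lam d) (hN.poisson.average_retainProbTwoSlots_self hlam hd)
      (hN.poisson.average_retainProbTwoSlots hlam hd),
    ← ENNReal.ofReal_mul (div_nonneg (by positivity) (by linarith)), ← ENNReal.ofReal_mul hlam.le,
    mul_comm (α * Real.pi / (α - 1)), ← mul_assoc]
  rfl

/-- In one slot the diagonal carries the second fading moment (m+1)/m and a one-point retainment
probability, so it is split off; coinciding locations contribute nothing to the rest. -/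
theorem IsNetwork.lintegral_totalPower_sq (hN : IsNetwork lam m X U H P) (hlam : 0 < lam)
    (hd : 0 < d) (hα : 2 < α) (hm : 0 < m) (t : ℤ) :
    ∫⁻ ω, totalPower d α X U H t ω * totalPower d α X U H t ω ∂P
      = ENNReal.ofReal ((m + 1) / m) *
          ENNReal.ofReal (senderIntensity lam d * (α * Real.pi / (α - 1)))
        + pairTerm lam α fun r => ENNReal.ofReal (retainPairSame lam d r) := by
  unfold totalPower
  rw [lintegral_tsum_mul_tsum (hN.measurable_power d α t) (hN.measurable_power d α t),
    ← hN.tsum_lintegral_gain_sq hlam hd hα, ← hN.tsum_lintegral_gain_pair hlam hd hα,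
    ← ENNReal.tsum_mul_left, ← tsum_tsum_ite_diag]
  · refine tsum_congr fun n => tsum_congr fun k => ?_
    rw [hN.lintegral_power_mul]
    split_ifs with h
    · subst h
      rw [hN.lintegral_fading_sq hm, hN.lintegral_senderGain_sq hd]
    · rw [hN.lintegral_fading_mul hm (p := (t, n)) (q := (t, k)) (by simp [h]), one_mul,
        hN.lintegral_senderGain_pair hd t h]
  · intro n
    simp [retainProbPair, hd.le]

theorem two_mul_le_add_mul_self (a b : ENNReal) : 2 * (a * b) ≤ a * a + b * b := by
  induction a with
  | top => simp
  | coe a =>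
    induction b with
    | top => simp
    | coe b =>
      have h := two_mul_le_add_sq a b
      rw [sq, sq, mul_assoc] at h
      exact_mod_cast h

/-- Integrating 2ab ≤ a² + b² over two independent copies gives the inequality without assuming
finiteness. -/
theorem sq_lintegral_le {f : Ω → ENNReal} (hf : Measurable f) :
    (∫⁻ ω, f ω ∂P) ^ 2 ≤ ∫⁻ ω, f ω * f ω ∂P := by
  have h1 : ∫⁻ ω, ∫⁻ ω', 2 * (f ω * f ω') ∂P ∂P ≤ ∫⁻ ω, ∫⁻ ω', (f ω * f ω + f ω' * f ω') ∂P ∂P := by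
    exact lintegral_mono fun ω => lintegral_mono fun ω' => two_mul_le_add_mul_self _ _
  have h2 : ∀ ω, ∫⁻ ω', 2 * (f ω * f ω') ∂P = 2 * ((∫⁻ ω', f ω' ∂P) * f ω) := by
    intro ω
    rw [lintegral_const_mul _ (by fun_prop), lintegral_const_mul _ hf, mul_comm (f ω)]
  have h3 : ∀ ω, ∫⁻ ω', (f ω * f ω + f ω' * f ω') ∂P = f ω * f ω + ∫⁻ ω', f ω' * f ω' ∂P := by
    intro ω
    rw [lintegral_add_left measurable_const, lintegral_const, measure_univ, mul_one]
  simp only [h2, h3] at h1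
  rw [lintegral_const_mul _ (by fun_prop), lintegral_const_mul _ hf,
    lintegral_add_right _ measurable_const, lintegral_const, measure_univ, mul_one, ← two_mul,
    ← sq] at h1
  exact (ENNReal.mul_le_mul_iff_right two_ne_zero ENNReal.ofNat_ne_top).1 h1

theorem IsNetwork.lintegral_locations_marks (hN : IsNetwork lam m X U H P)
    {F : (ℕ → Plane) × (ℤ × ℕ → ℝ) → ENNReal} (hF : Measurable F) :
    ∫⁻ ω, F (fun n => X n ω, fun p => U p.1 p.2 ω) ∂P
      = ∫⁻ ω', ∫⁻ ω, F (fun n => X n ω', fun p => U p.1 p.2 ω) ∂P ∂P := by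
  have h := hN.lintegral_separate hF (G := fun _ => 1) measurable_const
  simpa only [one_mul, lintegral_const, measure_univ] using h

/-- Without fading, the second moment is smaller, but not below the square of the first moment. -/
theorem IsNetwork.sq_mean_le (hN : IsNetwork lam m X U H P) (hlam : 0 < lam)
    (hd : 0 < d) (hα : 2 < α) (hm : 0 < m) (t : ℤ) :
    ENNReal.ofReal (senderIntensity lam d * (α * Real.pi / (α - 2))) ^ 2
      ≤ ENNReal.ofReal (senderIntensity lam d * (α * Real.pi / (α - 1)))
        + pairTerm lam α fun r => ENNReal.ofReal (retainPairSame lam d r) := by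
  have hg := hN.measurable_senderGain_comp d α t
  have h := sq_lintegral_le (P := P) (f := fun ω => ∑' n, senderGain d α t n
    (fun n => X n ω, fun p => U p.1 p.2 ω)) (Measurable.tsum hg)
  have e1 : ∫⁻ ω, ∑' n, senderGain d α t n (fun n => X n ω, fun p => U p.1 p.2 ω) ∂P
      = ∫⁻ ω, totalPower d α X U H t ω ∂P := by
    unfold totalPower
    rw [lintegral_tsum fun n => (hg n).aemeasurable,
      lintegral_tsum fun n => (hN.measurable_power d α t n).aemeasurable]
    refine tsum_congr fun n => ?_
    have h := hN.lintegral_separate (measurable_senderGain d α t n)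
      (G := fun h => ENNReal.ofReal (h (t, n))) (by fun_prop)
    simp only at h
    rw [h, hN.lintegral_fading hm, one_mul,
      hN.lintegral_locations_marks (measurable_senderGain d α t n)]
  rw [e1, hN.lintegral_totalPower hlam hd hα hm] at h
  refine h.trans (le_of_eq ?_)
  rw [lintegral_tsum_mul_tsum hg hg, ← hN.tsum_lintegral_gain_sq hlam hd hα,
    ← hN.tsum_lintegral_gain_pair hlam hd hα, ← tsum_tsum_ite_diag]
  · refine tsum_congr fun n => tsum_congr fun k => ?_
    rw [hN.lintegral_locations_marks (F := fun z => senderGain d α t n z * senderGain d α t k z)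
      ((measurable_senderGain d α t n).mul (measurable_senderGain d α t k))]
    split_ifs with h
    · subst h
      rw [hN.lintegral_senderGain_sq hd]
    · rw [hN.lintegral_senderGain_pair hd t h]
  · intro n
    simp [retainProbPair, hd.le]

/-! ### Finiteness of the pair terms -/

theorem retainPairSame_le_one {lam d : ℝ} (hlam : 0 < lam) (hd : 0 < d) (r : ℝ) :
    retainPairSame lam d r ≤ 1 := by
  rcases lt_or_ge d r with h | h
  · rw [retainPairSame_eq_integral hlam hd h]
    have h0 := lensArea_nonneg (d := d) (r := r) hd (by linarith)
    have h1 := lensArea_lt_discArea (d := d) (r := r) hd (by linarith)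
    have key : ∀ u ∈ Ioc (0 : ℝ) 1, ∀ v ∈ Ioc (0 : ℝ) 1, ‖Real.exp (-(lam *
        ((discArea d - lensArea d r) * u + (discArea d - lensArea d r) * v
          + lensArea d r * max u v)))‖ ≤ 1 := by
      intro u hu v hv
      rw [Real.norm_eq_abs, Real.abs_exp, Real.exp_le_one_iff, neg_nonpos]
      have : 0 ≤ max u v := le_max_of_le_left hu.1.le
      have h2 := sub_nonneg.2 h1.le
      exact mul_nonneg hlam.le (add_nonneg (add_nonneg (mul_nonneg h2 hu.1.le)
        (mul_nonneg h2 hv.1.le)) (mul_nonneg h0 this))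
    refine (le_abs_self _).trans ?_
    have hc : ∀ F : ℝ → ℝ, (∀ u ∈ Ioc (0 : ℝ) 1, ‖F u‖ ≤ 1) → ‖∫ u in (0 : ℝ)..1, F u‖ ≤ 1 := by
      intro F hF
      have := intervalIntegral.norm_integral_le_of_norm_le_const (a := 0) (b := 1) (f := F) (C := 1)
        (by rwa [uIoc_of_le zero_le_one])
      simpa using this
    exact hc _ fun u hu => hc _ fun v hv => key u hu v hv
  · rw [retainPairSame, if_neg h.not_gt]
    exact zero_le_one

/-- Bounding `f` by 1 leaves a product of two finite integrals of the path gain. -/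
theorem pairTerm_ne_top {f : ℝ → ENNReal} (hα : 2 < α) (hf : Measurable f) (h1 : ∀ r, f r ≤ 1) :
    pairTerm lam α f ≠ ⊤ := by
  have hm := measurable_pathGain α
  rw [pairTerm, ← lintegral_pair hα hf]
  refine ENNReal.mul_ne_top (ENNReal.pow_ne_top ENNReal.ofReal_ne_top) (ne_top_of_le_ne_top
    (b := ∫⁻ x : Plane, ∫⁻ y : Plane,
      ENNReal.ofReal (pathGain α ‖x‖) * ENNReal.ofReal (pathGain α ‖y‖)) ?_ ?_)
  · simp only [lintegral_const_mul' _ _ ENNReal.ofReal_ne_top]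
    rw [lintegral_mul_const _ (by fun_prop), lintegral_pathGain hα]
    exact ENNReal.mul_ne_top ENNReal.ofReal_ne_top ENNReal.ofReal_ne_top
  · exact lintegral_mono fun x => lintegral_mono fun y => mul_le_of_le_one_right' (h1 _)

end Network

/-! ### Passage to real-valued moments -/

/-- Agreement almost everywhere is enough, which accommodates the radius d/2 where the closed form
for two slots is not available. -/
theorem toReal_pairTerm {lam α : ℝ} (hlam : 0 < lam) (hα : 2 < α) {f : ℝ → ENNReal}
    (hf : Measurable f) {g : ℝ → ℝ}
    (hfg : ∀ᵐ r ∂(volume.restrict (Ioi (0 : ℝ))), 0 ≤ g (2 * r) ∧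
      f (2 * r) = ENNReal.ofReal (g (2 * r))) :
    (pairTerm lam α f).toReal
      = 8 * Real.pi * ∫ r in Ioi (0 : ℝ), ellipticIntegral α r * (lam ^ 2 * g (2 * r)) * r := by
  have hp := measurable_pairGain α
  have h1 : ∫⁻ r in Ioi (0 : ℝ), ENNReal.ofReal (ellipticIntegral α r) * f (2 * r) *
      ENNReal.ofReal r = ∫⁻ r in Ioi (0 : ℝ), pairGain α r * f (2 * r) * ENNReal.ofReal r :=
    setLIntegral_congr_fun measurableSet_Ioi fun r hr => by
      rw [ellipticIntegral_eq hα hr]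
  have h2 : ∫ r in Ioi (0 : ℝ), ellipticIntegral α r * (lam ^ 2 * g (2 * r)) * r
      = ∫ r in Ioi (0 : ℝ), lam ^ 2 * (pairGain α r * f (2 * r) * ENNReal.ofReal r).toReal := by
    refine integral_congr_ae ?_
    filter_upwards [hfg, ae_restrict_mem measurableSet_Ioi] with r h hr
    have hr0 : 0 < r := hr
    rw [h.2, ENNReal.toReal_mul, ENNReal.toReal_mul, ENNReal.toReal_ofReal h.1,
      ENNReal.toReal_ofReal hr0.le, ellipticIntegral_eq_toReal hα hr0]
    ring
  rw [h2, integral_const_mul, integral_toReal (by fun_prop), pairTerm, h1, ENNReal.toReal_mul,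
    ENNReal.toReal_mul, ENNReal.toReal_pow, ENNReal.toReal_ofReal hlam.le,
    ENNReal.toReal_ofReal (by positivity)]
  · ring
  · filter_upwards [hfg] with r h
    rw [h.2]
    exact ENNReal.mul_lt_top (ENNReal.mul_lt_top (pairGain_lt_top hα r) ENNReal.ofReal_lt_top)
      ENNReal.ofReal_lt_top

theorem toReal_pairTerm_retainPairSame {lam d α : ℝ} (hlam : 0 < lam) (hd : 0 < d) (hα : 2 < α) :
    (pairTerm lam α fun r => ENNReal.ofReal (retainPairSame lam d r)).toReal
      = 8 * Real.pi * ∫ r in Ioi (d / 2), ellipticIntegral α r * productDensity lam d (2 * r) * r := by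
  have hs := measurable_retainPairSame lam d
  rw [toReal_pairTerm hlam hα (by fun_prop) (g := retainPairSame lam d)
    (Eventually.of_forall fun r => ⟨retainPairSame_nonneg hlam hd _, rfl⟩)]
  congr 1
  refine setIntegral_eq_of_subset_of_forall_sdiff_eq_zero measurableSet_Ioi
    (Ioi_subset_Ioi (by linarith)) fun r hr => ?_
  have h : ¬ d < 2 * r := by
    have := hr.2
    simp only [mem_Ioi, not_lt] at this ⊢
    linarith
  rw [retainPairSame, if_neg h]
  ring

theorem toReal_pairTerm_pairIndepAverage {lam d α : ℝ} (hlam : 0 < lam) (hd : 0 < d)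
    (hα : 2 < α) :
    (pairTerm lam α (pairIndepAverage lam d)).toReal
      = 8 * Real.pi * ∫ r in Ioi (0 : ℝ),
        ellipticIntegral α r * (lam ^ 2 * retainPairIndep lam d (2 * r)) * r := by
  refine toReal_pairTerm hlam hα (measurable_pairIndepAverage lam d) ?_
  filter_upwards [ae_restrict_mem measurableSet_Ioi,
    ae_restrict_of_ae (Measure.ae_ne volume (d / 2))] with r hr hrd
  have hr0 : 0 < 2 * r := mul_pos two_pos hr
  have hne : 2 * r ≠ d := fun h => hrd (by linarith)
  exact ⟨retainPairIndep_nonneg hlam hd hr0 hne, pairIndepAverage_eq hlam hd hr0 hne⟩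

theorem receivedPower_eq_toReal {Ω : Type*} {d α : ℝ} {X : ℕ → Ω → Plane}
    {U H : ℤ → ℕ → Ω → ℝ} {t : ℤ} {n : ℕ} {ω : Ω} (hH : 0 ≤ H t n ω) :
    receivedPower d α X U H t n ω = (ENNReal.ofReal (H t n ω) *
      senderGain d α t n (fun n => X n ω, fun p => U p.1 p.2 ω)).toReal := by
  rw [ENNReal.toReal_mul, ENNReal.toReal_ofReal hH, receivedPower]
  by_cases h : Retained d X U t n ω
  · have h' : ((fun n => X n ω, fun p => U p.1 p.2 ω) : (ℕ → Plane) × (ℤ × ℕ → ℝ)) ∈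
        {z | RetainedAt d z.1 z.2 t n} := h
    rw [if_pos h, senderGain, indicator_of_mem h', ENNReal.toReal_ofReal
      (pathGain_nonneg (norm_nonneg _))]
  · have h' : ((fun n => X n ω, fun p => U p.1 p.2 ω) : (ℕ → Plane) × (ℤ × ℕ → ℝ)) ∉
        {z | RetainedAt d z.1 z.2 t n} := h
    rw [if_neg h, senderGain, indicator_of_notMem h', ENNReal.toReal_zero, mul_zero]

section Network

variable {Ω : Type*} [MeasurableSpace Ω] {P : Measure Ω} [IsProbabilityMeasure P] {lam m d α : ℝ}
  {X : ℕ → Ω → Plane} {U H : ℤ → ℕ → Ω → ℝ}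

theorem IsNetwork.ae_totalPower_lt_top (hN : IsNetwork lam m X U H P) (hlam : 0 < lam) (hd : 0 < d)
    (hα : 2 < α) (hm : 0 < m) (t : ℤ) : ∀ᵐ ω ∂P, totalPower d α X U H t ω < ⊤ :=
  ae_lt_top (hN.measurable_totalPower d α t) (by
    rw [hN.lintegral_totalPower hlam hd hα hm]; exact ENNReal.ofReal_ne_top)

theorem IsNetwork.ae_summable (hN : IsNetwork lam m X U H P) (hlam : 0 < lam) (hd : 0 < d)
    (hα : 2 < α) (hm : 0 < m) (t : ℤ) :
    ∀ᵐ ω ∂P, Summable fun n => receivedPower d α X U H t n ω := by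
  filter_upwards [hN.ae_totalPower_lt_top hlam hd hα hm t, hN.ae_fading_nonneg] with ω h hH
  simp only [receivedPower_eq_toReal (hH t _)]
  exact ENNReal.summable_toReal h.ne

theorem IsNetwork.interference_ae_eq (hN : IsNetwork lam m X U H P) (hlam : 0 < lam) (hd : 0 < d)
    (hα : 2 < α) (hm : 0 < m) (t : ℤ) :
    interference d α X U H t =ᵐ[P] fun ω => (totalPower d α X U H t ω).toReal := by
  filter_upwards [hN.ae_totalPower_lt_top hlam hd hα hm t, hN.ae_fading_nonneg] with ω h hH
  simp only [interference, receivedPower_eq_toReal (hH t _)]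
  exact (ENNReal.tsum_toReal_eq (ENNReal.ne_top_of_tsum_ne_top h.ne)).symm

theorem IsNetwork.lintegral_totalPower_sq_ne_top (hN : IsNetwork lam m X U H P) (hlam : 0 < lam)
    (hd : 0 < d) (hα : 2 < α) (hm : 0 < m) (t : ℤ) :
    ∫⁻ ω, totalPower d α X U H t ω * totalPower d α X U H t ω ∂P ≠ ⊤ := by
  have hs := measurable_retainPairSame lam d
  rw [hN.lintegral_totalPower_sq hlam hd hα hm]
  refine ENNReal.add_ne_top.2 ⟨ENNReal.mul_ne_top ENNReal.ofReal_ne_top ENNReal.ofReal_ne_top,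
    pairTerm_ne_top hα (by fun_prop) fun r => ?_⟩
  rw [← ENNReal.ofReal_one]
  exact ENNReal.ofReal_le_ofReal (retainPairSame_le_one hlam hd r)

theorem IsNetwork.memLp_interference (hN : IsNetwork lam m X U H P) (hlam : 0 < lam) (hd : 0 < d)
    (hα : 2 < α) (hm : 0 < m) (t : ℤ) : MemLp (interference d α X U H t) 2 P := by
  have hT := hN.measurable_totalPower d α t
  refine MemLp.ae_eq (hN.interference_ae_eq hlam hd hα hm t).symm ?_
  rw [memLp_two_iff_integrable_sq hT.ennreal_toReal.aestronglyMeasurable]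
  have h := integrable_toReal_of_lintegral_ne_top (hT.mul hT).aemeasurable
    (hN.lintegral_totalPower_sq_ne_top hlam hd hα hm t)
  simp only [Pi.mul_apply, ENNReal.toReal_mul] at h
  simpa only [sq] using h

theorem IsNetwork.integral_interference (hN : IsNetwork lam m X U H P) (hlam : 0 < lam)
    (hd : 0 < d) (hα : 2 < α) (hm : 0 < m) (t : ℤ) :
    ∫ ω, interference d α X U H t ω ∂P = senderIntensity lam d * α * Real.pi / (α - 2) := by
  rw [integral_congr_ae (hN.interference_ae_eq hlam hd hα hm t),
    integral_toReal (hN.measurable_totalPower d α t).aemeasurable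
      (hN.ae_totalPower_lt_top hlam hd hα hm t), hN.lintegral_totalPower hlam hd hα hm,
    ENNReal.toReal_ofReal]
  · ring
  · exact mul_nonneg (mul_pos hlam (retainOnce_pos hlam hd)).le
      (div_nonneg (by positivity) (by linarith))

theorem IsNetwork.integral_interference_mul (hN : IsNetwork lam m X U H P) (hlam : 0 < lam)
    (hd : 0 < d) (hα : 2 < α) (hm : 0 < m) (t s : ℤ) :
    ∫ ω, (interference d α X U H t * interference d α X U H s) ω ∂P
      = (∫⁻ ω, totalPower d α X U H t ω * totalPower d α X U H s ω ∂P).toReal := by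
  have ht := hN.ae_totalPower_lt_top hlam hd hα hm t
  have hs := hN.ae_totalPower_lt_top hlam hd hα hm s
  have hm2 : AEMeasurable (fun ω => totalPower d α X U H t ω * totalPower d α X U H s ω) P :=
    ((hN.measurable_totalPower d α t).mul (hN.measurable_totalPower d α s)).aemeasurable
  rw [← integral_toReal hm2]
  · refine integral_congr_ae ?_
    filter_upwards [hN.interference_ae_eq hlam hd hα hm t,
      hN.interference_ae_eq hlam hd hα hm s] with ω h1 h2
    rw [Pi.mul_apply, h1, h2, ENNReal.toReal_mul]
  · filter_upwards [ht, hs] with ω h1 h2 using ENNReal.mul_lt_top h1 h2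

theorem IsNetwork.covariance_interference (hN : IsNetwork lam m X U H P) (hlam : 0 < lam)
    (hd : 0 < d) (hα : 2 < α) (hm : 0 < m) {t s : ℤ} (hts : t ≠ s) :
    cov[interference d α X U H t, interference d α X U H s; P]
      = lam * retainTwice lam d * (α * Real.pi / (α - 1))
          + 8 * Real.pi * (∫ r in Ioi (0 : ℝ),
              ellipticIntegral α r * (lam ^ 2 * retainPairIndep lam d (2 * r)) * r)
          - (senderIntensity lam d * α * Real.pi / (α - 2)) ^ 2 := by
  -- The cross moment is finite because 2ab ≤ a² + b² and both second moments are.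
  have hfin : ∫⁻ ω, totalPower d α X U H t ω * totalPower d α X U H s ω ∂P ≠ ⊤ := by
    have ht : Measurable fun ω => totalPower d α X U H t ω * totalPower d α X U H t ω :=
      (hN.measurable_totalPower d α t).mul (hN.measurable_totalPower d α t)
    refine ne_top_of_le_ne_top (ENNReal.add_ne_top.2
      ⟨hN.lintegral_totalPower_sq_ne_top hlam hd hα hm t,
        hN.lintegral_totalPower_sq_ne_top hlam hd hα hm s⟩) ?_
    rw [← lintegral_add_left ht]
    refine lintegral_mono fun ω => le_trans ?_ (two_mul_le_add_mul_self _ _)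
    exact le_mul_of_one_le_left' one_le_two
  rw [covariance_eq_sub (hN.memLp_interference hlam hd hα hm t)
    (hN.memLp_interference hlam hd hα hm s), hN.integral_interference_mul hlam hd hα hm,
    hN.integral_interference hlam hd hα hm, hN.integral_interference hlam hd hα hm, ← sq]
  rw [hN.lintegral_totalPower_mul hlam hd hα hm hts] at hfin ⊢
  rw [ENNReal.toReal_add (ENNReal.add_ne_top.1 hfin).1 (ENNReal.add_ne_top.1 hfin).2,
    toReal_pairTerm_pairIndepAverage hlam hd hα, ENNReal.toReal_ofReal]
  exact mul_nonneg (mul_nonneg hlam.le (retainTwice_nonneg hlam hd))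
    (div_nonneg (by positivity) (by linarith))

theorem IsNetwork.variance_interference (hN : IsNetwork lam m X U H P) (hlam : 0 < lam)
    (hd : 0 < d) (hα : 2 < α) (hm : 0 < m) (t : ℤ) :
    Var[interference d α X U H t; P]
      = senderIntensity lam d * ((m + 1) * α * Real.pi / (m * (α - 1)))
          + 8 * Real.pi * (∫ r in Ioi (d / 2),
              ellipticIntegral α r * productDensity lam d (2 * r) * r)
          - (senderIntensity lam d * α * Real.pi / (α - 2)) ^ 2 := by
  have hfin := hN.lintegral_totalPower_sq_ne_top hlam hd hα hm t
  have hI := hN.memLp_interference hlam hd hα hm t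
  have hA : 0 ≤ senderIntensity lam d * (α * Real.pi / (α - 1)) :=
    mul_nonneg (mul_pos hlam (retainOnce_pos hlam hd)).le (div_nonneg (by positivity) (by linarith))
  rw [← covariance_self hI.aemeasurable, covariance_eq_sub hI hI,
    hN.integral_interference_mul hlam hd hα hm, hN.integral_interference hlam hd hα hm, ← sq]
  rw [hN.lintegral_totalPower_sq hlam hd hα hm] at hfin ⊢
  rw [ENNReal.toReal_add (ENNReal.add_ne_top.1 hfin).1 (ENNReal.add_ne_top.1 hfin).2,
    toReal_pairTerm_retainPairSame hlam hd hα, ENNReal.toReal_mul,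
    ENNReal.toReal_ofReal (by positivity), ENNReal.toReal_ofReal hA]
  have : α - 1 ≠ 0 := by linarith
  field_simp

/-- Since (m+1)/m = 1 + 1/m, the variance exceeds a quantity that is nonnegative without fading by
1/m times the positive diagonal term. -/
theorem IsNetwork.variance_interference_pos (hN : IsNetwork lam m X U H P) (hlam : 0 < lam)
    (hd : 0 < d) (hα : 2 < α) (hm : 0 < m) (t : ℤ) : 0 < Var[interference d α X U H t; P] := by
  have hs := mul_pos hlam (retainOnce_pos hlam hd)
  have hA : 0 < senderIntensity lam d * (α * Real.pi / (α - 1)) :=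
    mul_pos hs (div_pos (by positivity) (by linarith))
  have hM : 0 ≤ senderIntensity lam d * (α * Real.pi / (α - 2)) :=
    mul_nonneg hs.le (div_nonneg (by positivity) (by linarith))
  have hB : pairTerm lam α (fun r => ENNReal.ofReal (retainPairSame lam d r)) ≠ ⊤ := by
    have h := hN.lintegral_totalPower_sq_ne_top hlam hd hα hm t
    rw [hN.lintegral_totalPower_sq hlam hd hα hm] at h
    exact (ENNReal.add_ne_top.1 h).2
  have h := ENNReal.toReal_mono (ENNReal.add_ne_top.2 ⟨ENNReal.ofReal_ne_top, hB⟩)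
    (hN.sq_mean_le hlam hd hα hm t)
  rw [ENNReal.toReal_pow, ENNReal.toReal_ofReal hM, ENNReal.toReal_add ENNReal.ofReal_ne_top hB,
    ENNReal.toReal_ofReal hA.le, toReal_pairTerm_retainPairSame hlam hd hα] at h
  have e1 : senderIntensity lam d * ((m + 1) * α * Real.pi / (m * (α - 1)))
      = senderIntensity lam d * (α * Real.pi / (α - 1))
        + senderIntensity lam d * (α * Real.pi / (α - 1)) / m := by
    have : α - 1 ≠ 0 := by linarith
    field_simp
  have e2 : senderIntensity lam d * α * Real.pi / (α - 2)
      = senderIntensity lam d * (α * Real.pi / (α - 2)) := by ring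
  rw [hN.variance_interference hlam hd hα hm, e1, e2]
  have := div_pos hA hm
  linarith

end Network

end Matern

end

theorem corollary1 {Ω : Type*} [MeasurableSpace Ω] (P : Measure Ω) [IsProbabilityMeasure P]
    (lam d α m : ℝ) (hlam : 0 < lam) (hd : 0 < d) (hα : 2 < α) (hm : 0 < m)
    (X : ℕ → Ω → Plane) (U H : ℤ → ℕ → Ω → ℝ) (hN : IsNetwork lam m X U H P)
    (t₁ t₂ : ℤ) (ht : t₁ ≠ t₂) :
    (∀ t : ℤ, (∀ᵐ ω ∂P, Summable fun n => receivedPower d α X U H t n ω) ∧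
      MemLp (interference d α X U H t) 2 P ∧ 0 < Var[interference d α X U H t; P]) ∧
    pearson (interference d α X U H t₁) (interference d α X U H t₂) P =
      (lam * retainTwice lam d * (α * Real.pi / (α - 1))
          + 8 * Real.pi * (∫ r in Ioi (0 : ℝ),
              ellipticIntegral α r * (lam ^ 2 * retainPairIndep lam d (2 * r)) * r)
          - (senderIntensity lam d * α * Real.pi / (α - 2)) ^ 2) /
      (senderIntensity lam d * ((m + 1) * α * Real.pi / (m * (α - 1)))
          + 8 * Real.pi * (∫ r in Ioi (d / 2),
              ellipticIntegral α r * productDensity lam d (2 * r) * r)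
          - (senderIntensity lam d * α * Real.pi / (α - 2)) ^ 2) := by
  refine ⟨fun t => ⟨hN.ae_summable hlam hd hα hm t, hN.memLp_interference hlam hd hα hm t,
    hN.variance_interference_pos hlam hd hα hm t⟩, ?_⟩
  have h1 := hN.variance_interference hlam hd hα hm t₁
  have h2 := hN.variance_interference hlam hd hα hm t₂
  have hpos := hN.variance_interference_pos hlam hd hα hm t₁
  -- The variance formula does not involve the slot, so the root of the product of the two variances
  -- is one positive variance.
  rw [pearson, hN.covariance_interference hlam hd hα hm ht, h2, ← h1, Real.sqrt_mul_self hpos.le]
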